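/- The identification of two distinct vertices $u,v$ of a graph $G$ replaces $u$ and $v$ by one new vertex, which is made adjacent to every other vertex that is a neighbour of $u$ or of $v$. A split graph is a graph whose vertex set can be partitioned into a non-empty clique $K$ and a (possibly empty) independent set $I$. In the problem Split-Identification the input is a finite simple graph $G$ on $n\ge 1$ vertices and an integer $k\ge 0$, and the question is whether $G$ can be transformed into a split graph by at most $k$ vertex identifications. Theorem. Split-Identification is solvable in $k^{\mathcal{O}(k)}\cdot n^{\mathcal{O}(1)}$ time. That is, there are a single algorithm and constants $C,c,d\in\mathbb{N}$ such that on every instance $(G,k)$ the algorithm halts with the correct answer after at most $C\cdot k^{ck}\cdot n^{d}$ steps (with $0^0=1$). Here an algorithm is a program of a random access machine whose memory cells hold natural numbers, with addition, truncated subtraction, indirect addressing and tests for zero as its elementary operations, each at unit cost; the input is given by $n$, $k$ and the adjacency matrix of $G$. -/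

import Mathlib

/-! ### Vertex identification in graphs -/

namespace SimpleGraph

/-- A split graph: the vertex set has a partition into a nonempty clique `K` and a (possibly empty)
independent set `Kᶜ`. -/
def IsSplitGraph {V : Type} (G : SimpleGraph V) : Prop :=
  ∃ K : Set V, K.Nonempty ∧ G.IsClique K ∧ G.IsIndepSet Kᶜ

/-- The identification of `u` and `v`: these two vertices are replaced by one new vertex (`none`),
which is made adjacent to all the other vertices that are neighbours of `u` or of `v`. -/
def identify {V : Type} (G : SimpleGraph V) (u v : V) :
    SimpleGraph (Option {x : V // x ≠ u ∧ x ≠ v}) where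
  Adj
    | none, none => False
    | none, some x => G.Adj u x ∨ G.Adj v x
    | some x, none => G.Adj u x ∨ G.Adj v x
    | some x, some y => G.Adj x y
  symm := ⟨by
    rintro (_ | x) (_ | y) h
    · exact h
    · exact h
    · exact h
    · exact G.adj_symm h⟩
  loopless := ⟨by
    rintro (_ | x) h
    · exact h
    · exact G.loopless.irrefl _ h⟩

/-- `G` is transformed into (a graph isomorphic to) `H` by a sequence of exactly `j`
identifications of two distinct vertices. -/
def IdentifiesIn {W : Type} (H : SimpleGraph W) : ℕ → ∀ {V : Type}, SimpleGraph V → Prop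
  | 0, _, G => Nonempty (G ≃g H)
  | j + 1, V, G => ∃ u v : V, u ≠ v ∧ IdentifiesIn H j (G.identify u v)

/-- The question of `𝓗`-Identification on the instance `(G, k)`: can `G` be transformed into some
graph of the class `𝓗` by at most `k` identifications? -/
def ClassIdentification (𝓗 : ∀ {W : Type}, SimpleGraph W → Prop) {V : Type} (G : SimpleGraph V)
    (k : ℕ) : Prop :=
  ∃ (W : Type) (H : SimpleGraph W), 𝓗 H ∧ ∃ j ≤ k, IdentifiesIn H j G

/-- The question of Split-Identification on the instance `(G, k)`. -/
def SplitIdentification {V : Type} (G : SimpleGraph V) (k : ℕ) : Prop :=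
  ClassIdentification (fun H => H.IsSplitGraph) G k

end SimpleGraph

/-! ### Random access machine programs with a step count

Memory cells hold natural numbers. The arithmetic is addition and truncated subtraction, there is
indirect addressing, and every elementary operation takes one step. Multiplication is not an
elementary operation, so running times are polynomially related to those on Turing machines.
A program text is finite, so it names finitely many registers and arrays. -/

namespace RAM

/-- The memory: registers `reg x`, and arrays `arr a` with cells `arr a 0, arr a 1, …`. -/
@[ext]
structure State where
  reg : ℕ → ℕ
  arr : ℕ → ℕ → ℕ

/-- Expressions: constants, registers, the cell of array `a` at a computed index, sums and
truncated differences. -/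
inductive Expr where
  | const (c : ℕ)
  | reg (x : ℕ)
  | get (a : ℕ) (i : Expr)
  | add (e₁ e₂ : Expr)
  | sub (e₁ e₂ : Expr)

/-- The value of an expression. -/
def Expr.eval (s : State) : Expr → ℕ
  | .const c => c
  | .reg x => s.reg x
  | .get a i => s.arr a (i.eval s)
  | .add e₁ e₂ => e₁.eval s + e₂.eval s
  | .sub e₁ e₂ => e₁.eval s - e₂.eval s

/-- The number of steps for evaluating an expression: one for each node. -/
def Expr.cost : Expr → ℕ
  | .const _ => 1
  | .reg _ => 1
  | .get _ i => i.cost + 1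
  | .add e₁ e₂ => e₁.cost + e₂.cost + 1
  | .sub e₁ e₂ => e₁.cost + e₂.cost + 1

/-- Programs: `assign x e` puts the value of `e` into register `x`, and `store a i e` puts it into
the cell of array `a` at the index given by `i`. The tests of `ite` and `loop` (a while loop) hold
when the value of the expression is not zero. -/
inductive Program where
  | skip
  | assign (x : ℕ) (e : Expr)
  | store (a : ℕ) (i e : Expr)
  | seq (p q : Program)
  | ite (e : Expr) (p q : Program)
  | loop (e : Expr) (p : Program)

/-- The state after writing `v` into register `x`. -/
def State.setReg (s : State) (x v : ℕ) : State :=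
  { s with reg := Function.update s.reg x v }

/-- The state after writing `v` into the cell of array `a` at index `i`. -/
def State.setArr (s : State) (a i v : ℕ) : State :=
  { s with arr := Function.update s.arr a (Function.update (s.arr a) i v) }

/-- `Runs p s t s'`: program `p`, started in state `s`, halts in state `s'` after exactly `t`
steps. Execution is deterministic. -/
inductive Runs : Program → State → ℕ → State → Prop where
  | skip (s : State) : Runs .skip s 1 s
  | assign (s : State) (x : ℕ) (e : Expr) :
      Runs (.assign x e) s (e.cost + 1) (s.setReg x (e.eval s))
  | store (s : State) (a : ℕ) (i e : Expr) :
      Runs (.store a i e) s (i.cost + e.cost + 1) (s.setArr a (i.eval s) (e.eval s))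
  | seq {p q : Program} {s s' s'' : State} {t t' : ℕ} :
      Runs p s t s' → Runs q s' t' s'' → Runs (.seq p q) s (t + t') s''
  | iteTrue {e : Expr} {p q : Program} {s s' : State} {t : ℕ} :
      e.eval s ≠ 0 → Runs p s t s' → Runs (.ite e p q) s (e.cost + 1 + t) s'
  | iteFalse {e : Expr} {p q : Program} {s s' : State} {t : ℕ} :
      e.eval s = 0 → Runs q s t s' → Runs (.ite e p q) s (e.cost + 1 + t) s'
  | loopTrue {e : Expr} {p : Program} {s s' s'' : State} {t t' : ℕ} :
      e.eval s ≠ 0 → Runs p s t s' → Runs (.loop e p) s' t' s'' →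
        Runs (.loop e p) s (e.cost + 1 + t + t') s''
  | loopFalse {e : Expr} {p : Program} {s : State} :
      e.eval s = 0 → Runs (.loop e p) s (e.cost + 1) s

open Classical in
/-- The initial memory for the instance `(G, k)`, where `G` has the vertices `0, …, n - 1`:
register `0` holds `n`, register `1` holds `k`, array `0` holds the `n × n` adjacency matrix of `G`
row by row, and everything else is zero. -/
noncomputable def input {n : ℕ} (G : SimpleGraph (Fin n)) (k : ℕ) : State where
  reg x := if x = 0 then n else if x = 1 then k else 0
  arr a p := if a = 0 ∧ ∃ i j : Fin n, p = i * n + j ∧ G.Adj i j then 1 else 0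

/-- On the instance `(G, k)` the program halts within `T` steps, and register `0` then holds the
correct answer to the question `Q`: `1` for yes and `0` for no. -/
def DecidesWithin (P : Program) {n : ℕ} (G : SimpleGraph (Fin n)) (k : ℕ) (Q : Prop) (T : ℕ) :
    Prop :=
  ∃ (t : ℕ) (s : State), Runs P (input G k) t s ∧ t ≤ T ∧
    (Q → s.reg 0 = 1) ∧ (¬ Q → s.reg 0 = 0)

end RAM

/-! A sequence of identifications is a quotient map, and its length is the drop in the number of
vertices. For a split target it suffices to keep one representative in each fibre over the
independent side and to move the remaining vertices of these fibres into one clique class. So the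
problem asks for an independent set A and a partition of B = V \ A into pairwise adjacent classes
with |B| ≤ (number of classes) + k (`SplitIdentification.exists_isSolution`,
`IsSolution.splitIdentification`). If A is chosen as large as possible, every vertex of B has a
neighbour in A (`IsNatSolution.exists_dominating`).

At most 2k vertices lie in classes with more than one element. Deleting them leaves a split graph,
so they meet every induced 2K₂, C₄ and C₅. Hence a greedily built set S of whole obstructions has at
most 10k elements. Outside S the graph is split, and a degree threshold d separates a clique from an
independent set I (`exists_degree_threshold`). The clique contains at most one vertex r of A. Given
d, r and A ∩ S, the set A is determined: by domination, a vertex of I is outside A exactly when it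
has a neighbour in A ∩ S or is adjacent to r. Only 2k + 1 vertices of I can be outside A, because I
is independent while the singleton classes form a clique. So the set P of vertices of B not in the
clique part R has at most 12k + 1 elements, and their class labels can be guessed.

The set R may be large. A vertex of R is bad if it has no neighbour in some class contained in P.
Bad vertices are not singletons, so there are at most 2k of them, and their labels can be guessed as
well. The other vertices of R can be made singletons, except for the first one, which absorbs what
is left of the classes that contained such vertices (`exists_label`). In this normal form everything
is computable from d, r and three words of 14k + 1 digits in base Q = 28k + 5. The algorithm tries
all of them and checks each candidate, so a false positive is impossible.

For the running time, every loop makes at most N = Q ^ M * (n + 1) iterations, where M = 14k + 1, so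
a fixed program runs within a fixed power of N, and this has the required form. Apart from the
construction of S and of a few constants, the program is assembled from bounded sums, whose
correctness is proved compositionally by `Ev` and `Dec`. -/

namespace RAM

/-! ### Executions with a crude time bound -/

/-- A syntactic degree: if every loop inside `p` makes at most `N` iterations (`2 ≤ N`), then `p`
takes at most `N ^ p.deg` steps. -/
def Program.deg : Program → ℕ
  | .skip => 1
  | .assign _ e => e.cost + 1
  | .store _ i e => i.cost + e.cost + 1
  | .seq p q => p.deg + q.deg + 1
  | .ite e p q => e.cost + p.deg + q.deg + 2
  | .loop e p => e.cost + p.deg + 4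

/-- `p` leads from `s` to `s'` within `N ^ p.deg` steps. -/
def Exec (N : ℕ) (p : Program) (s s' : State) : Prop :=
  ∃ t, Runs p s t s' ∧ t ≤ N ^ p.deg

section Exec

variable {N : ℕ}

/-- Since `N` is at least 2, a sum of powers is absorbed by one more factor. This makes time bounds
compose by adding syntactic degrees, without tracking any polynomial. -/
theorem pow_add_pow_le (hN : 2 ≤ N) (a b : ℕ) : N ^ a + N ^ b ≤ N ^ (a + b + 1) := by
  have ha : N ^ a ≤ N ^ (a + b) := Nat.pow_le_pow_right (by omega) (by omega)
  have hb : N ^ b ≤ N ^ (a + b) := Nat.pow_le_pow_right (by omega) (by omega)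
  calc N ^ a + N ^ b ≤ N ^ (a + b) * 2 := by omega
    _ ≤ N ^ (a + b) * N := Nat.mul_le_mul_left _ hN
    _ = _ := (pow_succ _ _).symm

theorem le_pow_self_of_two_le (hN : 2 ≤ N) (a : ℕ) : a ≤ N ^ a :=
  (Nat.lt_pow_self (by omega)).le

theorem Exec.skip (hN : 2 ≤ N) (s : State) : Exec N .skip s s :=
  ⟨1, .skip s, Nat.one_le_pow _ _ (by omega)⟩

theorem Exec.assign (hN : 2 ≤ N) (s : State) (x : ℕ) (e : Expr) :
    Exec N (.assign x e) s (s.setReg x (e.eval s)) :=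
  ⟨_, .assign s x e, le_pow_self_of_two_le hN _⟩

theorem Exec.store (hN : 2 ≤ N) (s : State) (a : ℕ) (i e : Expr) :
    Exec N (.store a i e) s (s.setArr a (i.eval s) (e.eval s)) :=
  ⟨_, .store s a i e, le_pow_self_of_two_le hN _⟩

theorem Exec.seq (hN : 2 ≤ N) {p q : Program} {s s' s'' : State} (hp : Exec N p s s')
    (hq : Exec N q s' s'') : Exec N (.seq p q) s s'' := by
  obtain ⟨t, h, ht⟩ := hp
  obtain ⟨t', h', ht'⟩ := hq
  exact ⟨_, .seq h h', (Nat.add_le_add ht ht').trans (pow_add_pow_le hN _ _)⟩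

theorem Exec.iteTrue (hN : 2 ≤ N) {e : Expr} {p q : Program} {s s' : State}
    (he : e.eval s ≠ 0) (hp : Exec N p s s') : Exec N (.ite e p q) s s' := by
  obtain ⟨t, h, ht⟩ := hp
  refine ⟨_, .iteTrue he h, (Nat.add_le_add (le_pow_self_of_two_le hN _) ht).trans
    ((pow_add_pow_le hN _ _).trans (Nat.pow_le_pow_right (by omega) ?_))⟩
  simp only [Program.deg]; omega

theorem Exec.iteFalse (hN : 2 ≤ N) {e : Expr} {p q : Program} {s s' : State}
    (he : e.eval s = 0) (hq : Exec N q s s') : Exec N (.ite e p q) s s' := by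
  obtain ⟨t, h, ht⟩ := hq
  refine ⟨_, .iteFalse he h, (Nat.add_le_add (le_pow_self_of_two_le hN _) ht).trans
    ((pow_add_pow_le hN _ _).trans (Nat.pow_le_pow_right (by omega) ?_))⟩
  simp only [Program.deg]; omega

/-- A loop that makes `m ≤ N` iterations, with an invariant. -/
theorem Exec.loop (hN : 2 ≤ N) {e : Expr} {p : Program} {m : ℕ} (hm : m ≤ N)
    (I : ℕ → State → Prop)
    (step : ∀ i < m, ∀ s, I i s → e.eval s ≠ 0 ∧ ∃ s', Exec N p s s' ∧ I (i + 1) s')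
    (hend : ∀ s, I m s → e.eval s = 0) {s : State} (h0 : I 0 s) :
    ∃ s', Exec N (.loop e p) s s' ∧ I m s' := by
  have key : ∀ j i, i + j = m → ∀ s, I i s → ∃ t s', Runs (.loop e p) s t s' ∧ I m s' ∧
      t ≤ j * (e.cost + 1 + N ^ p.deg) + (e.cost + 1) := by
    intro j
    induction j with
    | zero =>
      intro i hi s hs
      obtain rfl : i = m := by omega
      exact ⟨_, s, .loopFalse (hend s hs), hs, by omega⟩
    | succ j ih =>
      intro i hi s hs
      obtain ⟨he, s', ⟨t, hr, ht⟩, hI⟩ := step i (by omega) s hs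
      obtain ⟨t', s'', hr', hI', ht'⟩ := ih (i + 1) (by omega) s' hI
      refine ⟨_, s'', .loopTrue he hr hr', hI', ?_⟩
      rw [Nat.succ_mul]; omega
  obtain ⟨t, s', hr, hI, ht⟩ := key m 0 (by omega) s h0
  refine ⟨s', ⟨t, hr, ht.trans ?_⟩, hI⟩
  have h1 : e.cost + 1 + N ^ p.deg ≤ N ^ (e.cost + 1 + p.deg + 1) :=
    (Nat.add_le_add_right (le_pow_self_of_two_le hN _) _).trans (pow_add_pow_le hN _ _)
  have h2 : e.cost + 1 ≤ N ^ (e.cost + 1 + p.deg + 2) :=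
    (le_pow_self_of_two_le hN _).trans (Nat.pow_le_pow_right (by omega) (by omega))
  calc m * (e.cost + 1 + N ^ p.deg) + (e.cost + 1)
      ≤ N * N ^ (e.cost + 1 + p.deg + 1) + N ^ (e.cost + 1 + p.deg + 2) :=
        Nat.add_le_add (Nat.mul_le_mul hm h1) h2
    _ = N ^ (e.cost + 1 + p.deg + 2) * 2 := by ring
    _ ≤ N ^ (e.cost + 1 + p.deg + 2) * N := Nat.mul_le_mul_left _ hN
    _ = N ^ (Program.loop e p).deg := by
        rw [← pow_succ]; congr 1; simp only [Program.deg]; omega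

end Exec

/-! ### Codes for bounded-sum terms

A code takes a level `ℓ` to a program that leaves a value in register `ℓ` and changes no register
below `ℓ` and no array. -/

/-- `s'` has the arrays of `s` and the registers of `s` below `ℓ`. -/
def Agree (ℓ : ℕ) (s s' : State) : Prop :=
  (∀ x < ℓ, s'.reg x = s.reg x) ∧ s'.arr = s.arr

theorem Agree.refl (ℓ : ℕ) (s : State) : Agree ℓ s s := ⟨fun _ _ => rfl, rfl⟩

theorem Agree.trans {ℓ ℓ' : ℕ} {s s' s'' : State} (h : Agree ℓ s s') (h' : Agree ℓ' s' s'')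
    (hl : ℓ ≤ ℓ') : Agree ℓ s s'' :=
  ⟨fun x hx => (h'.1 x (hx.trans_le hl)).trans (h.1 x hx), h'.2.trans h.2⟩

theorem agree_setReg {ℓ x : ℕ} (s : State) (v : ℕ) (h : ℓ ≤ x) : Agree ℓ s (s.setReg x v) :=
  ⟨fun y hy => Function.update_of_ne (by omega) _ _, rfl⟩

@[simp] theorem setReg_reg_self (s : State) (x v : ℕ) : (s.setReg x v).reg x = v :=
  Function.update_self _ _ _

theorem setReg_reg_of_ne (s : State) {x y : ℕ} (v : ℕ) (h : y ≠ x) :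
    (s.setReg x v).reg y = s.reg y :=
  Function.update_of_ne h _ _

@[simp] theorem setReg_arr (s : State) (x v : ℕ) : (s.setReg x v).arr = s.arr := rfl

/-- A memory together with the number of registers that are in use. -/
structure World where
  st : State
  lvl : ℕ

/-- `w'` extends `w`: the arrays are equal, and so are the registers that `w` uses. -/
def World.Le (w w' : World) : Prop := w.lvl ≤ w'.lvl ∧ Agree w.lvl w.st w'.st

theorem World.Le.rfl {w : World} : w.Le w := ⟨le_refl _, Agree.refl _ _⟩

theorem World.Le.trans {w w' w'' : World} (h : w.Le w') (h' : w'.Le w'') : w.Le w'' :=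
  ⟨h.1.trans h'.1, h.2.trans h'.2 h.1⟩

/-- The code `c` evaluates to `v` in all worlds that extend `w`. -/
def Ev (N : ℕ) (w : World) (c : ℕ → Program) (v : ℕ) : Prop :=
  ∀ w' : World, w.Le w' → ∃ s', Exec N (c w'.lvl) w'.st s' ∧ Agree w'.lvl w'.st s' ∧
    s'.reg w'.lvl = v

/-- The code of a constant. -/
def constC (a : ℕ) : ℕ → Program := fun ℓ => .assign ℓ (.const a)

/-- The code of a register. -/
def regC (x : ℕ) : ℕ → Program := fun ℓ => .assign ℓ (.reg x)

/-- The code of an array cell. -/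
def getC (a : ℕ) (c : ℕ → Program) : ℕ → Program :=
  fun ℓ => .seq (c ℓ) (.assign ℓ (.get a (.reg ℓ)))

/-- The code of a sum of two terms. -/
def addC (a b : ℕ → Program) : ℕ → Program :=
  fun ℓ => .seq (a ℓ) (.seq (b (ℓ + 1)) (.assign ℓ (.add (.reg ℓ) (.reg (ℓ + 1)))))

/-- The code of a truncated difference. -/
def subC (a b : ℕ → Program) : ℕ → Program :=
  fun ℓ => .seq (a ℓ) (.seq (b (ℓ + 1)) (.assign ℓ (.sub (.reg ℓ) (.reg (ℓ + 1)))))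

/-- The code of a bounded sum `∑ i < b, body i`. -/
def sumC (b : ℕ → Program) (body : (ℕ → Program) → ℕ → Program) : ℕ → Program :=
  fun ℓ => .seq (.assign ℓ (.const 0)) (.seq (b (ℓ + 1)) (.seq (.assign (ℓ + 2) (.const 0))
    (.loop (.sub (.reg (ℓ + 1)) (.reg (ℓ + 2)))
      (.seq (body (regC (ℓ + 2)) (ℓ + 3))
        (.seq (.assign ℓ (.add (.reg ℓ) (.reg (ℓ + 3))))
          (.assign (ℓ + 2) (.add (.reg (ℓ + 2)) (.const 1))))))))

section Ev

variable {N : ℕ} {w w' : World}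

/-- Extensions compose, and `Ev` quantifies over all of them. This is what allows the code of an
outer variable to be used inside inner loops that occupy further registers. -/
theorem Ev.mono {c : ℕ → Program} {v : ℕ} (h : Ev N w c v) (hw : w.Le w') : Ev N w' c v :=
  fun w'' h'' => h w'' (hw.trans h'')

theorem Ev.congr {c : ℕ → Program} {u v : ℕ} (h : Ev N w c u) (huv : u = v) : Ev N w c v := huv ▸ h

theorem Ev.const (hN : 2 ≤ N) (a : ℕ) : Ev N w (constC a) a := fun w' _ =>
  ⟨_, Exec.assign hN _ _ _, agree_setReg _ _ (le_refl _), by simp [Expr.eval]⟩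

theorem Ev.reg (hN : 2 ≤ N) {x : ℕ} (hx : x < w.lvl) : Ev N w (regC x) (w.st.reg x) :=
  fun w' hw => ⟨_, Exec.assign hN _ _ _, agree_setReg _ _ (le_refl _), by
    simp [Expr.eval, hw.2.1 x hx]⟩

theorem Ev.get (hN : 2 ≤ N) {c : ℕ → Program} {v : ℕ} (a : ℕ) (h : Ev N w c v) :
    Ev N w (getC a c) (w.st.arr a v) := by
  intro w' hw
  obtain ⟨s, he, hs, hv⟩ := h w' hw
  refine ⟨_, he.seq hN (Exec.assign hN _ _ _),
    hs.trans (agree_setReg _ _ (le_refl _)) (le_refl _), ?_⟩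
  simp [Expr.eval, hv, hs.2, hw.2.2]

/-- The second operand is evaluated one level higher, so it cannot overwrite the value of the first.
-/
theorem Ev.binop (hN : 2 ≤ N) {a b : ℕ → Program} {u v : ℕ} (ha : Ev N w a u) (hb : Ev N w b v)
    (hw : w.Le w') (e : ℕ → Expr) :
    ∃ s s', Exec N (.seq (a w'.lvl) (.seq (b (w'.lvl + 1)) (.assign w'.lvl (e w'.lvl)))) w'.st s' ∧
      Agree w'.lvl w'.st s' ∧ s'.reg w'.lvl = (e w'.lvl).eval s ∧
      s.reg w'.lvl = u ∧ s.reg (w'.lvl + 1) = v := by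
  obtain ⟨s, he, hs, hu⟩ := ha w' hw
  obtain ⟨s', he', hs', hv⟩ := hb ⟨s, w'.lvl + 1⟩
    ⟨hw.1.trans (Nat.le_succ _), hw.2.trans hs hw.1⟩
  refine ⟨s', _, he.seq hN (he'.seq hN (Exec.assign hN _ _ _)), ?_, ?_, ?_, hv⟩
  · exact (hs.trans hs' (Nat.le_succ _)).trans (agree_setReg _ _ (le_refl _)) (le_refl _)
  · exact setReg_reg_self _ _ _
  · rw [hs'.1 _ (Nat.lt_succ_self _), hu]

theorem Ev.add (hN : 2 ≤ N) {a b : ℕ → Program} {u v : ℕ} (ha : Ev N w a u) (hb : Ev N w b v) :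
    Ev N w (addC a b) (u + v) := by
  intro w' hw
  obtain ⟨s, s', h1, h2, h3, h4, h5⟩ :=
    Ev.binop hN ha hb hw (fun ℓ => .add (.reg ℓ) (.reg (ℓ + 1)))
  exact ⟨s', h1, h2, by rw [h3]; simp [Expr.eval, h4, h5]⟩

theorem Ev.sub (hN : 2 ≤ N) {a b : ℕ → Program} {u v : ℕ} (ha : Ev N w a u) (hb : Ev N w b v) :
    Ev N w (subC a b) (u - v) := by
  intro w' hw
  obtain ⟨s, s', h1, h2, h3, h4, h5⟩ :=
    Ev.binop hN ha hb hw (fun ℓ => .sub (.reg ℓ) (.reg (ℓ + 1)))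
  exact ⟨s', h1, h2, by rw [h3]; simp [Expr.eval, h4, h5]⟩

/-- Accumulator, bound and index sit in registers `ℓ`, `ℓ + 1`, `ℓ + 2`, and the body runs at level
`ℓ + 3`, where it cannot disturb them. The body receives its index as a code, so binding is done by
Lean functions and needs no variable names. -/
theorem Ev.sum (hN : 2 ≤ N) {b : ℕ → Program} {body : (ℕ → Program) → ℕ → Program} {m : ℕ}
    {g : ℕ → ℕ} (hm : m ≤ N) (hb : Ev N w b m)
    (hbody : ∀ w', w.Le w' → ∀ i < m, ∀ x, Ev N w' x i → Ev N w' (body x) (g i)) :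
    Ev N w (sumC b body) (∑ i ∈ Finset.range m, g i) := by
  rintro ⟨s, ℓ⟩ hw
  have a1 : Agree ℓ s (s.setReg ℓ 0) := agree_setReg _ _ (le_refl _)
  obtain ⟨s1, e1, h1, hv⟩ := hb ⟨s.setReg ℓ 0, ℓ + 1⟩
    ⟨hw.1.trans (Nat.le_succ _), hw.2.trans a1 hw.1⟩
  have hs1 : s1.reg ℓ = 0 := by rw [h1.1 _ (Nat.lt_succ_self _)]; simp
  have hA1 : Agree ℓ s s1 := a1.trans h1 (Nat.le_succ _)
  let I : ℕ → State → Prop := fun i t => Agree ℓ s t ∧ t.reg ℓ = ∑ j ∈ Finset.range i, g j ∧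
    t.reg (ℓ + 1) = m ∧ t.reg (ℓ + 2) = i
  have h0 : I 0 (s1.setReg (ℓ + 2) 0) := by
    refine ⟨hA1.trans (agree_setReg _ _ (by omega)) (le_refl _), ?_, ?_, by simp⟩
    · rw [setReg_reg_of_ne _ _ (by omega), hs1]; simp
    · rw [setReg_reg_of_ne _ _ (by omega), hv]
  have key : ∃ s2, Exec N (.loop (.sub (.reg (ℓ + 1)) (.reg (ℓ + 2)))
      (.seq (body (regC (ℓ + 2)) (ℓ + 3))
        (.seq (.assign ℓ (.add (.reg ℓ) (.reg (ℓ + 3))))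
          (.assign (ℓ + 2) (.add (.reg (ℓ + 2)) (.const 1)))))) (s1.setReg (ℓ + 2) 0) s2 ∧
      I m s2 := by
    refine Exec.loop hN hm I ?_ ?_ h0
    · rintro i hi t ⟨ht, hsum, hb1, hi1⟩
      refine ⟨by simp only [Expr.eval, hb1, hi1]; omega, ?_⟩
      have hle : w.Le ⟨t, ℓ + 3⟩ := ⟨hw.1.trans (Nat.le_add_right _ _), hw.2.trans ht hw.1⟩
      obtain ⟨t', e', ht', hv'⟩ := hbody ⟨t, ℓ + 3⟩ hle i hi (regC (ℓ + 2))
        (by simpa [hi1] using Ev.reg (w := ⟨t, ℓ + 3⟩) hN (x := ℓ + 2) (by simp)) _ World.Le.rfl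
      refine ⟨_, e'.seq hN ((Exec.assign hN _ _ _).seq hN (Exec.assign hN _ _ _)), ?_, ?_, ?_, ?_⟩
      · exact ((ht.trans ht' (by simp)).trans (agree_setReg _ _ (le_refl _)) (le_refl _)).trans
          (agree_setReg _ _ (by omega)) (le_refl _)
      · rw [setReg_reg_of_ne _ _ (by omega), setReg_reg_self]
        simp only [Expr.eval]
        rw [Finset.sum_range_succ, ← hsum, ht'.1 _ (by simp), hv']
      · rw [setReg_reg_of_ne _ _ (by omega), setReg_reg_of_ne _ _ (by omega), ht'.1 _ (by simp),
          hb1]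
      · rw [setReg_reg_self]
        simp only [Expr.eval]
        rw [setReg_reg_of_ne _ _ (by omega), ht'.1 _ (by simp), hi1]
    · rintro t ⟨-, -, hb1, hi1⟩
      simp [Expr.eval, hb1, hi1]
  obtain ⟨s2, e2, h2⟩ := key
  exact ⟨s2, (Exec.assign hN _ _ _).seq hN (e1.seq hN ((Exec.assign hN _ _ _).seq hN e2)),
    h2.1, h2.2.1⟩

end Ev

/-! ### Codes for propositions -/

open Classical in
/-- The truth value of a proposition as a number. -/
noncomputable def ind (p : Prop) : ℕ := if p then 1 else 0

theorem ind_true {p : Prop} (h : p) : ind p = 1 := if_pos h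

theorem ind_false {p : Prop} (h : ¬ p) : ind p = 0 := if_neg h

theorem ind_congr {p q : Prop} (h : p ↔ q) : ind p = ind q := by rw [propext h]

/-- The code `c` decides `p`. -/
def Dec (N : ℕ) (w : World) (c : ℕ → Program) (p : Prop) : Prop := Ev N w c (ind p)

/-- Negation. -/
def notC (c : ℕ → Program) : ℕ → Program := subC (constC 1) c

/-- Conjunction. -/
def andC (a b : ℕ → Program) : ℕ → Program := notC (addC (notC a) (notC b))

/-- Disjunction. -/
def orC (a b : ℕ → Program) : ℕ → Program := notC (andC (notC a) (notC b))

/-- The order of two numbers. -/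
def leC (a b : ℕ → Program) : ℕ → Program := notC (subC a b)

/-- The strict order of two numbers. -/
def ltC (a b : ℕ → Program) : ℕ → Program := leC (addC a (constC 1)) b

/-- Equality of two numbers. -/
def eqC (a b : ℕ → Program) : ℕ → Program := andC (leC a b) (leC b a)

/-- Bounded existential quantification. -/
def exC (b : ℕ → Program) (body : (ℕ → Program) → ℕ → Program) : ℕ → Program :=
  notC (notC (sumC b body))

/-- Bounded universal quantification. -/
def allC (b : ℕ → Program) (body : (ℕ → Program) → ℕ → Program) : ℕ → Program :=
  notC (exC b fun x => notC (body x))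

/-- Case distinction. -/
def iteC (c a b : ℕ → Program) : ℕ → Program :=
  addC (sumC c fun _ => a) (sumC (notC c) fun _ => b)

/-- Products. -/
def mulC (a b : ℕ → Program) : ℕ → Program := sumC a fun _ => b

/-- Quotients. -/
def divC (a b : ℕ → Program) : ℕ → Program :=
  sumC a fun i => leC (mulC (addC i (constC 1)) b) a

/-- Remainders. -/
def modC (a b : ℕ → Program) : ℕ → Program := subC a (mulC (divC a b) b)

section Dec

variable {N : ℕ} {w w' : World} {a b c : ℕ → Program} {p q : Prop} {u v : ℕ}

theorem Dec.congr (h : Dec N w c p) (hpq : p ↔ q) : Dec N w c q := propext hpq ▸ h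

theorem Dec.not (hN : 2 ≤ N) (h : Dec N w c p) : Dec N w (notC c) (¬ p) := by
  have := Ev.sub hN (Ev.const hN 1) h
  refine Ev.congr this ?_
  by_cases hp : p <;> simp [ind, hp]

theorem Dec.and (hN : 2 ≤ N) (ha : Dec N w a p) (hb : Dec N w b q) :
    Dec N w (andC a b) (p ∧ q) := by
  have := Ev.sub hN (Ev.const hN 1) (Ev.add hN (Dec.not hN ha) (Dec.not hN hb))
  refine Ev.congr this ?_
  by_cases hp : p <;> by_cases hq : q <;> simp [ind, hp, hq]

theorem Dec.or (hN : 2 ≤ N) (ha : Dec N w a p) (hb : Dec N w b q) :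
    Dec N w (orC a b) (p ∨ q) :=
  (Dec.not hN (Dec.and hN (Dec.not hN ha) (Dec.not hN hb))).congr (by tauto)

theorem Dec.le (hN : 2 ≤ N) (ha : Ev N w a u) (hb : Ev N w b v) : Dec N w (leC a b) (u ≤ v) := by
  have := Ev.sub hN (Ev.const hN 1) (Ev.sub hN ha hb)
  refine Ev.congr this ?_
  by_cases h : u ≤ v
  · simp [ind, h]
  · simp only [ind, h, if_false]; omega

theorem Dec.lt (hN : 2 ≤ N) (ha : Ev N w a u) (hb : Ev N w b v) : Dec N w (ltC a b) (u < v) :=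
  Dec.le hN (Ev.add hN ha (Ev.const hN 1)) hb

theorem Dec.eq (hN : 2 ≤ N) (ha : Ev N w a u) (hb : Ev N w b v) : Dec N w (eqC a b) (u = v) :=
  (Dec.and hN (Dec.le hN ha hb) (Dec.le hN hb ha)).congr (by omega)

/-- The sum counts the witnesses, and two truncated subtractions from 1 turn a positive count into
1. -/
theorem Dec.ex (hN : 2 ≤ N) {body : (ℕ → Program) → ℕ → Program} {m : ℕ} {P : ℕ → Prop}
    (hm : m ≤ N) (hb : Ev N w b m)
    (hbody : ∀ w', w.Le w' → ∀ i < m, ∀ x, Ev N w' x i → Dec N w' (body x) (P i)) :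
    Dec N w (exC b body) (∃ i < m, P i) := by
  have := Ev.sub hN (Ev.const hN 1) (Ev.sub hN (Ev.const hN 1) (Ev.sum hN hm hb hbody))
  refine Ev.congr this ?_
  by_cases h : ∃ i < m, P i
  · obtain ⟨i, hi, hP⟩ := h
    have : ind (P i) ≤ ∑ i ∈ Finset.range m, ind (P i) :=
      Finset.single_le_sum (f := fun i => ind (P i)) (fun _ _ => Nat.zero_le _)
        (Finset.mem_range.2 hi)
    rw [ind_true hP] at this
    rw [ind_true ⟨i, hi, hP⟩]; omega
  · have : ∑ i ∈ Finset.range m, ind (P i) = 0 :=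
      Finset.sum_eq_zero fun i hi => ind_false fun hP => h ⟨i, Finset.mem_range.1 hi, hP⟩
    rw [ind_false h, this]

theorem Dec.all (hN : 2 ≤ N) {body : (ℕ → Program) → ℕ → Program} {m : ℕ} {P : ℕ → Prop}
    (hm : m ≤ N) (hb : Ev N w b m)
    (hbody : ∀ w', w.Le w' → ∀ i < m, ∀ x, Ev N w' x i → Dec N w' (body x) (P i)) :
    Dec N w (allC b body) (∀ i < m, P i) :=
  (Dec.not hN (Dec.ex hN hm hb fun w' hw i hi x hx => Dec.not hN (hbody w' hw i hi x hx))).congr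
    (by push Not; rfl)

/-- Each branch is a sum with 0 or 1 iterations, so the branch not taken is never run. Hence each
branch has to be correct only under its own condition. -/
theorem Ev.ite {inst : Decidable p} (hN : 2 ≤ N) (hc : Dec N w c p) (ha : p → Ev N w a u) (hb : ¬ p → Ev N w b v) :
    Ev N w (iteC c a b) (if p then u else v) := by
  have h1 : ∀ p : Prop, ind p ≤ N := fun p => by unfold ind; split_ifs <;> omega
  have h2 : ∀ (p : Prop) (i : ℕ), i < ind p → p := fun p i hi => by
    by_contra hp; simp [ind_false hp] at hi
  refine Ev.congr (Ev.add hN (Ev.sum hN (h1 p) hc (body := fun _ => a) (g := fun _ => u)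
    fun w' hw i hi _ _ => (ha (h2 p i hi)).mono hw) (Ev.sum hN (h1 _) (Dec.not hN hc)
    (body := fun _ => b) (g := fun _ => v) fun w' hw i hi _ _ => (hb (h2 _ i hi)).mono hw)) ?_
  by_cases hp : p <;> simp [ind, hp]

theorem Ev.mul (hN : 2 ≤ N) (hu : u ≤ N) (ha : Ev N w a u) (hb : Ev N w b v) :
    Ev N w (mulC a b) (u * v) := by
  have := Ev.sum hN hu ha (body := fun _ => b) (g := fun _ => v) fun w' hw _ _ _ _ => hb.mono hw
  simpa [mulC] using this

/-- The quotient is the number of `i < u` with `(i + 1) * v ≤ u`. -/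
theorem Ev.div (hN : 2 ≤ N) (hu : u ≤ N) (hv : 0 < v) (ha : Ev N w a u) (hb : Ev N w b v) :
    Ev N w (divC a b) (u / v) := by
  have := Ev.sum hN hu ha (body := fun i => leC (mulC (addC i (constC 1)) b) a)
    (g := fun i => ind ((i + 1) * v ≤ u)) fun w' hw i hi x hx =>
      Dec.le hN (Ev.mul hN (by omega) (Ev.add hN hx (Ev.const hN 1)) (hb.mono hw)) (ha.mono hw)
  refine Ev.congr this ?_
  have : ∀ i, ind ((i + 1) * v ≤ u) = if i < u / v then 1 else 0 := by
    intro i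
    unfold ind
    congr 1
    rw [← Nat.le_div_iff_mul_le hv]; exact propext Iff.rfl
  simp only [this, Finset.sum_ite, Finset.sum_const_zero, Finset.sum_const, smul_eq_mul, mul_one,
    add_zero]
  have : (Finset.range u).filter (fun i => i < u / v) = Finset.range (u / v) := by
    ext i
    have := Nat.div_le_self u v
    simp only [Finset.mem_filter, Finset.mem_range]; omega
  rw [this, Finset.card_range]

theorem Ev.mod (hN : 2 ≤ N) (hu : u ≤ N) (hv : 0 < v) (ha : Ev N w a u) (hb : Ev N w b v) :
    Ev N w (modC a b) (u % v) := by
  have := Ev.sub hN ha (Ev.mul hN ((Nat.div_le_self u v).trans hu) (Ev.div hN hu hv ha hb) hb)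
  refine Ev.congr this ?_
  have := Nat.div_add_mod' u v
  exact (Nat.sub_eq_of_eq_add (by omega)).trans rfl

end Dec

end RAM

namespace SimpleGraph

/-! ### Identification sequences and quotients -/

/-- `H` is the quotient of `G` by the fibres of the surjection `φ`. -/
def IsQuotient {V W : Type} (φ : V → W) (G : SimpleGraph V) (H : SimpleGraph W) : Prop :=
  Function.Surjective φ ∧ ∀ x y, H.Adj x y ↔ x ≠ y ∧ ∃ u v, φ u = x ∧ φ v = y ∧ G.Adj u v

theorem IsQuotient.comp {V W X : Type} {φ : V → W} {ψ : W → X} {G : SimpleGraph V}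
    {H : SimpleGraph W} {J : SimpleGraph X} (hψ : IsQuotient ψ H J) (hφ : IsQuotient φ G H) :
    IsQuotient (ψ ∘ φ) G J := by
  refine ⟨hψ.1.comp hφ.1, fun x y => ?_⟩
  rw [hψ.2]
  refine and_congr_right fun hxy => ⟨?_, ?_⟩
  · rintro ⟨a, b, rfl, rfl, hab⟩
    obtain ⟨-, u, v, rfl, rfl, huv⟩ := (hφ.2 _ _).1 hab
    exact ⟨u, v, rfl, rfl, huv⟩
  · rintro ⟨u, v, rfl, rfl, huv⟩
    exact ⟨_, _, rfl, rfl, (hφ.2 _ _).2 ⟨fun h => hxy (congrArg ψ h), u, v, rfl, rfl, huv⟩⟩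

open Classical in
/-- The quotient map of an identification. -/
noncomputable def identifyMap {V : Type} (u v x : V) : Option {x : V // x ≠ u ∧ x ≠ v} :=
  if h : x ≠ u ∧ x ≠ v then some ⟨x, h⟩ else none

theorem identifyMap_eq_none {V : Type} {u v x : V} :
    identifyMap u v x = none ↔ x = u ∨ x = v := by
  unfold identifyMap; split_ifs with h <;> simp <;> tauto

theorem identifyMap_eq_some {V : Type} {u v x : V} {y : {x : V // x ≠ u ∧ x ≠ v}} :
    identifyMap u v x = some y ↔ x = y := by
  unfold identifyMap
  split_ifs with h
  · simp [Subtype.ext_iff]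
  · simp only [false_iff]
    rintro rfl
    exact h y.2

theorem isQuotient_identifyMap {V : Type} (G : SimpleGraph V) (u v : V) :
    IsQuotient (identifyMap u v) G (G.identify u v) := by
  refine ⟨?_, ?_⟩
  · rintro (_ | y)
    · exact ⟨u, identifyMap_eq_none.2 (Or.inl rfl)⟩
    · exact ⟨y, identifyMap_eq_some.2 rfl⟩
  · rintro (_ | x) (_ | y)
    · simp [identify]
    · simp only [identify, identifyMap_eq_none, identifyMap_eq_some]
      constructor
      · rintro (h | h)
        · exact ⟨by simp, u, y, Or.inl rfl, rfl, h⟩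
        · exact ⟨by simp, v, y, Or.inr rfl, rfl, h⟩
      · rintro ⟨-, a, b, rfl | rfl, rfl, h⟩ <;> tauto
    · simp only [identify, identifyMap_eq_none, identifyMap_eq_some]
      constructor
      · rintro (h | h)
        · exact ⟨by simp, x, u, rfl, Or.inl rfl, h.symm⟩
        · exact ⟨by simp, x, v, rfl, Or.inr rfl, h.symm⟩
      · rintro ⟨-, a, b, rfl, rfl | rfl, h⟩
        · exact Or.inl h.symm
        · exact Or.inr h.symm
    · simp only [identify, identifyMap_eq_some]
      constructor
      · intro h
        exact ⟨fun e => h.ne (congrArg Subtype.val (Option.some_injective _ e)), x, y, rfl, rfl, h⟩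
      · rintro ⟨-, a, b, rfl, rfl, h⟩
        exact h

theorem card_identify {V : Type} [Finite V] {u v : V} (huv : u ≠ v) :
    Nat.card V = Nat.card (Option {x : V // x ≠ u ∧ x ≠ v}) + 1 := by
  classical
  have := Fintype.ofFinite V
  rw [Finite.card_option, Nat.card_eq_fintype_card, Nat.card_eq_fintype_card,
    Fintype.card_subtype]
  have h : (Finset.univ.filter fun x : V => x ≠ u ∧ x ≠ v) = Finset.univ \ {u, v} := by
    ext x; simp
  have h2 : ({u, v} : Finset V).card ≤ Fintype.card V := Finset.card_le_univ _
  rw [h, Finset.card_sdiff_of_subset (Finset.subset_univ _), Finset.card_univ]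
  rw [Finset.card_pair huv] at h2 ⊢
  omega

/-- Quotient maps compose, and each identification removes exactly one vertex. With the converse
below, the order of the identifications becomes irrelevant and only the fibres matter. -/
theorem IdentifiesIn.exists_isQuotient {W : Type} {H : SimpleGraph W} {j : ℕ} :
    ∀ {V : Type} [Finite V] {G : SimpleGraph V}, IdentifiesIn H j G →
      ∃ φ : V → W, IsQuotient φ G H ∧ Nat.card V = Nat.card W + j := by
  induction j with
  | zero =>
    rintro V _ G ⟨e⟩
    refine ⟨e, ⟨e.surjective, fun x y => ?_⟩, Nat.card_congr e.toEquiv⟩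
    constructor
    · intro h
      refine ⟨h.ne, e.symm x, e.symm y, by simp, by simp, ?_⟩
      rwa [← e.map_adj_iff, e.apply_symm_apply, e.apply_symm_apply]
    · rintro ⟨-, u, v, rfl, rfl, h⟩
      exact e.map_adj_iff.2 h
  | succ j ih =>
    rintro V _ G ⟨u, v, huv, h⟩
    obtain ⟨ψ, hψ, hc⟩ := ih h
    refine ⟨_, hψ.comp (isQuotient_identifyMap G u v), ?_⟩
    rw [card_identify huv, hc]; ring

/-- While vertices remain to be lost, `φ` is not injective. Identifying two vertices of one fibre
lets `φ` descend to the smaller graph, and induction applies. -/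
theorem IsQuotient.identifiesIn {W : Type} {H : SimpleGraph W} {j : ℕ} :
    ∀ {V : Type} [Finite V] {G : SimpleGraph V} {φ : V → W}, IsQuotient φ G H →
      Nat.card V = Nat.card W + j → IdentifiesIn H j G := by
  induction j with
  | zero =>
    intro V _ G φ hφ hc
    have hb : Function.Bijective φ := hφ.1.bijective_of_nat_card_le (by omega)
    refine ⟨⟨Equiv.ofBijective φ hb, fun {a b} => ?_⟩⟩
    simp only [Equiv.ofBijective_apply, hφ.2]
    constructor
    · rintro ⟨-, u, v, hu, hv, h⟩
      rwa [← hb.1 hu, ← hb.1 hv]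
    · exact fun h => ⟨fun e => h.ne (hb.1 e), a, b, rfl, rfl, h⟩
  | succ j ih =>
    intro V _ G φ hφ hc
    have hi : ¬ Function.Injective φ := fun hi => by
      have := Nat.card_congr (Equiv.ofBijective φ ⟨hi, hφ.1⟩)
      omega
    simp only [Function.Injective, not_forall] at hi
    obtain ⟨u, v, e, huv⟩ := hi
    refine ⟨u, v, huv, ih (φ := fun x => x.elim (φ u) fun x => φ x) ⟨?_, ?_⟩ ?_⟩
    · intro x
      obtain ⟨a, rfl⟩ := hφ.1 x
      by_cases ha : a ≠ u ∧ a ≠ v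
      · exact ⟨some ⟨a, ha⟩, rfl⟩
      · refine ⟨none, ?_⟩
        by_cases h : a = u
        · simp [h]
        · simp only [Option.elim]
          rw [e, not_not.1 fun h' => ha ⟨h, h'⟩]
    · have hq := isQuotient_identifyMap G u v
      have key : ∀ a, (identifyMap u v a).elim (φ u) (fun x => φ x) = φ a := by
        intro a
        rcases h : identifyMap u v a with _ | b
        · rcases identifyMap_eq_none.1 h with rfl | rfl
          · rfl
          · exact e
        · rw [identifyMap_eq_some.1 h]; rfl
      intro x y
      rw [hφ.2]
      refine and_congr_right fun hxy => ⟨?_, ?_⟩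
      · rintro ⟨a, b, rfl, rfl, hab⟩
        refine ⟨_, _, key a, key b, (hq.2 _ _).2 ⟨fun h => hxy ?_, a, b, rfl, rfl, hab⟩⟩
        rw [← key a, h, key b]
      · rintro ⟨a, b, rfl, rfl, hab⟩
        obtain ⟨-, c, d, rfl, rfl, hcd⟩ := (hq.2 _ _).1 hab
        exact ⟨c, d, (key c).symm, (key d).symm, hcd⟩
    · have := card_identify huv
      omega

/-! ### Reformulation with an independent set and a partition of its complement -/

/-- `A` is an independent set of `G`, and `f` partitions the other vertices into pairwise adjacent
classes, so that at most `k` identifications are needed for contracting these classes. -/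
def IsSolution {V : Type} [Fintype V] [DecidableEq V] (G : SimpleGraph V) (k : ℕ) (A : Finset V)
    (f : V → ℕ) : Prop :=
  (∀ u ∈ A, ∀ v ∈ A, ¬ G.Adj u v) ∧
  (∀ u ∉ A, ∀ v ∉ A, f u ≠ f v → ∃ u' ∉ A, ∃ v' ∉ A, f u' = f u ∧ f v' = f v ∧ G.Adj u' v') ∧
  Aᶜ.card ≤ (Aᶜ.image f).card + k

/-- `A` consists of one representative for each vertex of the independent side. The other vertices
of those fibres join the class of a clique vertex `x₀`; enlarging a class destroys no adjacency. `A`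
and the classes together are at least as many as the vertices of `H`, so the cost does not grow. -/
theorem SplitIdentification.exists_isSolution {V : Type} [Fintype V] [DecidableEq V]
    {G : SimpleGraph V} {k : ℕ} (h : G.SplitIdentification k) : ∃ A f, G.IsSolution k A f := by
  classical
  obtain ⟨W, H, ⟨K, ⟨x₀, hx₀⟩, hK, hI⟩, j, hj, hid⟩ := h
  obtain ⟨φ, ⟨hs, hφ⟩, hc⟩ := hid.exists_isQuotient
  have : Finite W := Finite.of_surjective φ hs
  have := Fintype.ofFinite W
  obtain ⟨ι, hι⟩ : ∃ ι : W → ℕ, Function.Injective ι :=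
    ⟨fun w => Fintype.equivFin W w, fun a b h => (Fintype.equivFin W).injective (Fin.ext h)⟩
  let σ : W → V := Function.surjInv hs
  have hσ : ∀ x, φ (σ x) = x := Function.surjInv_eq hs
  let A : Finset V := (Finset.univ.filter fun x : W => x ∉ K).image σ
  have hA : ∀ v, v ∈ A ↔ φ v ∉ K ∧ σ (φ v) = v := by
    intro v
    simp only [A, Finset.mem_image, Finset.mem_filter, Finset.mem_univ, true_and]
    constructor
    · rintro ⟨x, hx, rfl⟩
      rw [hσ]; exact ⟨hx, rfl⟩
    · rintro ⟨h1, h2⟩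
      exact ⟨_, h1, h2⟩
  let f : V → ℕ := fun v => ι (if φ v ∈ K then φ v else x₀)
  have hf : ∀ v, ∃ x ∈ K, f v = ι x := by
    intro v
    by_cases h : φ v ∈ K
    · exact ⟨_, h, by simp [f, h]⟩
    · exact ⟨_, hx₀, by simp [f, h]⟩
  refine ⟨A, f, ?_, ?_, ?_⟩
  · intro u hu v hv huv
    rw [hA] at hu hv
    have hne : φ u ≠ φ v := fun h => huv.ne (by rw [← hu.2, h, hv.2])
    exact hI hu.1 hv.1 hne ((hφ _ _).2 ⟨hne, u, v, rfl, rfl, huv⟩)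
  · intro u hu v hv huv
    obtain ⟨x, hx, hxu⟩ := hf u
    obtain ⟨y, hy, hyv⟩ := hf v
    obtain ⟨-, a, b, rfl, rfl, hab⟩ :=
      (hφ _ _).1 (hK hx hy fun h => huv (by rw [hxu, hyv, h]))
    exact ⟨a, fun h => ((hA a).1 h).1 hx, b, fun h => ((hA b).1 h).1 hy,
      by rw [hxu]; simp [f, hx], by rw [hyv]; simp [f, hy], hab⟩
  · have h1 : A.card + (Finset.univ.filter fun x : W => x ∈ K).card = Fintype.card W := by
      rw [Finset.card_image_of_injective _ (Function.injective_surjInv hs), add_comm,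
        Finset.card_filter_add_card_filter_not, Finset.card_univ]
    have h2 : (Finset.univ.filter fun x : W => x ∈ K).card ≤ (Aᶜ.image f).card := by
      rw [← Finset.card_image_of_injective _ hι]
      refine Finset.card_le_card fun m hm => ?_
      simp only [Finset.mem_image, Finset.mem_filter, Finset.mem_univ, true_and,
        Finset.mem_compl] at hm ⊢
      obtain ⟨x, hx, rfl⟩ := hm
      exact ⟨σ x, fun h => ((hA _).1 h).1 (by rwa [hσ]), by simp [f, hσ, hx]⟩
    rw [Finset.card_compl]
    rw [Nat.card_eq_fintype_card, Nat.card_eq_fintype_card] at hc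
    omega

/-- The fibres of the quotient are the single vertices of `A` and the classes of the complement; the
classes form the clique. -/
theorem IsSolution.splitIdentification {V : Type} [Fintype V] [DecidableEq V] [Nonempty V]
    {G : SimpleGraph V} {k : ℕ} {A : Finset V} {f : V → ℕ} (h : G.IsSolution k A f) :
    G.SplitIdentification k := by
  classical
  obtain ⟨h1, h2, h3⟩ := h
  let g : V → V ⊕ ℕ := fun v => if v ∈ A then .inl v else .inr (f v)
  let W := Set.range g
  let φ : V → W := Set.rangeFactorization g
  have hφ : ∀ u v, φ u = φ v ↔ g u = g v := fun u v => by
    simp [φ, Set.rangeFactorization, Subtype.ext_iff]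
  have hs : Function.Surjective φ := Set.rangeFactorization_surjective
  let H : SimpleGraph W :=
    { Adj := fun x y => x ≠ y ∧ ∃ u v, φ u = x ∧ φ v = y ∧ G.Adj u v
      symm := ⟨fun x y ⟨hxy, u, v, hu, hv, h⟩ => ⟨hxy.symm, v, u, hv, hu, h.symm⟩⟩
      loopless := ⟨fun x h => h.1 rfl⟩ }
  have hq : IsQuotient φ G H := ⟨hs, fun x y => Iff.rfl⟩
  have hin : ∀ u ∈ A, ∀ v, φ v = φ u → v = u := by
    intro u hu v hv
    rw [hφ] at hv
    simp only [g, hu, if_true] at hv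
    split_ifs at hv
    exact Sum.inl_injective hv
  have hcl : ∀ u v, u ∉ A → v ∉ A → φ u ≠ φ v → H.Adj (φ u) (φ v) := by
    intro u v hu hv hne
    have hf : f u ≠ f v := fun h => hne ((hφ _ _).2 (by simp [g, hu, hv, h]))
    obtain ⟨u', hu', v', hv', e1, e2, hadj⟩ := h2 u hu v hv hf
    exact ⟨hne, u', v', (hφ _ _).2 (by simp [g, hu, hu', e1]),
      (hφ _ _).2 (by simp [g, hv, hv', e2]), hadj⟩
  have hind : ∀ u ∈ A, ∀ v ∈ A, ¬ H.Adj (φ u) (φ v) := by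
    rintro u hu v hv ⟨-, a, b, ha, hb, hab⟩
    rw [hin u hu a ha, hin v hv b hb] at hab
    exact h1 u hu v hv hab
  have hsplit : H.IsSplitGraph := by
    by_cases hB : ∃ v, v ∉ A
    · obtain ⟨v₀, hv₀⟩ := hB
      refine ⟨{x | ∃ v, v ∉ A ∧ φ v = x}, ⟨_, v₀, hv₀, rfl⟩, ?_, ?_⟩
      · rintro _ ⟨u, hu, rfl⟩ _ ⟨v, hv, rfl⟩ hne
        exact hcl u v hu hv hne
      · intro x hx y hy _
        obtain ⟨u, rfl⟩ := hs x
        obtain ⟨v, rfl⟩ := hs y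
        exact hind u (by_contra fun h => hx ⟨u, h, rfl⟩) v (by_contra fun h => hy ⟨v, h, rfl⟩)
    -- There are no classes here. A clique has to be nonempty, so one vertex of the edgeless graph
    -- is declared to be the clique.
    · push Not at hB
      obtain ⟨v₀⟩ := ‹Nonempty V›
      refine ⟨{φ v₀}, Set.singleton_nonempty _, by simp, ?_⟩
      intro x _ y _ _
      obtain ⟨u, rfl⟩ := hs x
      obtain ⟨v, rfl⟩ := hs y
      exact hind u (hB u) v (hB v)
  have hcard : A.card + (Aᶜ.image f).card ≤ Nat.card W := by
    have e1 : (A.image g ∪ Aᶜ.image g).card = A.card + (Aᶜ.image f).card := by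
      rw [Finset.card_union_of_disjoint]
      · congr 1
        · exact Finset.card_image_of_injOn fun u hu v hv h => (hin u hu v ((hφ _ _).2 h.symm)).symm
        · rw [← Finset.card_image_of_injective (Aᶜ.image f) (Sum.inr_injective (α := V)),
            Finset.image_image]
          congr 1
          refine Finset.image_congr fun v hv => ?_
          simp only [Finset.coe_compl, Set.mem_compl_iff, Finset.mem_coe] at hv
          simp [g, hv]
      · rw [Finset.disjoint_left]
        intro x hx hy
        obtain ⟨u, hu, rfl⟩ := Finset.mem_image.1 hx
        obtain ⟨v, hv, h⟩ := Finset.mem_image.1 hy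
        rw [hin u hu v ((hφ _ _).2 h)] at hv
        exact Finset.mem_compl.1 hv hu
    rw [← e1, ← Finset.image_union, Finset.union_compl, Nat.card_coe_set_eq]
    change _ ≤ (Set.range g).ncard
    rw [← Set.image_univ, ← Finset.coe_univ, ← Finset.coe_image, Set.ncard_coe_finset]
  have hle : Nat.card W ≤ Nat.card V := Nat.card_le_card_of_surjective φ hs
  refine ⟨W, H, hsplit, Nat.card V - Nat.card W, ?_, hq.identifiesIn (by omega)⟩
  rw [Finset.card_compl] at h3
  rw [Nat.card_eq_fintype_card] at hle ⊢
  have := Finset.card_le_univ A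
  omega

end SimpleGraph

namespace SimpleGraph

/-! ### Split graphs by forbidden subgraphs and by degrees -/

/-- Five vertices that witness an induced `2K₂`, `C₄` or `C₅` (in the first two cases the last vertex
repeats the first one). -/
def IsObstruction {V : Type} (G : SimpleGraph V) (a b c d e : V) : Prop :=
  (G.Adj a b ∧ G.Adj c d ∧ ¬ G.Adj a c ∧ ¬ G.Adj b d ∧ a ≠ c ∧ b ≠ d ∧
    (G.Adj a d ↔ G.Adj b c) ∧ e = a) ∨
  (G.Adj a b ∧ G.Adj b c ∧ G.Adj c d ∧ G.Adj d e ∧ G.Adj e a ∧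
    ¬ G.Adj a c ∧ ¬ G.Adj b d ∧ ¬ G.Adj c e ∧ ¬ G.Adj d a ∧ ¬ G.Adj e b)

/-- An obstruction contains two adjacent vertices of an independent set or two nonadjacent vertices
of a clique. -/
theorem IsObstruction.false_of_split {V : Type} {G : SimpleGraph V} {a b c d e : V}
    (h : G.IsObstruction a b c d e) (A : Set V)
    (hI : ∀ u ∈ ({a, b, c, d, e} : Set V), ∀ v ∈ ({a, b, c, d, e} : Set V), u ∈ A → v ∈ A →
      ¬ G.Adj u v)
    (hK : ∀ u ∈ ({a, b, c, d, e} : Set V), ∀ v ∈ ({a, b, c, d, e} : Set V), u ∉ A → v ∉ A →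
      u ≠ v → G.Adj u v) : False := by
  have ma : a ∈ ({a, b, c, d, e} : Set V) := by simp
  have mb : b ∈ ({a, b, c, d, e} : Set V) := by simp
  have mc : c ∈ ({a, b, c, d, e} : Set V) := by simp
  have md : d ∈ ({a, b, c, d, e} : Set V) := by simp
  have me : e ∈ ({a, b, c, d, e} : Set V) := by simp
  rcases h with ⟨h1, h2, h3, h4, h5, h6, h7, -⟩ | ⟨h1, h2, h3, h4, h5, h6, h7, h8, h9, h10⟩
  · have i1 := hI a ma b mb
    have i2 := hI c mc d md
    have i3 := hI a ma d md
    have i4 := hI b mb c mc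
    have k1 := hK a ma c mc
    have k2 := hK b mb d md
    have k3 := hK a ma d md
    have k4 := hK b mb c mc
    by_cases ha : a ∈ A <;> by_cases hb : b ∈ A <;> by_cases hc : c ∈ A <;> by_cases hd : d ∈ A <;>
      first
      | exact i1 ha hb h1
      | exact i2 hc hd h2
      | exact h3 (k1 ha hc h5)
      | exact h4 (k2 hb hd h6)
      | skip
    · exact i3 ha hd (h7.2 (k4 hb hc (by rintro rfl; exact h3 h1)))
    · exact i4 hb hc (h7.1 (k3 ha hd (by rintro rfl; exact h4 h1.symm)))
  · have i1 := hI a ma b mb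
    have i2 := hI b mb c mc
    have i3 := hI c mc d md
    have i4 := hI d md e me
    have i5 := hI e me a ma
    have k1 := hK a ma c mc
    have k2 := hK b mb d md
    have k3 := hK c mc e me
    have n1 : a ≠ c := by rintro rfl; exact h9 h3.symm
    have n2 : b ≠ d := by rintro rfl; exact h10 h4.symm
    have n3 : c ≠ e := by rintro rfl; exact h6 h5.symm
    by_cases ha : a ∈ A <;> by_cases hb : b ∈ A <;> by_cases hc : c ∈ A <;> by_cases hd : d ∈ A <;>
      by_cases he : e ∈ A <;>
      first
      | exact i1 ha hb h1
      | exact i2 hb hc h2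
      | exact i3 hc hd h3
      | exact i4 hd he h4
      | exact i5 he ha h5
      | exact h6 (k1 ha hc n1)
      | exact h7 (k2 hb hd n2)
      | exact h8 (k3 hc he n3)

open Classical in
/-- A finite set without obstructions is the disjoint union of a clique that is a maximum clique and
an independent set. -/
theorem exists_clique_of_forall_not_isObstruction {V : Type} (G : SimpleGraph V) (U : Finset V)
    (h : ∀ a ∈ U, ∀ b ∈ U, ∀ c ∈ U, ∀ d ∈ U, ∀ e ∈ U, ¬ G.IsObstruction a b c d e) :
    ∃ K ⊆ U, (∀ u ∈ K, ∀ v ∈ K, u ≠ v → G.Adj u v) ∧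
      (∀ x ∈ U, x ∉ K → ∃ p ∈ K, ¬ G.Adj x p) ∧
      (∀ x ∈ U, x ∉ K → ∀ y ∈ U, y ∉ K → ¬ G.Adj x y) := by
  let deg : V → ℕ := fun u => (U.filter fun v => G.Adj u v).card
  let 𝒦 := U.powerset.filter fun K => ∀ u ∈ K, ∀ v ∈ K, u ≠ v → G.Adj u v
  -- The extremal choice: a clique of maximum size and, among these, one with maximum degree sum.
  obtain ⟨K₀, hK₀, hmax₀⟩ := Finset.exists_max_image 𝒦 Finset.card ⟨∅, by simp [𝒦]⟩
  obtain ⟨K, hK, hmax⟩ := Finset.exists_max_image (𝒦.filter fun K => K.card = K₀.card)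
    (fun K => ∑ u ∈ K, deg u) ⟨K₀, by simp [hK₀]⟩
  simp only [Finset.mem_filter, 𝒦, Finset.mem_powerset] at hK hmax hmax₀
  obtain ⟨⟨hKU, hKc⟩, hKcard⟩ := hK
  have hnon : ∀ x ∈ U, x ∉ K → ∃ p ∈ K, ¬ G.Adj x p := by
    intro x hxU hxK
    by_contra! hall
    have := hmax₀ (insert x K) ⟨Finset.insert_subset hxU hKU, by
      intro u hu v hv huv
      rcases Finset.mem_insert.1 hu with rfl | hu' <;>
        rcases Finset.mem_insert.1 hv with rfl | hv'
      · exact absurd rfl huv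
      · exact hall v hv'
      · exact (hall u hu').symm
      · exact hKc u hu' v hv' huv⟩
    rw [Finset.card_insert_of_notMem hxK] at this
    omega
  refine ⟨K, hKU, hKc, hnon, ?_⟩
  -- An edge `x y` outside `K` is impossible if `p` is the only nonneighbour of `x` in `K` and also
  -- a nonneighbour of `y`. Exchanging `p` for `x` gives another maximum clique, so `p` has at least
  -- the degree of `x`. As `y` is a neighbour of `x` only, `p` has a neighbour `z` that `x` does not
  -- have. A nonneighbour `q` of `z` in `K` then completes a C₄ or a C₅, unless `x y` and `p z`
  -- already form a 2K₂.
  have key : ∀ x ∈ U, x ∉ K → ∀ y ∈ U, y ∉ K → G.Adj x y → ∀ p ∈ K, ¬ G.Adj x p → ¬ G.Adj y p →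
      (∀ q ∈ K, ¬ G.Adj x q → q = p) → False := by
    intro x hxU hxK y hyU hyK hxy p hpK hxp hyp hp
    have hpU := hKU hpK
    have hle : deg x ≤ deg p := by
      have hxe : x ∉ K.erase p := fun hx => hxK (Finset.mem_of_mem_erase hx)
      have hins : (insert x (K.erase p)).card = K.card := by
        rw [Finset.card_insert_of_notMem hxe, Finset.card_erase_add_one hpK]
      have := hmax (insert x (K.erase p)) ⟨⟨Finset.insert_subset hxU
        ((Finset.erase_subset _ _).trans hKU), by
          intro u hu v hv huv
          rcases Finset.mem_insert.1 hu with rfl | hu' <;>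
            rcases Finset.mem_insert.1 hv with rfl | hv'
          · exact absurd rfl huv
          · by_contra hn
            exact (Finset.mem_erase.1 hv').1 (hp v (Finset.mem_of_mem_erase hv') hn)
          · by_contra hn
            exact (Finset.mem_erase.1 hu').1
              (hp u (Finset.mem_of_mem_erase hu') fun h => hn h.symm)
          · exact hKc u (Finset.mem_of_mem_erase hu') v (Finset.mem_of_mem_erase hv') huv⟩,
          hins.trans hKcard⟩
      rw [Finset.sum_insert hxe, ← Finset.add_sum_erase K deg hpK] at this
      omega
    obtain ⟨z, hzU, hpz, hxz⟩ : ∃ z ∈ U, G.Adj p z ∧ ¬ G.Adj x z := by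
      by_contra! hall
      have hss : (U.filter fun v => G.Adj p v) ⊂ U.filter fun v => G.Adj x v := by
        refine (Finset.ssubset_iff_of_subset fun v hv => ?_).2 ⟨y, by simp [hyU, hxy], ?_⟩
        · rw [Finset.mem_filter] at hv ⊢
          exact ⟨hv.1, hall v hv.1 hv.2⟩
        · simp only [Finset.mem_filter, not_and]
          exact fun _ h => hyp h.symm
      have := Finset.card_lt_card hss
      simp only [deg] at hle
      omega
    have hzK : z ∉ K := fun hz => hpz.ne (hp z hz hxz).symm
    have hyz : G.Adj y z := by
      by_contra hyz
      refine h x hxU y hyU p hpU z hzU x hxU (Or.inl ⟨hxy, hpz, hxp, hyz, ?_, ?_, ?_, rfl⟩)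
      · rintro rfl; exact hxK hpK
      · rintro rfl; exact hxz hxy
      · exact iff_of_false hxz hyp
    obtain ⟨q, hqK, hzq⟩ := hnon z hzU hzK
    have hqp : q ≠ p := by rintro rfl; exact hzq hpz.symm
    have hxq : G.Adj x q := by
      by_contra hn; exact hqp (hp q hqK hn)
    have hpq := hKc p hpK q hqK hqp.symm
    have hqU := hKU hqK
    by_cases hyq : G.Adj y q
    · refine h z hzU p hpU q hqU y hyU z hzU (Or.inl ⟨hpz.symm, hyq.symm, hzq, fun h => hyp h.symm,
        ?_, ?_, iff_of_true hyz.symm hpq, rfl⟩)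
      · rintro rfl; exact hzK hqK
      · rintro rfl; exact hyK hpK
    · exact h x hxU y hyU z hzU p hpU q hqU (Or.inr ⟨hxy, hyz, hpz.symm, hpq, hxq.symm, hxz, hyp, hzq,
        fun h => hxp h.symm, fun h => hyq h.symm⟩)
  intro x hxU hxK y hyU hyK hxy
  -- If the two cross adjacencies agreed, the edges `x y` and `p q` would span a 2K₂ or a C₄.
  have hpair : ∀ p ∈ K, ∀ q ∈ K, p ≠ q → ¬ G.Adj x p → ¬ G.Adj y q → ¬ (G.Adj x q ↔ G.Adj y p) := by
    intro p hpK q hqK hpq hxp hyq hiff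
    refine h x hxU y hyU p (hKU hpK) q (hKU hqK) x hxU (Or.inl ⟨hxy, hKc p hpK q hqK hpq, hxp, hyq,
      ?_, ?_, hiff, rfl⟩)
    · rintro rfl; exact hxK hpK
    · rintro rfl; exact hyK hqK
  obtain ⟨p, hpK, hxp, hyp⟩ : ∃ p ∈ K, ¬ G.Adj x p ∧ ¬ G.Adj y p := by
    obtain ⟨p, hpK, hxp⟩ := hnon x hxU hxK
    obtain ⟨q, hqK, hyq⟩ := hnon y hyU hyK
    by_contra! hno
    have h1 := hno p hpK hxp
    have h2 : G.Adj x q := by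
      by_contra hn; exact hyq (hno q hqK hn)
    exact hpair p hpK q hqK (by rintro rfl; exact hxp h2) hxp hyq (iff_of_true h2 h1)
  by_cases hx : ∀ q ∈ K, ¬ G.Adj x q → q = p
  · exact key x hxU hxK y hyU hyK hxy p hpK hxp hyp hx
  by_cases hy : ∀ q ∈ K, ¬ G.Adj y q → q = p
  · exact key y hyU hyK x hxU hxK hxy.symm p hpK hyp hxp hy
  -- Both ends have a further nonneighbour in `K`. Comparing each of these with `p` through `hpair`
  -- forces the two cross adjacencies between them, which contradicts `hpair` once more.
  push Not at hx hy
  obtain ⟨x', hx'K, hxx', hx'p⟩ := hx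
  obtain ⟨y', hy'K, hyy', hy'p⟩ := hy
  have h1 : G.Adj y x' := by
    by_contra hn
    exact hpair x' hx'K p hpK hx'p hxx' hyp (iff_of_false hxp hn)
  have h2 : G.Adj x y' := by
    by_contra hn
    exact hpair p hpK y' hy'K hy'p.symm hxp hyy' (iff_of_false hn hyp)
  exact hpair x' hx'K y' hy'K (by rintro rfl; exact hxx' h2) hxx' hyy' (iff_of_true h2 h1)

open Classical in
/-- In a finite set without obstructions, the vertices of degree at least `d` are a clique and the
other ones are independent, for some threshold `d`. -/
theorem exists_degree_threshold {V : Type} (G : SimpleGraph V) (U : Finset V)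
    (h : ∀ a ∈ U, ∀ b ∈ U, ∀ c ∈ U, ∀ d ∈ U, ∀ e ∈ U, ¬ G.IsObstruction a b c d e) :
    ∃ d ≤ U.card,
      (∀ u ∈ U, ∀ v ∈ U, d ≤ (U.filter fun w => G.Adj u w).card →
        d ≤ (U.filter fun w => G.Adj v w).card → u ≠ v → G.Adj u v) ∧
      (∀ u ∈ U, ∀ v ∈ U, (U.filter fun w => G.Adj u w).card < d →
        (U.filter fun w => G.Adj v w).card < d → ¬ G.Adj u v) := by
  obtain ⟨K, hKU, hKc, hnon, hI⟩ := exists_clique_of_forall_not_isObstruction G U h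
  have hω := Finset.card_le_card hKU
  have hK : ∀ u ∈ K, K.erase u ⊆ U.filter fun w => G.Adj u w := fun u hu v hv => by
    rw [Finset.mem_erase] at hv
    exact Finset.mem_filter.2 ⟨hKU hv.2, hKc u hu v hv.2 hv.1.symm⟩
  have hKd : ∀ u ∈ K, K.card ≤ (U.filter fun w => G.Adj u w).card + 1 := fun u hu => by
    rw [← Finset.card_erase_add_one hu]
    exact Nat.add_le_add_right (Finset.card_le_card (hK u hu)) 1
  have hIs : ∀ u ∈ U, u ∉ K → (U.filter fun w => G.Adj u w) ⊂ K := fun u hu huK => by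
    obtain ⟨p, hp, hup⟩ := hnon u hu huK
    refine (Finset.ssubset_iff_of_subset fun v hv => ?_).2 ⟨p, hp, by simp [hup]⟩
    rw [Finset.mem_filter] at hv
    by_contra hvK
    exact hI u hu huK v hv.1 hvK hv.2
  have hId : ∀ u ∈ U, u ∉ K → (U.filter fun w => G.Adj u w).card < K.card := fun u hu huK =>
    Finset.card_lt_card (hIs u hu huK)
  -- Let ω be the size of `K`. Vertices of `K` have degree at least ω − 1, the others at most ω − 1.
  -- If no outside vertex attains ω − 1, this is the threshold. Otherwise some `b` sees all of `K`
  -- except one vertex `a`, and the threshold is ω: only `a` can fall below it within `K`, and then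
  -- it has no neighbour outside `K`, so it can join the independent side.
  by_cases hb : ∃ b ∈ U, b ∉ K ∧ (U.filter fun w => G.Adj b w).card + 1 = K.card
  · obtain ⟨b, hbU, hbK, hbd⟩ := hb
    have hone : (K \ U.filter fun w => G.Adj b w).card = 1 := by
      rw [Finset.card_sdiff_of_subset (hIs b hbU hbK).subset]; omega
    obtain ⟨a, ha⟩ := Finset.card_eq_one.1 hone
    have hN : ∀ u ∈ K, (U.filter fun w => G.Adj u w).card < K.card →
        ∀ v ∈ U, G.Adj u v → v ∈ K := by
      intro u hu hd v hv huv
      have := Finset.eq_of_subset_of_card_le (hK u hu) (by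
        rw [Finset.card_erase_of_mem hu]; omega)
      have hv' : v ∈ U.filter fun w => G.Adj u w := Finset.mem_filter.2 ⟨hv, huv⟩
      rw [← this] at hv'
      exact Finset.mem_of_mem_erase hv'
    have heq : ∀ u ∈ K, (U.filter fun w => G.Adj u w).card < K.card → u = a := by
      intro u hu hd
      rw [← Finset.mem_singleton, ← ha, Finset.mem_sdiff, Finset.mem_filter]
      exact ⟨hu, fun h => hbK (hN u hu hd b hbU h.2.symm)⟩
    refine ⟨K.card, hω, fun u hu v hv hdu hdv huv => ?_, fun u hu v hv hdu hdv huv => ?_⟩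
    · refine hKc u ?_ v ?_ huv
      · by_contra hn; exact absurd (hId u hu hn) (by omega)
      · by_contra hn; exact absurd (hId v hv hn) (by omega)
    · by_cases huK : u ∈ K
      · have hvK := hN u huK hdu v hv huv
        exact huv.ne ((heq u huK hdu).trans (heq v hvK hdv).symm)
      · by_cases hvK : v ∈ K
        · exact huK (hN v hvK hdv u hu huv.symm)
        · exact hI u hu huK v hv hvK huv
  · push Not at hb
    refine ⟨K.card - 1, by omega, fun u hu v hv hdu hdv huv => ?_, fun u hu v hv hdu hdv huv => ?_⟩
    · refine hKc u ?_ v ?_ huv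
      · by_contra hn
        have := hId u hu hn
        have := hb u hu hn
        omega
      · by_contra hn
        have := hId v hv hn
        have := hb v hv hn
        omega
    · refine hI u hu (fun hn => ?_) v hv (fun hn => ?_) huv
      · have := hKd u hn; omega
      · have := hKd v hn; omega

end SimpleGraph

/-! ### Solutions on the natural numbers: domination and nontrivial classes -/

namespace SimpleGraph

open Classical in
/-- Solutions for a graph with the vertices `0, …, n - 1`: `A` is independent, and `f` partitions
the set `range n \ A` into pairwise adjacent classes at the cost of at most `k` identifications. -/
def IsNatSolution (E : SimpleGraph ℕ) (n k : ℕ) (A : Finset ℕ) (f : ℕ → ℕ) : Prop :=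
  A ⊆ Finset.range n ∧ (∀ u ∈ A, ∀ v ∈ A, ¬ E.Adj u v) ∧
  (∀ u ∈ Finset.range n \ A, ∀ v ∈ Finset.range n \ A, f u ≠ f v →
    ∃ u' ∈ Finset.range n \ A, ∃ v' ∈ Finset.range n \ A, f u' = f u ∧ f v' = f v ∧ E.Adj u' v') ∧
  (Finset.range n \ A).card ≤ ((Finset.range n \ A).image f).card + k

theorem map_val_adj {n : ℕ} (G : SimpleGraph (Fin n)) (u v : Fin n) :
    (G.map (Fin.valEmbedding : Fin n ↪ ℕ)).Adj u v ↔ G.Adj u v := by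
  rw [SimpleGraph.map_adj]
  constructor
  · rintro ⟨u', v', h, hu, hv⟩
    rwa [← Fin.ext hu, ← Fin.ext hv]
  · exact fun h => ⟨u, v, h, rfl, rfl⟩

theorem IsSolution.exists_isNatSolution {n k : ℕ} {G : SimpleGraph (Fin n)} {A : Finset (Fin n)}
    {f : Fin n → ℕ} (h : G.IsSolution k A f) :
    ∃ A f, (G.map (Fin.valEmbedding : Fin n ↪ ℕ)).IsNatSolution n k A f := by
  obtain ⟨h1, h2, h3⟩ := h
  have hA : ∀ u : Fin n, (u : ℕ) ∈ A.map Fin.valEmbedding ↔ u ∈ A := fun u =>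
    Finset.mem_map' Fin.valEmbedding
  have hB : Finset.range n \ A.map Fin.valEmbedding = Aᶜ.map Fin.valEmbedding := by
    ext x
    simp only [Finset.mem_sdiff, Finset.mem_range, Finset.mem_map, Finset.mem_compl]
    constructor
    · rintro ⟨hx, hn⟩
      exact ⟨⟨x, hx⟩, fun h => hn ⟨_, h, rfl⟩, rfl⟩
    · rintro ⟨a, ha, rfl⟩
      exact ⟨a.2, fun ⟨b, hb, e⟩ => ha (Fin.ext e ▸ hb)⟩
  let f' : ℕ → ℕ := fun v => if h : v < n then f ⟨v, h⟩ else 0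
  have hf : ∀ u : Fin n, f' u = f u := fun u => by simp [f']
  refine ⟨A.map Fin.valEmbedding, f', ?_, ?_, ?_, ?_⟩
  · intro x hx
    obtain ⟨a, -, rfl⟩ := Finset.mem_map.1 hx
    exact Finset.mem_range.2 a.2
  · intro u hu v hv
    obtain ⟨a, ha, rfl⟩ := Finset.mem_map.1 hu
    obtain ⟨b, hb, rfl⟩ := Finset.mem_map.1 hv
    exact fun h => h1 a ha b hb ((map_val_adj G a b).1 h)
  · rw [show (Finset.range n \ A.map Fin.valEmbedding) = Aᶜ.map Fin.valEmbedding from by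
      convert hB]
    intro u hu v hv huv
    obtain ⟨a, ha, rfl⟩ := Finset.mem_map.1 hu
    obtain ⟨b, hb, rfl⟩ := Finset.mem_map.1 hv
    simp only [Fin.valEmbedding_apply, hf] at huv
    rw [Finset.mem_compl] at ha hb
    obtain ⟨a', ha', b', hb', e1, e2, hab⟩ := h2 a ha b hb huv
    refine ⟨_, Finset.mem_map_of_mem _ (Finset.mem_compl.2 ha'), _,
      Finset.mem_map_of_mem _ (Finset.mem_compl.2 hb'), ?_, ?_, (map_val_adj G _ _).2 hab⟩
    · simp only [Fin.valEmbedding_apply, hf, e1]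
    · simp only [Fin.valEmbedding_apply, hf, e2]
  · rw [show (Finset.range n \ A.map Fin.valEmbedding) = Aᶜ.map Fin.valEmbedding from by
      convert hB]
    rw [Finset.card_map, Finset.map_eq_image, Finset.image_image]
    convert h3 using 4
    exact funext hf

theorem IsNatSolution.isSolution {n k : ℕ} {G : SimpleGraph (Fin n)} {A : Finset ℕ}
    {f : ℕ → ℕ} (h : (G.map (Fin.valEmbedding : Fin n ↪ ℕ)).IsNatSolution n k A f) :
    G.IsSolution k (Finset.univ.filter fun v : Fin n => (v : ℕ) ∈ A) (fun v => f v) := by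
  obtain ⟨h0, h1, h2, h3⟩ := h
  have hB : Finset.range n \ A =
      (Finset.univ.filter fun v : Fin n => (v : ℕ) ∈ A)ᶜ.map Fin.valEmbedding := by
    ext x
    simp only [Finset.mem_sdiff, Finset.mem_range, Finset.mem_map, Finset.mem_compl,
      Finset.mem_filter, Finset.mem_univ, true_and]
    constructor
    · rintro ⟨hx, hn⟩
      exact ⟨⟨x, hx⟩, hn, rfl⟩
    · rintro ⟨a, ha, rfl⟩
      exact ⟨a.2, ha⟩
  refine ⟨?_, ?_, ?_⟩
  · intro u hu v hv huv
    simp only [Finset.mem_filter, Finset.mem_univ, true_and] at hu hv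
    exact h1 u hu v hv ((map_val_adj G u v).2 huv)
  · intro u hu v hv huv
    simp only [Finset.mem_filter, Finset.mem_univ, true_and] at hu hv ⊢
    obtain ⟨a, ha, b, hb, e1, e2, hab⟩ := h2 u (by simp [hu]) v (by simp [hv]) huv
    simp only [Finset.mem_sdiff, Finset.mem_range] at ha hb
    exact ⟨⟨a, ha.1⟩, ha.2, ⟨b, hb.1⟩, hb.2, e1, e2, (map_val_adj G _ _).1 hab⟩
  · rw [show (Finset.range n \ A) = (Finset.univ.filter fun v : Fin n => (v : ℕ) ∈ A)ᶜ.map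
      Fin.valEmbedding from by convert hB] at h3
    rw [Finset.card_map, Finset.map_eq_image, Finset.image_image] at h3
    convert h3 using 3
    ext; simp

open Classical in
/-- The independent set of a solution can be chosen so that every other vertex has a neighbour
in it. -/
theorem IsNatSolution.exists_dominating {E : SimpleGraph ℕ} {n k : ℕ} {A : Finset ℕ}
    {f : ℕ → ℕ} (h : E.IsNatSolution n k A f) :
    ∃ A f, E.IsNatSolution n k A f ∧ ∀ y ∈ Finset.range n \ A, ∃ a ∈ A, E.Adj y a := by
  -- `A` is taken as large as possible; a vertex `y` without neighbours in `A` could be moved into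
  -- `A`.
  obtain ⟨A, hA, hmax⟩ := Finset.exists_max_image
    ((Finset.range n).powerset.filter fun A => ∃ f, E.IsNatSolution n k A f) Finset.card
    ⟨A, by simp only [Finset.mem_filter, Finset.mem_powerset]; exact ⟨h.1, f, h⟩⟩
  simp only [Finset.mem_filter, Finset.mem_powerset] at hA hmax
  obtain ⟨hAn, f, hf⟩ := hA
  refine ⟨A, f, hf, ?_⟩
  intro y hy
  by_contra! hno
  obtain ⟨-, h1, h2, h3⟩ := hf
  obtain ⟨hyn, hyA⟩ := Finset.mem_sdiff.1 hy
  have hins : insert y A ⊆ Finset.range n := Finset.insert_subset hyn hAn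
  have hB' : Finset.range n \ insert y A = (Finset.range n \ A).erase y := by
    ext x; simp only [Finset.mem_sdiff, Finset.mem_insert, Finset.mem_erase]; tauto
  set B := Finset.range n \ A with hB
  suffices hs : ∃ f', E.IsNatSolution n k (insert y A) f' by
    have := hmax (insert y A) ⟨hins, hs⟩
    rw [Finset.card_insert_of_notMem hyA] at this
    omega
  have hind : ∀ u ∈ insert y A, ∀ v ∈ insert y A, ¬ E.Adj u v := by
    intro u hu v hv
    rcases Finset.mem_insert.1 hu with rfl | hu' <;> rcases Finset.mem_insert.1 hv with rfl | hv'
    · exact E.irrefl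
    · exact hno v hv'
    · exact fun h => hno u hu' h.symm
    · exact h1 u hu' v hv'
  have hcard : (B.erase y).card + 1 = B.card := Finset.card_erase_add_one hy
  by_cases hc : ∃ z ∈ B, f z ≠ f y
  · obtain ⟨z, hz, hzy⟩ := hc
    -- The rest of the class of `y` is merged into the class of `z`. At most one class is lost, and
    -- this is paid for by the departure of `y`. All remaining class pairs were adjacent without
    -- using the class of `y`.
    let f' : ℕ → ℕ := fun v => if f v = f y then f z else f v
    refine ⟨f', hins, hind, ?_, ?_⟩
    · rw [hB']
      have hrep : ∀ u ∈ B.erase y, ∃ c ∈ B, f c = f' u ∧ f c ≠ f y := by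
        intro u hu
        by_cases e : f u = f y
        · exact ⟨z, hz, by simp [f', e], hzy⟩
        · exact ⟨u, Finset.mem_of_mem_erase hu, by simp [f', e], e⟩
      intro u hu v hv huv
      obtain ⟨a, ha, ea, na⟩ := hrep u hu
      obtain ⟨b, hb, eb, nb⟩ := hrep v hv
      obtain ⟨a', ha', b', hb', ea', eb', hab⟩ := h2 a ha b hb (by rwa [ea, eb])
      refine ⟨a', Finset.mem_erase.2 ⟨?_, ha'⟩, b', Finset.mem_erase.2 ⟨?_, hb'⟩, ?_, ?_, hab⟩
      · rintro rfl; exact na ea'.symm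
      · rintro rfl; exact nb eb'.symm
      · simp only [f', ea', na, if_false]; exact ea
      · simp only [f', eb', nb, if_false]; exact eb
    · rw [hB']
      have : ((B.image f).erase (f y)).card ≤ ((B.erase y).image f').card := by
        refine Finset.card_le_card fun c hc => ?_
        obtain ⟨hcy, hc⟩ := Finset.mem_erase.1 hc
        obtain ⟨v, hv, rfl⟩ := Finset.mem_image.1 hc
        refine Finset.mem_image.2 ⟨v, Finset.mem_erase.2 ⟨?_, hv⟩, by simp [f', hcy]⟩
        rintro rfl; exact hcy rfl
      rw [Finset.card_erase_of_mem (Finset.mem_image_of_mem f hy)] at this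
      omega
  -- There is only one class, so adjacency is vacuous, and the count survives even if that class
  -- disappears with `y`.
  · push Not at hc
    refine ⟨f, hins, hind, ?_, ?_⟩
    · rw [hB']
      intro u hu v hv huv
      exact absurd ((hc u (Finset.mem_of_mem_erase hu)).trans
        (hc v (Finset.mem_of_mem_erase hv)).symm) huv
    · rw [hB']
      have : (B.image f).card ≤ 1 := Finset.card_le_one.2 fun a ha b hb => by
        obtain ⟨u, hu, rfl⟩ := Finset.mem_image.1 ha
        obtain ⟨v, hv, rfl⟩ := Finset.mem_image.1 hb
        exact (hc u hu).trans (hc v hv).symm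
      omega

open Classical in
/-- There are at most `2 * k` vertices in nontrivial classes. -/
theorem card_nontrivial_classes_le {B : Finset ℕ} {f : ℕ → ℕ} {k : ℕ}
    (h : B.card ≤ (B.image f).card + k) :
    (B.filter fun v => ∃ u ∈ B, u ≠ v ∧ f u = f v).card ≤ 2 * k := by
  set X := B.filter fun v => ∃ u ∈ B, u ≠ v ∧ f u = f v with hX
  have h1 : B.image f = (B \ X).image f ∪ X.image f := by
    rw [← Finset.image_union, Finset.sdiff_union_of_subset (Finset.filter_subset _ _)]
  have h2 := Finset.card_union_le ((B \ X).image f) (X.image f)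
  have h3 : ((B \ X).image f).card ≤ (B \ X).card := Finset.card_image_le
  -- Each nontrivial class has at least two elements, so passing to classes loses at least half of
  -- `X`, while the total loss is at most `k`.
  have h4 : (X.image f).card * 2 ≤ X.card := by
    rw [mul_comm, Finset.card_eq_sum_card_image f X, mul_comm, ← smul_eq_mul]
    refine Finset.card_nsmul_le_sum _ _ _ fun c hc => ?_
    obtain ⟨v, hv, rfl⟩ := Finset.mem_image.1 hc
    obtain ⟨hvB, u, hu, huv, e⟩ := Finset.mem_filter.1 hv
    refine Finset.one_lt_card.2 ⟨v, by simp [hv], u, ?_, huv.symm⟩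
    simp only [Finset.mem_filter, X]
    exact ⟨⟨hu, v, hvB, huv.symm, e.symm⟩, e⟩
  have h5 := Finset.card_sdiff_add_card_eq_card (Finset.filter_subset (fun v => ∃ u ∈ B, u ≠ v ∧ f u = f v) B)
  rw [← hX] at h5
  rw [h1] at h
  omega

end SimpleGraph

namespace SimpleGraph

/-! ### A normal form for the partition into pairwise adjacent classes -/

/-- A vertex of `R` that has no neighbour in some class of `P` with a label that is at least `L`. -/
def IsBad (E : SimpleGraph ℕ) (P R : Finset ℕ) (L : ℕ) (g : ℕ → ℕ) (v : ℕ) : Prop :=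
  v ∈ R ∧ ∃ s ∈ P, L ≤ g s ∧ ∀ s' ∈ P, g s' = g s → ¬ E.Adj v s'

open Classical in
/-- The partition that `g` encodes: bad vertices and vertices outside `R` have the label `g v`, the
first vertex of `R` that is not bad has the label `0`, and the other ones are singletons. -/
noncomputable def label (E : SimpleGraph ℕ) (P R : Finset ℕ) (L : ℕ) (g : ℕ → ℕ) (v : ℕ) : ℕ :=
  if v ∈ R then
    if IsBad E P R L g v then g v
    else if ∃ u < v, u ∈ R ∧ ¬ IsBad E P R L g u then 2 * L + 1 + v else 0
  else g v

open Classical in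
-- Labels from `L` on mark classes contained in `P`, so badness can be read off from the labels on
-- `P` alone, before any vertex of `R` is labelled. A good vertex is adjacent to every class inside
-- `P` by definition, and to every other class without good vertices because such a class contains a
-- vertex of the clique `R`. Hence good vertices can be separated. The remainders of their old
-- classes go to the class `0`, which contains the first good vertex and inherits its adjacencies.
-- No class is lost in the count, because each old class with a good vertex can be charged to one
-- such vertex.
theorem exists_label {E : SimpleGraph ℕ} {B P R : Finset ℕ} {f : ℕ → ℕ} {k L : ℕ}
    (hPB : P ⊆ B) (hRB : R ⊆ B) (hBPR : ∀ v ∈ B, v ∉ R → v ∈ P) (hPR : ∀ v ∈ P, v ∉ R)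
    (hR : ∀ u ∈ R, ∀ v ∈ R, u ≠ v → E.Adj u v)
    (hadj : ∀ u ∈ B, ∀ v ∈ B, f u ≠ f v → ∃ u' ∈ B, ∃ v' ∈ B, f u' = f u ∧ f v' = f v ∧ E.Adj u' v')
    (hcard : B.card ≤ (B.image f).card + k) (hL : P.card + 2 * k < L) :
    ∃ g : ℕ → ℕ, (∀ v ∈ P, g v < 2 * L) ∧ (∀ v, IsBad E P R L g v → g v < 2 * L) ∧
      (R.filter fun v => IsBad E P R L g v).card ≤ 2 * k ∧
      (∀ u ∈ B, ∀ v ∈ B, label E P R L g u ≠ label E P R L g v → ∃ u' ∈ B, ∃ v' ∈ B,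
        label E P R L g u' = label E P R L g u ∧ label E P R L g v' = label E P R L g v ∧
          E.Adj u' v') ∧
      B.card ≤ (B.image (label E P R L g)).card + k := by
  -- classes inside `P`, good vertices, classes that contain a good vertex
  let Ncl : ℕ → Prop := fun c => ∀ v ∈ B, f v = c → v ∈ P
  let bad : ℕ → Prop := fun v => v ∈ R ∧ ∃ s ∈ P, Ncl (f s) ∧ ∀ s' ∈ P, f s' = f s → ¬ E.Adj v s'
  let gcl : ℕ → Prop := fun c => ∃ v ∈ R, ¬ bad v ∧ f v = c
  let F := R.filter bad
  -- The class of a bad vertex must be adjacent to the class it misses, and only another member of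
  -- its own class can provide that edge. So bad vertices lie in nontrivial classes.
  have hFX : F ⊆ B.filter fun v => ∃ u ∈ B, u ≠ v ∧ f u = f v := by
    intro v hv
    obtain ⟨hvR, -, s, hs, hN, hno⟩ := Finset.mem_filter.1 hv
    refine Finset.mem_filter.2 ⟨hRB hvR, ?_⟩
    by_contra! hall
    have hne : f v ≠ f s := fun h => hPR v (hN v (hRB hvR) h) hvR
    obtain ⟨u', hu', v', hv', e1, e2, h⟩ := hadj v (hRB hvR) s (hPB hs) hne
    have : u' = v := by
      by_contra hn
      exact hall u' hu' hn e1
    subst this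
    exact hno v' (hN v' hv' e2) e2 h
  have hFc : F.card ≤ 2 * k := (Finset.card_le_card hFX).trans (card_nontrivial_classes_le hcard)
  let J := (P ∪ F).image f
  have hJ : J.card < L :=
    (Finset.card_image_le.trans (Finset.card_union_le _ _)).trans_lt (by omega)
  -- Relevant classes are numbered from 1 to `L - 1`; the number 0 is reserved for the collecting
  -- class.
  let ι : ℕ → ℕ := fun c => (J.filter fun x => x < c).card + 1
  have hι : ∀ c ∈ J, ι c < L := by
    intro c hc
    have : (J.filter fun x => x < c) ⊂ J :=
      (Finset.ssubset_iff_of_subset (Finset.filter_subset _ _)).2 ⟨c, hc, by simp⟩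
    have := Finset.card_lt_card this
    simp only [ι]
    omega
  have hιlt : ∀ c ∈ J, ∀ c', c < c' → ι c < ι c' := by
    intro c hc c' hcc
    have : (J.filter fun x => x < c) ⊂ J.filter fun x => x < c' := by
      refine (Finset.ssubset_iff_of_subset fun x hx => ?_).2 ⟨c, by simp [hc, hcc], by simp⟩
      simp only [Finset.mem_filter] at hx ⊢
      exact ⟨hx.1, hx.2.trans hcc⟩
    have := Finset.card_lt_card this
    simp only [ι]
    omega
  have hιinj : ∀ c ∈ J, ∀ c' ∈ J, ι c = ι c' → c = c' := by
    intro c hc c' hc' e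
    rcases lt_trichotomy c c' with h | h | h
    · exact absurd e (hιlt c hc c' h).ne
    · exact h
    · exact absurd e (hιlt c' hc' c h).ne'
  have hιpos : ∀ c, 1 ≤ ι c := fun c => Nat.le_add_left 1 _
  -- Three kinds of classes: those with a good vertex collapse to 0, those inside `P` get labels
  -- from `L` to `2 * L - 1`, and those that meet `R` in bad vertices only get labels from 1 to `L -
  -- 1`.
  let γ : ℕ → ℕ := fun c => if gcl c then 0 else if Ncl c then L + ι c else ι c
  let g : ℕ → ℕ := fun v => γ (f v)
  have hNg : ∀ c, Ncl c → ¬ gcl c := fun c hN ⟨v, hvR, _, e⟩ => hPR v (hN v (hRB hvR) e) hvR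
  have hJP : ∀ v ∈ P, f v ∈ J := fun v hv =>
    Finset.mem_image_of_mem _ (Finset.mem_union_left _ hv)
  have hγL : ∀ c ∈ J, (L ≤ γ c ↔ Ncl c) := by
    intro c hc
    have := hι c hc
    by_cases hN : Ncl c
    · simp [γ, hN, hNg c hN]
    · by_cases hg : gcl c
      · simp only [γ, hN, hg, if_true, iff_false]; omega
      · simp only [γ, hN, hg, if_false, iff_false]; omega
  have hγlt : ∀ c ∈ J, γ c < 2 * L := by
    intro c hc
    have := hι c hc
    simp only [γ]
    split_ifs <;> omega
  have hγinj : ∀ c ∈ J, ∀ c' ∈ J, ¬ gcl c → γ c = γ c' → c = c' := by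
    intro c hc c' hc' hg e
    have h1 := hι c hc
    have h2 := hι c' hc'
    have h3 := hιpos c
    have h4 := hιpos c'
    refine hιinj c hc c' hc' ?_
    simp only [γ, hg, if_false] at e
    split_ifs at e <;> omega
  have hbad : ∀ v, IsBad E P R L g v ↔ bad v := by
    intro v
    refine and_congr_right fun _ => exists_congr fun s => and_congr_right fun hs => ?_
    rw [hγL _ (hJP s hs)]
    refine and_congr_right fun hN => forall_congr' fun s' => forall_congr' fun hs' => ?_
    have : g s' = g s ↔ f s' = f s :=
      ⟨fun e => (hγinj _ (hJP s hs) _ (hJP s' hs') (hNg _ hN) e.symm).symm,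
        fun e => congrArg γ e⟩
    rw [this]
  have hJB : ∀ v ∈ B, ¬ (v ∈ R ∧ ¬ bad v) → f v ∈ J := by
    intro v hv hn
    refine Finset.mem_image_of_mem _ (Finset.mem_union.2 ?_)
    by_cases hvR : v ∈ R
    · exact Or.inr (Finset.mem_filter.2 ⟨hvR, not_not.1 fun h => hn ⟨hvR, h⟩⟩)
    · exact Or.inl (hBPR v hv hvR)
  set lab := label E P R L g with hlab
  have hlab1 : ∀ v, ¬ (v ∈ R ∧ ¬ bad v) → lab v = γ (f v) := by
    intro v hn
    simp only [hlab, label, hbad]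
    split_ifs with h1 h2 h3
    · rfl
    · exact absurd ⟨h1, h2⟩ hn
    · exact absurd ⟨h1, h2⟩ hn
    · rfl
  have hlab2 : ∀ v ∈ R, ¬ bad v → (∃ u < v, u ∈ R ∧ ¬ bad u) → lab v = 2 * L + 1 + v := by
    intro v h1 h2 h3
    simp only [hlab, label, hbad, h1, h2, h3, if_true, if_false]
  have hlab3 : ∀ v ∈ R, ¬ bad v → ¬ (∃ u < v, u ∈ R ∧ ¬ bad u) → lab v = 0 := by
    intro v h1 h2 h3
    simp only [hlab, label, hbad, h1, h2, h3, if_true, if_false]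
  have hfirst : ∀ v ∈ R, ¬ bad v → ∃ v₀ ∈ R, ¬ bad v₀ ∧ lab v₀ = 0 := by
    intro v hvR hvb
    obtain ⟨v₀, hv₀, hmin⟩ := Finset.exists_min_image (R.filter fun v => ¬ bad v) id
      ⟨v, by simp [hvR, hvb]⟩
    simp only [Finset.mem_filter, id] at hv₀ hmin
    exact ⟨v₀, hv₀.1, hv₀.2, hlab3 _ hv₀.1 hv₀.2 fun ⟨u, hu, hu'⟩ => absurd (hmin u hu') (by omega)⟩
  have hgood : ∀ u ∈ R, ¬ bad u → ∀ v ∈ R, ¬ bad v → lab u = lab v → u = v := by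
    intro u huR hub v hvR hvb e
    by_cases hu : ∃ w < u, w ∈ R ∧ ¬ bad w <;> by_cases hv : ∃ w < v, w ∈ R ∧ ¬ bad w
    · rw [hlab2 u huR hub hu, hlab2 v hvR hvb hv] at e; omega
    · rw [hlab2 u huR hub hu, hlab3 v hvR hvb hv] at e; omega
    · rw [hlab3 u huR hub hu, hlab2 v hvR hvb hv] at e; omega
    · rcases lt_trichotomy u v with h | h | h
      · exact absurd ⟨u, h, huR, hub⟩ hv
      · exact h
      · exact absurd ⟨v, h, hvR, hvb⟩ hu
  -- a good vertex and a class without good vertices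
  have hmix : ∀ u ∈ R, ¬ bad u → ∀ v ∈ B, ¬ (v ∈ R ∧ ¬ bad v) → ¬ gcl (f v) →
      ∃ v' ∈ B, lab v' = lab v ∧ E.Adj u v' := by
    intro u huR hub v hv hvn hg
    have hngood : ∀ w, f w = f v → ¬ (w ∈ R ∧ ¬ bad w) := fun w e h => hg ⟨w, h.1, h.2, e⟩
    by_cases hN : Ncl (f v)
    · have hvP := hN v hv rfl
      have : ∃ s' ∈ P, f s' = f v ∧ E.Adj u s' := by
        by_contra! hno
        exact hub ⟨huR, v, hvP, hN, hno⟩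
      obtain ⟨s', hs', e, h⟩ := this
      exact ⟨s', hPB hs', by rw [hlab1 _ (hngood s' e), hlab1 _ hvn, e], h⟩
    · simp only [Ncl, not_forall] at hN
      obtain ⟨w, hw, e, hwP⟩ := hN
      have hwR : w ∈ R := by
        by_contra hn; exact hwP (hBPR w hw hn)
      refine ⟨w, hw, by rw [hlab1 _ (hngood w e), hlab1 _ hvn, e], hR u huR w hwR ?_⟩
      rintro rfl
      exact hngood u e ⟨huR, hub⟩
  have hmix' : ∀ u ∈ R, ¬ bad u → ∀ v ∈ B, ¬ (v ∈ R ∧ ¬ bad v) → lab u ≠ lab v →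
      ∃ u' ∈ B, ∃ v' ∈ B, lab u' = lab u ∧ lab v' = lab v ∧ E.Adj u' v' := by
    intro u huR hub v hv hvn hne
    by_cases hg : gcl (f v)
    · obtain ⟨v₀, h0R, h0b, h0⟩ := hfirst u huR hub
      have hv0 : lab v = 0 := by rw [hlab1 v hvn]; simp [γ, hg]
      refine ⟨u, hRB huR, v₀, hRB h0R, rfl, h0.trans hv0.symm, hR u huR v₀ h0R ?_⟩
      rintro rfl
      exact hne (h0.trans hv0.symm)
    · obtain ⟨v', hv', e, h⟩ := hmix u huR hub v hv hvn hg
      exact ⟨u, hRB huR, v', hv', rfl, e, h⟩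
  refine ⟨g, fun v hv => hγlt _ (hJP v hv), fun v hv => ?_, ?_, ?_, ?_⟩
  · rw [hbad] at hv
    exact hγlt _ (hJB v (hRB hv.1) fun h => h.2 hv)
  · refine le_trans (Finset.card_le_card fun v hv => ?_) hFc
    rw [Finset.mem_filter, hbad] at hv
    exact Finset.mem_filter.2 hv
  · rw [← hlab]
    intro u hu v hv hne
    by_cases hun : v ∈ R ∧ ¬ bad v <;> by_cases hvn : u ∈ R ∧ ¬ bad u
    · refine ⟨u, hu, v, hv, rfl, rfl, hR u hvn.1 v hun.1 ?_⟩
      rintro rfl; exact hne rfl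
    · obtain ⟨a, ha, b, hb, e1, e2, h⟩ := hmix' v hun.1 hun.2 u hu hvn hne.symm
      exact ⟨b, hb, a, ha, e2, e1, h.symm⟩
    · exact hmix' u hvn.1 hvn.2 v hv hun hne
    · have eu := hlab1 u hvn
      have ev := hlab1 v hun
      have hz : ∀ x, gcl (f x) → γ (f x) = 0 := fun x hx => by simp [γ, hx]
      by_cases hgu : gcl (f u)
      · have hgv : ¬ gcl (f v) := fun hgv => hne (by rw [eu, ev, hz u hgu, hz v hgv])
        obtain ⟨w, hwR, hwb, hw⟩ := hgu
        obtain ⟨v₀, h0R, h0b, h0⟩ := hfirst w hwR hwb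
        obtain ⟨v', hv', e, h⟩ := hmix v₀ h0R h0b v hv hun hgv
        exact ⟨v₀, hRB h0R, v', hv', by rw [h0, eu, hz u ⟨w, hwR, hwb, hw⟩], e, h⟩
      · by_cases hgv : gcl (f v)
        · obtain ⟨w, hwR, hwb, hw⟩ := hgv
          obtain ⟨v₀, h0R, h0b, h0⟩ := hfirst w hwR hwb
          obtain ⟨u', hu', e, h⟩ := hmix v₀ h0R h0b u hu hvn hgu
          exact ⟨u', hu', v₀, hRB h0R, e, by rw [h0, ev, hz v ⟨w, hwR, hwb, hw⟩], h.symm⟩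
        · obtain ⟨a, ha, b, hb, e1, e2, h⟩ := hadj u hu v hv fun e => hne (by rw [eu, ev, e])
          refine ⟨a, ha, b, hb, ?_, ?_, h⟩
          · rw [hlab1 a fun h => hgu ⟨a, h.1, h.2, e1⟩, eu, e1]
          · rw [hlab1 b fun h => hgv ⟨b, h.1, h.2, e2⟩, ev, e2]
  · refine hcard.trans (Nat.add_le_add_right ?_ k)
    -- Each old class picks a member, a good one whenever possible; these members have pairwise
    -- different new labels.
    have hsec : ∀ c ∈ B.image f, ∃ v ∈ B, f v = c ∧ (gcl c → v ∈ R ∧ ¬ bad v) := by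
      intro c hc
      by_cases hg : gcl c
      · obtain ⟨v, hvR, hvb, e⟩ := hg
        exact ⟨v, hRB hvR, e, fun _ => ⟨hvR, hvb⟩⟩
      · obtain ⟨v, hv, e⟩ := Finset.mem_image.1 hc
        exact ⟨v, hv, e, fun h => absurd h hg⟩
    choose! σ hσ using hsec
    have hval : ∀ c ∈ B.image f, ¬ gcl c → lab (σ c) = γ c ∧ c ∈ J ∧ 1 ≤ γ c := by
      intro c hc hg
      obtain ⟨hB, e, -⟩ := hσ c hc
      have hn : ¬ (σ c ∈ R ∧ ¬ bad (σ c)) := fun h => hg ⟨_, h.1, h.2, e⟩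
      refine ⟨by rw [hlab1 _ hn, e], by have := hJB _ hB hn; rwa [e] at this, ?_⟩
      have := hιpos c
      simp only [γ, hg, if_false]
      split_ifs <;> omega
    have hval' : ∀ c ∈ B.image f, gcl c → lab (σ c) = 0 ∨ 2 * L + 1 ≤ lab (σ c) := by
      intro c hc hg
      obtain ⟨-, -, h⟩ := hσ c hc
      obtain ⟨h1, h2⟩ := h hg
      by_cases h3 : ∃ u < σ c, u ∈ R ∧ ¬ bad u
      · rw [hlab2 _ h1 h2 h3]; omega
      · exact Or.inl (hlab3 _ h1 h2 h3)
    refine Finset.card_le_card_of_injOn (fun c => lab (σ c))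
      (fun c hc => Finset.mem_image_of_mem _ (hσ c hc).1) ?_
    intro c hc c' hc' e
    simp only at e
    by_cases hg : gcl c <;> by_cases hg' : gcl c'
    · have := hgood _ ((hσ c hc).2.2 hg).1 ((hσ c hc).2.2 hg).2 _ ((hσ c' hc').2.2 hg').1
        ((hσ c' hc').2.2 hg').2 e
      rw [← (hσ c hc).2.1, this, (hσ c' hc').2.1]
    · obtain ⟨h1, h2, h3⟩ := hval c' hc' hg'
      have := hval' c hc hg
      have := hγlt c' h2
      omega
    · obtain ⟨h1, h2, h3⟩ := hval c hc hg
      have := hval' c' hc' hg'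
      have := hγlt c h2
      omega
    · obtain ⟨h1, h2, h3⟩ := hval c hc hg
      obtain ⟨h1', h2', h3'⟩ := hval c' hc' hg'
      exact hγinj c h2 c' h2' hg (by omega)

end SimpleGraph

open RAM

/-! ### Ranks and digit codes -/

/-- The number of elements of `Z` below `v`. -/
noncomputable def rank (Z : ℕ → Prop) (v : ℕ) : ℕ := ∑ u ∈ Finset.range v, ind (Z u)

open Classical in
theorem sum_ind_eq_card (Z : ℕ → Prop) (v : ℕ) :
    ∑ u ∈ Finset.range v, ind (Z u) = ((Finset.range v).filter Z).card := by
  rw [Finset.card_filter]; rfl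

theorem rank_congr {Z Z' : ℕ → Prop} {v : ℕ} (h : ∀ u < v, Z u ↔ Z' u) : rank Z v = rank Z' v :=
  Finset.sum_congr rfl fun u hu => ind_congr (h u (Finset.mem_range.1 hu))

theorem rank_lt_rank {Z : ℕ → Prop} {u v : ℕ} (hu : Z u) (huv : u < v) : rank Z u < rank Z v := by
  have h1 : rank Z (u + 1) = rank Z u + 1 := by
    rw [rank, Finset.sum_range_succ, ind_true hu]; rfl
  have h2 : rank Z (u + 1) ≤ rank Z v :=
    Finset.sum_le_sum_of_subset (Finset.range_subset_range.2 huv)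
  omega

theorem rank_injective {Z : ℕ → Prop} {u v : ℕ} (hu : Z u) (hv : Z v) (h : rank Z u = rank Z v) :
    u = v := by
  rcases lt_trichotomy u v with h' | h' | h'
  · exact absurd h (rank_lt_rank hu h').ne
  · exact h'
  · exact absurd h (rank_lt_rank hv h').ne'

open Classical in
/-- Small values at the elements of a set are the digits of some number, in the order of the
elements. -/
theorem exists_code {Z : ℕ → Prop} {n M Q : ℕ} {g : ℕ → ℕ} (hQ : 0 < Q) (hM : rank Z n ≤ M)
    (hg : ∀ v < n, Z v → g v < Q) :
    ∃ t < Q ^ M, ∀ v < n, Z v → t / Q ^ rank Z v % Q = g v := by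
  -- The digit at position `j` is the value at the element of rank `j`; positions that no element
  -- occupies get 0.
  let w : Fin M → Fin Q := fun j =>
    if h : ∃ v < n, Z v ∧ rank Z v = j then ⟨g h.choose, hg _ h.choose_spec.1 h.choose_spec.2.1⟩
    else ⟨0, hQ⟩
  refine ⟨finFunctionFinEquiv w, (finFunctionFinEquiv w).2, fun v hv hZ => ?_⟩
  let j : Fin M := ⟨rank Z v, (rank_lt_rank hZ hv).trans_le hM⟩
  have h1 : ((finFunctionFinEquiv.symm (finFunctionFinEquiv w) j : Fin Q) : ℕ) =
      (finFunctionFinEquiv w : ℕ) / Q ^ rank Z v % Q := rfl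
  rw [← h1, Equiv.symm_apply_apply]
  have h : ∃ v' < n, Z v' ∧ rank Z v' = j := ⟨v, hv, hZ, rfl⟩
  simp only [w, dif_pos h]
  rw [rank_injective h.choose_spec.2.1 hZ h.choose_spec.2.2]

/-! ### Candidate solutions -/

/-- The data from which a candidate solution is computed: the graph `E` on `0, …, n - 1`, a set `S`
whose complement induces a split graph, the bound `L` on the number of labels, the degree
threshold `d`, the vertex `r`, and three sequences of labels. -/
structure Candidate where
  E : SimpleGraph ℕ
  n : ℕ
  S : Finset ℕ
  L : ℕ
  d : ℕ
  r : ℕ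
  D₁ : ℕ → ℕ
  D₂ : ℕ → ℕ
  D₃ : ℕ → ℕ

namespace Candidate

variable (c : Candidate)

/-- The degree of `v` outside `S`. -/
noncomputable def deg (v : ℕ) : ℕ := ∑ u ∈ Finset.range c.n, ind (u ∉ c.S ∧ c.E.Adj v u)

/-- `v` is in the independent set of the split graph outside `S`. -/
def IsI (v : ℕ) : Prop := v ∉ c.S ∧ c.deg v < c.d

/-- `v` is in the clique of the split graph outside `S`. -/
def IsK (v : ℕ) : Prop := v ∉ c.S ∧ ¬ c.deg v < c.d

/-- `v` is one of the guessed elements of the independent set of the solution. -/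
def InA₁ (v : ℕ) : Prop := (v ∈ c.S ∧ c.D₁ (rank (fun u => u ∈ c.S) v) = 2 * c.L) ∨ v = c.r

/-- `v` has a neighbour among the guessed elements. -/
def Hit (v : ℕ) : Prop := ∃ u < c.n, c.InA₁ u ∧ c.E.Adj v u

/-- `v` is in the independent set of the solution. -/
def InA (v : ℕ) : Prop := c.InA₁ v ∨ (c.IsI v ∧ ¬ c.Hit v)

/-- `v` is in the independent set of the split graph, but not in that of the solution. -/
def IsZ (v : ℕ) : Prop := c.IsI v ∧ c.Hit v

/-- `v` is in the clique of the split graph and was not guessed. -/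
def IsR (v : ℕ) : Prop := c.IsK v ∧ v ≠ c.r

/-- `v` is another vertex that is not in the independent set of the solution. -/
def IsP (v : ℕ) : Prop := ¬ c.InA v ∧ ¬ c.IsR v

open Classical in
/-- The guessed label of `v`, if `IsP v`. -/
noncomputable def labP (v : ℕ) : ℕ :=
  if v ∈ c.S then c.D₁ (rank (fun u => u ∈ c.S) v) else c.D₂ (rank c.IsZ v)

/-- The vertices that cannot be singletons. -/
def Bad (v : ℕ) : Prop :=
  c.IsR v ∧ ∃ s < c.n, (c.IsP s ∧ c.L ≤ c.labP s) ∧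
    ∀ s' < c.n, ¬ (c.IsP s' ∧ c.labP s' = c.labP s ∧ c.E.Adj v s')

open Classical in
/-- The label of `v`. -/
noncomputable def lab (v : ℕ) : ℕ :=
  if c.IsR v then
    if c.Bad v then c.D₃ (rank c.Bad v)
    else if ∃ u < v, c.IsR u ∧ ¬ c.Bad u then 2 * c.L + 1 + v else 0
  else c.labP v

/-- The candidate is a solution. -/
def Check (k : ℕ) : Prop :=
  (∀ u < c.n, ∀ v < c.n, ¬ (c.InA u ∧ c.InA v ∧ c.E.Adj u v)) ∧
  (∀ u < c.n, ∀ v < c.n, (c.InA u ∨ c.InA v ∨ c.lab u = c.lab v) ∨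
    ∃ u' < c.n, ∃ v' < c.n, (¬ c.InA u' ∧ c.lab u' = c.lab u) ∧ (¬ c.InA v' ∧ c.lab v' = c.lab v) ∧
      c.E.Adj u' v') ∧
  ∑ v ∈ Finset.range c.n, ind (¬ c.InA v ∧ ∃ u < v, ¬ c.InA u ∧ c.lab u = c.lab v) ≤ k

end Candidate

open Classical in
-- The first elements of the classes count the classes. The number of identifications is thus the
-- number of elements preceded by an element of the same class, which is a bounded sum.
theorem card_eq_card_image_add (B : Finset ℕ) (f : ℕ → ℕ) :
    B.card = (B.image f).card + (B.filter fun v => ∃ u < v, u ∈ B ∧ f u = f v).card := by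
  rw [← Finset.card_filter_add_card_filter_not (s := B) (fun v => ∃ u < v, u ∈ B ∧ f u = f v),
    add_comm]
  congr 1
  rw [← Finset.card_image_of_injOn (f := f)]
  · congr 1
    ext y
    simp only [Finset.mem_image, Finset.mem_filter]
    constructor
    · rintro ⟨v, ⟨hv, -⟩, rfl⟩
      exact ⟨v, hv, rfl⟩
    · rintro ⟨v, hv, rfl⟩
      obtain ⟨u, hu, hmin⟩ := Finset.exists_min_image (B.filter fun u => f u = f v) id
        ⟨v, by simp [hv]⟩
      simp only [Finset.mem_filter, id] at hu hmin
      refine ⟨u, ⟨hu.1, ?_⟩, hu.2⟩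
      rintro ⟨w, hw, hwB, e⟩
      exact absurd (hmin w ⟨hwB, e.trans hu.2⟩) (by omega)
  · intro u hu v hv e
    simp only [Finset.coe_filter, Set.mem_ofPred_eq] at hu hv
    rcases lt_trichotomy u v with h | h | h
    · exact absurd ⟨u, h, hu.1, e⟩ hv.2
    · exact h
    · exact absurd ⟨v, h, hv.1, e.symm⟩ hu.2

open Classical in
/-- A check of the candidate decides whether the encoded set and partition are a solution. -/
theorem Candidate.isNatSolution_iff_check (c : Candidate) {k : ℕ} {A : Finset ℕ} {f : ℕ → ℕ}
    (hA : A ⊆ Finset.range c.n) (hcA : ∀ v < c.n, c.InA v ↔ v ∈ A)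
    (hf : ∀ v < c.n, v ∉ A → c.lab v = f v) :
    c.E.IsNatSolution c.n k A f ↔ c.Check k := by
  have hB : ∀ v, v ∈ Finset.range c.n \ A ↔ v < c.n ∧ ¬ c.InA v := fun v => by
    rw [Finset.mem_sdiff, Finset.mem_range]
    exact and_congr_right fun h => not_congr (hcA v h).symm
  have hf' : ∀ v < c.n, ¬ c.InA v → c.lab v = f v := fun v hv h => hf v hv ((hcA v hv).not.1 h)
  have h3 : ((Finset.range c.n \ A).filter fun v => ∃ u < v, u ∈ Finset.range c.n \ A ∧
      f u = f v).card =
      ∑ v ∈ Finset.range c.n, ind (¬ c.InA v ∧ ∃ u < v, ¬ c.InA u ∧ c.lab u = c.lab v) := by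
    rw [sum_ind_eq_card]
    congr 1
    ext v
    simp only [Finset.mem_filter, hB, Finset.mem_range]
    constructor
    · rintro ⟨⟨hv, hvA⟩, u, huv, ⟨hu, huA⟩, e⟩
      exact ⟨hv, hvA, u, huv, huA, by rw [hf' u hu huA, hf' v hv hvA, e]⟩
    · rintro ⟨hv, hvA, u, huv, huA, e⟩
      exact ⟨⟨hv, hvA⟩, u, huv, ⟨huv.trans hv, huA⟩, by
        rw [← hf' u (huv.trans hv) huA, ← hf' v hv hvA, e]⟩
  unfold SimpleGraph.IsNatSolution Candidate.Check
  rw [card_eq_card_image_add (Finset.range c.n \ A) f, h3]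
  constructor
  · rintro ⟨-, h1, h2, h4⟩
    refine ⟨?_, ?_, by omega⟩
    · rintro u hu v hv ⟨huA, hvA, h⟩
      exact h1 u ((hcA u hu).1 huA) v ((hcA v hv).1 hvA) h
    · intro u hu v hv
      rw [or_iff_not_imp_left]
      intro hn
      push Not at hn
      obtain ⟨huA, hvA, hne⟩ := hn
      rw [hf' u hu huA, hf' v hv hvA] at hne ⊢
      obtain ⟨u', hu', v', hv', e1, e2, h⟩ := h2 u ((hB u).2 ⟨hu, huA⟩) v ((hB v).2 ⟨hv, hvA⟩) hne
      rw [hB] at hu' hv'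
      exact ⟨u', hu'.1, v', hv'.1, ⟨hu'.2, by rw [hf' u' hu'.1 hu'.2, e1]⟩,
        ⟨hv'.2, by rw [hf' v' hv'.1 hv'.2, e2]⟩, h⟩
  · rintro ⟨h1, h2, h4⟩
    refine ⟨hA, ?_, ?_, by omega⟩
    · intro u hu v hv h
      have hu' := Finset.mem_range.1 (hA hu)
      have hv' := Finset.mem_range.1 (hA hv)
      exact h1 u hu' v hv' ⟨(hcA u hu').2 hu, (hcA v hv').2 hv, h⟩
    · intro u hu v hv hne
      rw [hB] at hu hv
      rcases h2 u hu.1 v hv.1 with h | ⟨u', hu', v', hv', ⟨hu'A, e1⟩, ⟨hv'A, e2⟩, h⟩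
      · rw [hf' u hu.1 hu.2, hf' v hv.1 hv.2] at h
        tauto
      · rw [hf' u' hu' hu'A, hf' u hu.1 hu.2] at e1
        rw [hf' v' hv' hv'A, hf' v hv.1 hv.2] at e2
        exact ⟨u', (hB u').2 ⟨hu', hu'A⟩, v', (hB v').2 ⟨hv', hv'A⟩, e1, e2, h⟩

/-! ### Small covers of the obstructions, and completeness of the candidates -/

open SimpleGraph

/-- `S` is a small set that meets all obstructions. -/
def IsSmallCover (E : SimpleGraph ℕ) (n : ℕ) (S : Finset ℕ) : Prop :=
  S ⊆ Finset.range n ∧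
  (∀ a < n, ∀ b < n, ∀ c < n, ∀ d < n, ∀ e < n, a ∉ S → b ∉ S → c ∉ S → d ∉ S → e ∉ S →
    ¬ E.IsObstruction a b c d e) ∧
  ∀ X : Finset ℕ, (∀ a < n, ∀ b < n, ∀ c < n, ∀ d < n, ∀ e < n, E.IsObstruction a b c d e →
    a ∈ X ∨ b ∈ X ∨ c ∈ X ∨ d ∈ X ∨ e ∈ X) → S.card ≤ 5 * (S ∩ X).card

open Classical in
-- Completeness of the search: the parameters are read off from a dominating solution brought into
-- the normal form of `exists_label`. The number `14 * k + 1` bounds both the lengths of the three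
-- words and the number of labels needed for `P` (at most `12 * k + 1` vertices) and the bad
-- vertices (at most `2 * k`).
theorem exists_candidate {E : SimpleGraph ℕ} {n k : ℕ} {S A : Finset ℕ} {f : ℕ → ℕ}
    (hS : IsSmallCover E n S) (hsol : E.IsNatSolution n k A f)
    (hdom : ∀ y ∈ Finset.range n \ A, ∃ a ∈ A, E.Adj y a) {M L Q : ℕ} (hM : M = 14 * k + 1)
    (hL : L = M + 1) (hQ : Q = 2 * L + 1) :
    ∃ d ≤ n, ∃ r ≤ n, ∃ t₁ < Q ^ M, ∃ t₂ < Q ^ M, ∃ t₃ < Q ^ M,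
      (Candidate.mk E n S L d r (fun j => t₁ / Q ^ j % Q) (fun j => t₂ / Q ^ j % Q)
        (fun j => t₃ / Q ^ j % Q)).Check k := by
  obtain ⟨hSn, hSobs, hSX⟩ := hS
  obtain ⟨hAn, hA, hadj, hcard⟩ := id hsol
  set B := Finset.range n \ A with hBdef
  have hB : ∀ v, v ∈ B ↔ v < n ∧ v ∉ A := fun v => by simp [hBdef]
  -- the vertices in nontrivial classes
  set X := B.filter fun v => ∃ u ∈ B, u ≠ v ∧ f u = f v with hXdef
  have hXc : X.card ≤ 2 * k := card_nontrivial_classes_le hcard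
  have hBX : ∀ u ∈ B, u ∉ X → ∀ v ∈ B, v ∉ X → u ≠ v → E.Adj u v := by
    have hsing : ∀ u ∈ B, u ∉ X → ∀ w ∈ B, f w = f u → w = u := by
      intro u hu huX w hw e
      by_contra hne
      exact huX (Finset.mem_filter.2 ⟨hu, w, hw, hne, e⟩)
    intro u hu huX v hv hvX huv
    obtain ⟨u', hu', v', hv', e1, e2, h⟩ :=
      hadj u hu v hv fun e => huv (hsing v hv hvX u hu e)
    rwa [hsing u hu huX u' hu' e1, hsing v hv hvX v' hv' e2] at h
  -- Outside `X` the set `A` and the singleton classes form a split graph, so `X` meets every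
  -- obstruction.
  have hScard : S.card ≤ 10 * k := by
    have h1 := hSX X ?_
    · have h2 : (S ∩ X).card ≤ X.card := Finset.card_le_card Finset.inter_subset_right
      omega
    · intro a ha b hb c hc d hd e he hobs
      by_contra! hno
      refine hobs.false_of_split (A := (A : Set ℕ)) (fun u _ v _ hu hv => hA u hu v hv) ?_
      have hall : ∀ u ∈ ({a, b, c, d, e} : Set ℕ), u < n ∧ u ∉ X := by
        rintro u (rfl | rfl | rfl | rfl | rfl)
        · exact ⟨ha, hno.1⟩
        · exact ⟨hb, hno.2.1⟩
        · exact ⟨hc, hno.2.2.1⟩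
        · exact ⟨hd, hno.2.2.2.1⟩
        · exact ⟨he, hno.2.2.2.2⟩
      intro u hu v hv huA hvA huv
      exact hBX u ((hB u).2 ⟨(hall u hu).1, huA⟩) (hall u hu).2 v
        ((hB v).2 ⟨(hall v hv).1, hvA⟩) (hall v hv).2 huv
  -- the split graph outside `S`
  set U := Finset.range n \ S with hUdef
  have hU : ∀ v, v ∈ U ↔ v < n ∧ v ∉ S := fun v => by simp [hUdef]
  obtain ⟨d, hdU, hKcl, hIind⟩ := exists_degree_threshold E U fun a ha b hb c hc d hd e he =>
    hSobs a ((hU a).1 ha).1 b ((hU b).1 hb).1 c ((hU c).1 hc).1 d ((hU d).1 hd).1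
      e ((hU e).1 he).1 ((hU a).1 ha).2 ((hU b).1 hb).2 ((hU c).1 hc).2 ((hU d).1 hd).2
      ((hU e).1 he).2
  have hdn : d ≤ n := hdU.trans ((Finset.card_le_card Finset.sdiff_subset).trans
    (Finset.card_range n).le)
  set dg : ℕ → ℕ := fun u => (U.filter fun w => E.Adj u w).card with hdg
  -- `A` is independent and meets the clique in at most one vertex `r`; the value `n` stands for no
  -- such vertex.
  have hr : ∃ r ≤ n, ∀ v < n, v = r ↔ (v ∈ A ∧ v ∈ U ∧ d ≤ dg v) := by
    by_cases h : ∃ r ∈ A, r ∈ U ∧ d ≤ dg r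
    · obtain ⟨r, hrA, hrU, hrd⟩ := h
      refine ⟨r, ((hU r).1 hrU).1.le, fun v _ => ⟨?_, ?_⟩⟩
      · rintro rfl
        exact ⟨hrA, hrU, hrd⟩
      · rintro ⟨hvA, hvU, hvd⟩
        by_contra hne
        exact hA v hvA r hrA (hKcl v hvU r hrU hvd hrd hne)
    · refine ⟨n, le_rfl, fun v hv => ⟨fun e => absurd e hv.ne, ?_⟩⟩
      rintro ⟨h1, h2, h3⟩
      exact absurd ⟨v, h1, h2, h3⟩ h
  obtain ⟨r, hrn, hr⟩ := hr
  let R := U.filter fun v => d ≤ dg v ∧ v ∉ A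
  let Z := U.filter fun v => dg v < d ∧ v ∉ A
  let P := B \ R
  have hR : ∀ v, v ∈ R ↔ v ∈ U ∧ d ≤ dg v ∧ v ∉ A := fun v => Finset.mem_filter
  have hZ : ∀ v, v ∈ Z ↔ v ∈ U ∧ dg v < d ∧ v ∉ A := fun v => Finset.mem_filter
  have hP : ∀ v, v ∈ P ↔ v ∈ B ∧ v ∉ R := fun v => Finset.mem_sdiff
  -- Two vertices of `Z` outside `X` would be singleton classes, hence adjacent, but `Z` is
  -- independent.
  have hZc : Z.card ≤ 2 * k + 1 := by
    have h1 : (Z \ X).card ≤ 1 := by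
      refine Finset.card_le_one.2 fun u hu v hv => ?_
      rw [Finset.mem_sdiff, hZ] at hu hv
      by_contra hne
      exact hIind u hu.1.1 v hv.1.1 hu.1.2.1 hv.1.2.1
        (hBX u ((hB u).2 ⟨((hU u).1 hu.1.1).1, hu.1.2.2⟩) hu.2 v
          ((hB v).2 ⟨((hU v).1 hv.1.1).1, hv.1.2.2⟩) hv.2 hne)
    have h2 : Z.card ≤ (Z \ X).card + X.card := by
      have := Finset.card_le_card (show Z ⊆ (Z \ X) ∪ X by
        intro v hv; by_cases h : v ∈ X <;> simp [hv, h])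
      exact this.trans (Finset.card_union_le _ _)
    omega
  have hPc : P.card ≤ 12 * k + 1 := by
    have : P ⊆ S ∪ Z := by
      intro v hv
      rw [hP, hB, hR] at hv
      rw [Finset.mem_union, hZ, hU]
      rw [hU] at hv
      by_cases hvS : v ∈ S
      · exact Or.inl hvS
      · refine Or.inr ⟨⟨hv.1.1, hvS⟩, ?_, hv.1.2⟩
        by_contra hn
        exact hv.2 ⟨⟨hv.1.1, hvS⟩, not_lt.1 hn, hv.1.2⟩
    have := (Finset.card_le_card this).trans (Finset.card_union_le _ _)
    omega
  obtain ⟨g, hgP, hgbad, hbadc, hlabadj, hlabc⟩ := exists_label (E := E) (B := B) (P := P) (R := R)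
    (f := f) (k := k) (L := L) Finset.sdiff_subset
    (fun v hv => (hB v).2 ⟨((hU v).1 ((hR v).1 hv).1).1, ((hR v).1 hv).2.2⟩)
    (fun v hv hvR => (hP v).2 ⟨hv, hvR⟩) (fun v hv => ((hP v).1 hv).2)
    (fun u hu v hv huv => hKcl u ((hR u).1 hu).1 v ((hR v).1 hv).1 ((hR u).1 hu).2.1
      ((hR v).1 hv).2.1 huv) hadj hcard (by omega)
  -- the codes
  have hrank : ∀ T : Finset ℕ, T ⊆ Finset.range n → rank (fun v => v ∈ T) n = T.card := by
    intro T hT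
    rw [rank, sum_ind_eq_card]
    congr 1
    ext v
    simp only [Finset.mem_filter]
    exact ⟨fun h => h.2, fun h => ⟨hT h, h⟩⟩
  have hUn : U ⊆ Finset.range n := Finset.sdiff_subset
  -- Labels stay below `2 * L`, so the digit `2 * L` is free to mark the members of `A`; this is why
  -- the base is `2 * L + 1`.
  obtain ⟨t₁, ht₁, hD₁⟩ := exists_code (Z := fun v => v ∈ S) (n := n) (M := M) (Q := Q)
    (g := fun v => if v ∈ A then 2 * L else g v) (by omega) (by rw [hrank S hSn]; omega)
    (fun v hv hvS => by
      split_ifs with h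
      · omega
      · have := hgP v ((hP v).2 ⟨(hB v).2 ⟨hv, h⟩, fun hvR =>
          ((hU v).1 ((hR v).1 hvR).1).2 hvS⟩)
        omega)
  obtain ⟨t₂, ht₂, hD₂⟩ := exists_code (Z := fun v => v ∈ Z) (n := n) (M := M) (Q := Q)
    (g := g) (by omega) (by
      rw [hrank Z ((Finset.filter_subset _ _).trans hUn)]; omega)
    (fun v hv hvZ => by
      have hvZ' := (hZ v).1 hvZ
      have := hgP v ((hP v).2 ⟨(hB v).2 ⟨hv, hvZ'.2.2⟩, fun hvR =>
        absurd hvZ'.2.1 (not_lt.2 ((hR v).1 hvR).2.1)⟩)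
      omega)
  obtain ⟨t₃, ht₃, hD₃⟩ := exists_code (Z := IsBad E P R L g) (n := n) (M := M) (Q := Q)
    (g := g) (by omega) (by
      have e : rank (IsBad E P R L g) n =
          rank (fun v => v ∈ R.filter fun v => IsBad E P R L g v) n := by
        refine rank_congr fun u _ => ?_
        simp only [Finset.mem_filter]
        exact ⟨fun h => ⟨h.1, h⟩, fun h => h.2⟩
      rw [e, hrank (R.filter fun v => IsBad E P R L g v)
        ((Finset.filter_subset _ _).trans ((Finset.filter_subset _ _).trans hUn))]
      omega)
    (fun v hv hvb => by have := hgbad v hvb; omega)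
  refine ⟨d, hdn, r, hrn, t₁, ht₁, t₂, ht₂, t₃, ht₃, ?_⟩
  set c : Candidate := Candidate.mk E n S L d r (fun j => t₁ / Q ^ j % Q) (fun j => t₂ / Q ^ j % Q)
    (fun j => t₃ / Q ^ j % Q) with hc
  have hdeg : ∀ v, c.deg v = dg v := by
    intro v
    rw [Candidate.deg, sum_ind_eq_card]
    simp only [hdg]
    congr 1
    ext u
    simp only [Finset.mem_filter, hU, Finset.mem_range, hc, and_assoc]
  have hI : ∀ v < n, c.IsI v ↔ v ∈ U ∧ dg v < d := fun v hv => by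
    rw [Candidate.IsI, hdeg, hU]; simp [hc, hv]
  have hK : ∀ v < n, c.IsK v ↔ v ∈ U ∧ d ≤ dg v := fun v hv => by
    rw [Candidate.IsK, hdeg, hU, not_lt]; simp [hc, hv]
  have hA₁ : ∀ v < n, c.InA₁ v ↔ v ∈ A ∧ (v ∈ S ∨ d ≤ dg v) := by
    intro v hv
    have e1 : c.InA₁ v ↔ (v ∈ S ∧ t₁ / Q ^ rank (fun u => u ∈ S) v % Q = 2 * L) ∨ v = r := Iff.rfl
    rw [e1, hr v hv]
    by_cases hvS : v ∈ S
    · rw [hD₁ v hv hvS]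
      by_cases hvA : v ∈ A
      · simp [hvS, hvA]
      · have := hgP v ((hP v).2 ⟨(hB v).2 ⟨hv, hvA⟩, fun hvR =>
          ((hU v).1 ((hR v).1 hvR).1).2 hvS⟩)
        simp only [hvA, if_false, false_and, or_false, iff_false, not_and]
        omega
    · simp [hvS, hU, hv]
  -- Domination is used here: the neighbour in `A` of a vertex `v` on the independent side cannot be
  -- on that side too, so it is among the guessed elements.
  have hhit : ∀ v < n, v ∈ U → dg v < d → (c.Hit v ↔ v ∉ A) := by
    intro v hv hvU hvd
    constructor
    · rintro ⟨u, hu, huA, h⟩ hvA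
      exact hA v hvA u ((hA₁ u hu).1 huA).1 h
    · intro hvA
      obtain ⟨a, haA, h⟩ := hdom v ((hB v).2 ⟨hv, hvA⟩)
      have han := Finset.mem_range.1 (hAn haA)
      refine ⟨a, han, (hA₁ a han).2 ⟨haA, ?_⟩, h⟩
      by_contra! hno
      exact hIind v hvU a ((hU a).2 ⟨han, hno.1⟩) hvd hno.2 h
  have hcA : ∀ v < n, c.InA v ↔ v ∈ A := by
    intro v hv
    rw [Candidate.InA, hA₁ v hv, hI v hv]
    constructor
    · rintro (h | ⟨⟨h1, h2⟩, h3⟩)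
      · exact h.1
      · rw [hhit v hv h1 h2] at h3
        exact not_not.1 h3
    · intro hvA
      by_cases hno : v ∈ S ∨ d ≤ dg v
      · exact Or.inl ⟨hvA, hno⟩
      · push Not at hno
        have hvU := (hU v).2 ⟨hv, hno.1⟩
        exact Or.inr ⟨⟨hvU, hno.2⟩, fun h => (hhit v hv hvU hno.2).1 h hvA⟩
  have hcZ : ∀ v < n, c.IsZ v ↔ v ∈ Z := by
    intro v hv
    rw [Candidate.IsZ, hI v hv, hZ]
    constructor
    · rintro ⟨⟨h1, h2⟩, h3⟩
      exact ⟨h1, h2, (hhit v hv h1 h2).1 h3⟩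
    · rintro ⟨h1, h2, h3⟩
      exact ⟨⟨h1, h2⟩, (hhit v hv h1 h2).2 h3⟩
  have hcR : ∀ v < n, c.IsR v ↔ v ∈ R := by
    intro v hv
    have e1 : c.IsR v ↔ c.IsK v ∧ v ≠ r := Iff.rfl
    rw [e1, hK v hv, Ne, hr v hv, hR]
    tauto
  have hcP : ∀ v < n, c.IsP v ↔ v ∈ P := by
    intro v hv
    rw [Candidate.IsP, hcA v hv, hcR v hv, hP, hB]
    tauto
  have hlabP : ∀ v ∈ P, c.labP v = g v := by
    intro v hvP
    obtain ⟨hvB, hvR⟩ := (hP v).1 hvP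
    obtain ⟨hv, hvA⟩ := (hB v).1 hvB
    by_cases hvS : v ∈ S
    · have e1 : c.labP v = t₁ / Q ^ rank (fun u => u ∈ S) v % Q := if_pos hvS
      rw [e1, hD₁ v hv hvS, if_neg hvA]
    · have e1 : c.labP v = t₂ / Q ^ rank c.IsZ v % Q := if_neg hvS
      have hvU := (hU v).2 ⟨hv, hvS⟩
      rw [e1, rank_congr fun u hu => hcZ u (hu.trans hv), hD₂ v hv]
      rw [hZ]
      refine ⟨hvU, ?_, hvA⟩
      by_contra hn
      exact hvR ((hR v).2 ⟨hvU, not_lt.1 hn, hvA⟩)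
  have hPn : ∀ v ∈ P, v < n := fun v hv => ((hB v).1 ((hP v).1 hv).1).1
  have hcbad : ∀ v < n, c.Bad v ↔ IsBad E P R L g v := by
    intro v hv
    rw [Candidate.Bad, IsBad, hcR v hv]
    refine and_congr_right fun hvR => ?_
    constructor
    · rintro ⟨s, hs, ⟨h1, h2⟩, h3⟩
      rw [hcP s hs] at h1
      rw [hlabP s h1] at h2 h3
      refine ⟨s, h1, h2, fun s' hs' e h => h3 s' (hPn s' hs') ⟨(hcP s' (hPn s' hs')).2 hs', ?_, h⟩⟩
      rw [hlabP s' hs', e]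
    · rintro ⟨s, hs, h2, h3⟩
      refine ⟨s, hPn s hs, ⟨(hcP s (hPn s hs)).2 hs, by rw [hlabP s hs]; exact h2⟩, ?_⟩
      rintro s' hs' ⟨h1, e, h⟩
      rw [hcP s' hs'] at h1
      rw [hlabP s hs, hlabP s' h1] at e
      exact h3 s' h1 e h
  have hlab : ∀ v < n, v ∉ A → c.lab v = label E P R L g v := by
    intro v hv hvA
    rw [Candidate.lab, label]
    by_cases hvR : v ∈ R
    · rw [if_pos ((hcR v hv).2 hvR), if_pos hvR]
      by_cases hvb : IsBad E P R L g v
      · rw [if_pos ((hcbad v hv).2 hvb), if_pos hvb, rank_congr fun u hu => hcbad u (hu.trans hv)]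
        exact hD₃ v hv hvb
      · rw [if_neg fun h => hvb ((hcbad v hv).1 h), if_neg hvb]
        have : (∃ u < v, c.IsR u ∧ ¬ c.Bad u) ↔ ∃ u < v, u ∈ R ∧ ¬ IsBad E P R L g u :=
          exists_congr fun u => and_congr_right fun hu => by
            rw [hcR u (hu.trans hv), hcbad u (hu.trans hv)]
        simp only [this]
        rfl
    · rw [if_neg fun h => hvR ((hcR v hv).1 h), if_neg hvR]
      exact hlabP v ((hP v).2 ⟨(hB v).2 ⟨hv, hvA⟩, hvR⟩)
  refine (c.isNatSolution_iff_check hAn hcA hlab).1 ⟨hAn, hA, hlabadj, hlabc⟩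

open Classical in
-- Soundness needs no assumption on the digits, on `S` or on the threshold: the check verifies all
-- conditions directly.
theorem Candidate.Check.isNatSolution {c : Candidate} {k : ℕ} (h : c.Check k) :
    ∃ A f, c.E.IsNatSolution c.n k A f :=
  ⟨(Finset.range c.n).filter c.InA, c.lab, (c.isNatSolution_iff_check (Finset.filter_subset _ _)
    (fun v hv => by simp [hv]) fun _ _ _ => rfl).2 h⟩

/-- The answer is yes if and only if one of the candidates passes the check. -/
theorem splitIdentification_iff_exists_candidate {n k : ℕ} {G : SimpleGraph (Fin n)} (hn : 1 ≤ n)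
    {E : SimpleGraph ℕ} (hE : E = G.map (Fin.valEmbedding : Fin n ↪ ℕ)) {S : Finset ℕ}
    (hS : IsSmallCover E n S) {M L Q : ℕ} (hM : M = 14 * k + 1)
    (hL : L = M + 1) (hQ : Q = 2 * L + 1) :
    G.SplitIdentification k ↔
      ∃ d < n + 1, ∃ r < n + 1, ∃ t₁ < Q ^ M, ∃ t₂ < Q ^ M, ∃ t₃ < Q ^ M,
      (Candidate.mk E n S L d r (fun j => t₁ / Q ^ j % Q) (fun j => t₂ / Q ^ j % Q)
        (fun j => t₃ / Q ^ j % Q)).Check k := by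
  subst hE
  constructor
  · intro h
    obtain ⟨A, f, h⟩ := h.exists_isSolution
    obtain ⟨A, f, h⟩ := h.exists_isNatSolution
    obtain ⟨A, f, h, hdom⟩ := h.exists_dominating
    obtain ⟨d, hd, r, hr, h⟩ := exists_candidate hS h hdom hM hL hQ
    exact ⟨d, Nat.lt_succ_of_le hd, r, Nat.lt_succ_of_le hr, h⟩
  · rintro ⟨d, -, r, -, t₁, -, t₂, -, t₃, -, h⟩
    obtain ⟨A, f, h⟩ := h.isNatSolution
    have : Nonempty (Fin n) := ⟨⟨0, hn⟩⟩
    exact h.isSolution.splitIdentification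

namespace RAM

/-! ### The codes of the algorithm

Register `0` holds `n`, register `1` holds `k`, and registers `2`, `3`, `4`, `5` hold `L`, `Q`, `M`,
`Q ^ M`. Array `0` holds the adjacency matrix, array `1` the set `S`, and array `2` the powers
of `Q`. -/

/-- Adjacency. -/
def adjC (u v : ℕ → Program) : ℕ → Program := getC 0 (addC (mulC u (regC 0)) v)

/-- Membership in `S`. -/
def memC (v : ℕ → Program) : ℕ → Program := getC 1 v

/-- Digits in base `Q`. -/
def digitC (t j : ℕ → Program) : ℕ → Program :=
  iteC (leC j (regC 4)) (modC (divC t (getC 2 j)) (regC 3)) (constC 0)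

/-- Five values, or five codes, that determine a candidate. -/
structure Guess (α : Type) where
  d : α
  r : α
  t₁ : α
  t₂ : α
  t₃ : α

/-- Degree outside `S`. -/
def degC (v : ℕ → Program) : ℕ → Program :=
  sumC (regC 0) fun u => andC (notC (memC u)) (adjC v u)

section codes

variable (γ : Guess (ℕ → Program)) (v : ℕ → Program)

/-- Code of `Candidate.IsI`. -/
def isIC : ℕ → Program := andC (notC (memC v)) (ltC (degC v) γ.d)

/-- Code of `Candidate.IsK`. -/
def isKC : ℕ → Program := andC (notC (memC v)) (notC (ltC (degC v) γ.d))

/-- Code of `Candidate.InA₁`. -/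
def inA₁C : ℕ → Program :=
  orC (andC (memC v) (eqC (digitC γ.t₁ (sumC v memC)) (addC (regC 2) (regC 2)))) (eqC v γ.r)

/-- Code of `Candidate.Hit`. -/
def hitC : ℕ → Program := exC (regC 0) fun u => andC (inA₁C γ u) (adjC v u)

/-- Code of `Candidate.InA`. -/
def inAC : ℕ → Program := orC (inA₁C γ v) (andC (isIC γ v) (notC (hitC γ v)))

/-- Code of `Candidate.IsZ`. -/
def isZC : ℕ → Program := andC (isIC γ v) (hitC γ v)

/-- Code of `Candidate.IsR`. -/
def isRC : ℕ → Program := andC (isKC γ v) (notC (eqC v γ.r))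

/-- Code of `Candidate.IsP`. -/
def isPC : ℕ → Program := andC (notC (inAC γ v)) (notC (isRC γ v))

/-- Code of `Candidate.labP`. -/
def labPC : ℕ → Program :=
  iteC (memC v) (digitC γ.t₁ (sumC v memC)) (digitC γ.t₂ (sumC v (isZC γ)))

/-- Code of `Candidate.Bad`. -/
def badC : ℕ → Program :=
  andC (isRC γ v) (exC (regC 0) fun s => andC (andC (isPC γ s) (leC (regC 2) (labPC γ s)))
    (allC (regC 0) fun s' =>
      notC (andC (isPC γ s') (andC (eqC (labPC γ s') (labPC γ s)) (adjC v s')))))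

/-- Code of `Candidate.lab`. -/
def labC : ℕ → Program :=
  iteC (isRC γ v)
    (iteC (badC γ v) (digitC γ.t₃ (sumC v (badC γ)))
      (iteC (exC v fun u => andC (isRC γ u) (notC (badC γ u)))
        (addC (addC (addC (regC 2) (regC 2)) (constC 1)) v) (constC 0)))
    (labPC γ v)

/-- Code of `Candidate.Check`. -/
def checkC : ℕ → Program :=
  andC (allC (regC 0) fun u => allC (regC 0) fun v =>
      notC (andC (inAC γ u) (andC (inAC γ v) (adjC u v))))
    (andC (allC (regC 0) fun u => allC (regC 0) fun v =>
        orC (orC (inAC γ u) (orC (inAC γ v) (eqC (labC γ u) (labC γ v))))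
          (exC (regC 0) fun u' => exC (regC 0) fun v' =>
            andC (andC (notC (inAC γ u')) (eqC (labC γ u') (labC γ u)))
              (andC (andC (notC (inAC γ v')) (eqC (labC γ v') (labC γ v))) (adjC u' v'))))
      (leC (sumC (regC 0) fun v => andC (notC (inAC γ v)) (exC v fun u =>
        andC (notC (inAC γ u)) (eqC (labC γ u) (labC γ v)))) (regC 1)))

end codes

/-- Code of the search for a candidate. -/
def searchC : ℕ → Program :=
  exC (addC (regC 0) (constC 1)) fun d => exC (addC (regC 0) (constC 1)) fun r =>
    exC (regC 5) fun t₁ => exC (regC 5) fun t₂ => exC (regC 5) fun t₃ => checkC ⟨d, r, t₁, t₂, t₃⟩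

/-! ### Correctness of the codes -/

/-- The memory holds the graph `E` with `n` vertices and the set `S`. -/
structure Base (N : ℕ) (E : SimpleGraph ℕ) (n : ℕ) (S : Finset ℕ) (w : World) : Prop where
  two_le : 2 ≤ N
  n_le : n + 1 ≤ N
  lvl : 6 ≤ w.lvl
  reg_zero : w.st.reg 0 = n
  adj : ∀ u < n, ∀ v < n, w.st.arr 0 (u * n + v) = ind (E.Adj u v)
  mem : ∀ v, w.st.arr 1 v = ind (v ∈ S)

/-- The memory holds in addition the numbers that depend on `k`. -/
structure Full (N : ℕ) (E : SimpleGraph ℕ) (n : ℕ) (S : Finset ℕ) (k L Q M : ℕ) (w : World) :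
    Prop extends Base N E n S w where
  pow_le : Q ^ M ≤ N
  Q_pos : 0 < Q
  reg_one : w.st.reg 1 = k
  reg_two : w.st.reg 2 = L
  reg_three : w.st.reg 3 = Q
  reg_four : w.st.reg 4 = M
  reg_five : w.st.reg 5 = Q ^ M
  pow : ∀ j ≤ M, w.st.arr 2 j = Q ^ j

section Base

variable {N : ℕ} {E : SimpleGraph ℕ} {n : ℕ} {S : Finset ℕ} {w w' : World} {x y : ℕ → Program}
  {u v : ℕ}

theorem Base.mono (h : Base N E n S w) (hw : w.Le w') : Base N E n S w' where
  two_le := h.two_le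
  n_le := h.n_le
  lvl := h.lvl.trans hw.1
  reg_zero := (hw.2.1 0 (by have := h.lvl; omega)).trans h.reg_zero
  adj := hw.2.2 ▸ h.adj
  mem := hw.2.2 ▸ h.mem

theorem Base.ev_n (h : Base N E n S w) : Ev N w (regC 0) n :=
  (Ev.reg h.two_le (by have := h.lvl; omega)).congr h.reg_zero

theorem Base.ex (h : Base N E n S w) {body : (ℕ → Program) → ℕ → Program} {P : ℕ → Prop}
    (hb : ∀ w', w.Le w' → ∀ u < n, ∀ x, Ev N w' x u → Dec N w' (body x) (P u)) :
    Dec N w (exC (regC 0) body) (∃ u < n, P u) :=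
  Dec.ex h.two_le (by have := h.n_le; omega) h.ev_n hb

theorem Base.all (h : Base N E n S w) {body : (ℕ → Program) → ℕ → Program} {P : ℕ → Prop}
    (hb : ∀ w', w.Le w' → ∀ u < n, ∀ x, Ev N w' x u → Dec N w' (body x) (P u)) :
    Dec N w (allC (regC 0) body) (∀ u < n, P u) :=
  Dec.all h.two_le (by have := h.n_le; omega) h.ev_n hb

theorem Base.dec_adj (h : Base N E n S w) (hu : u < n) (hv : v < n) (hx : Ev N w x u)
    (hy : Ev N w y v) : Dec N w (adjC x y) (E.Adj u v) :=
  (Ev.get h.two_le 0 (Ev.add h.two_le (Ev.mul h.two_le (by have := h.n_le; omega) hx h.ev_n)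
    hy)).congr (h.adj u hu v hv)

theorem Base.dec_mem (h : Base N E n S w) (hx : Ev N w x v) : Dec N w (memC x) (v ∈ S) :=
  (Ev.get h.two_le 1 hx).congr (h.mem v)

theorem Base.ev_rank (h : Base N E n S w) (hv : v < n) (hx : Ev N w x v) {P : ℕ → Prop}
    {body : (ℕ → Program) → ℕ → Program}
    (hb : ∀ w', w.Le w' → ∀ u < n, ∀ y, Ev N w' y u → Dec N w' (body y) (P u)) :
    Ev N w (sumC x body) (rank P v) :=
  Ev.sum h.two_le (by have := h.n_le; omega) hx fun w' hw u hu y hy =>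
    hb w' hw u (hu.trans hv) y hy

end Base

section Full

variable {N : ℕ} {E : SimpleGraph ℕ} {n : ℕ} {S : Finset ℕ} {k L Q M : ℕ} {w w' : World}
  {x y : ℕ → Program} {t j v : ℕ}

theorem Full.mono (h : Full N E n S k L Q M w) (hw : w.Le w') : Full N E n S k L Q M w' where
  toBase := h.toBase.mono hw
  pow_le := h.pow_le
  Q_pos := h.Q_pos
  reg_one := (hw.2.1 1 (by have := h.lvl; omega)).trans h.reg_one
  reg_two := (hw.2.1 2 (by have := h.lvl; omega)).trans h.reg_two
  reg_three := (hw.2.1 3 (by have := h.lvl; omega)).trans h.reg_three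
  reg_four := (hw.2.1 4 (by have := h.lvl; omega)).trans h.reg_four
  reg_five := (hw.2.1 5 (by have := h.lvl; omega)).trans h.reg_five
  pow := hw.2.2 ▸ h.pow

theorem Full.ev_k (h : Full N E n S k L Q M w) : Ev N w (regC 1) k :=
  (Ev.reg h.two_le (by have := h.lvl; omega)).congr h.reg_one

theorem Full.ev_L (h : Full N E n S k L Q M w) : Ev N w (regC 2) L :=
  (Ev.reg h.two_le (by have := h.lvl; omega)).congr h.reg_two

theorem Full.ev_Q (h : Full N E n S k L Q M w) : Ev N w (regC 3) Q :=
  (Ev.reg h.two_le (by have := h.lvl; omega)).congr h.reg_three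

theorem Full.ev_M (h : Full N E n S k L Q M w) : Ev N w (regC 4) M :=
  (Ev.reg h.two_le (by have := h.lvl; omega)).congr h.reg_four

theorem Full.ev_T (h : Full N E n S k L Q M w) : Ev N w (regC 5) (Q ^ M) :=
  (Ev.reg h.two_le (by have := h.lvl; omega)).congr h.reg_five

/-- The table of powers ends at `Q ^ M`, whereas a wrong guess may ask for a digit at a larger rank.
As `t < Q ^ M`, such a digit is 0, which is the value given by the guard in `digitC`. -/
theorem Full.ev_digit (h : Full N E n S k L Q M w) (ht : t < Q ^ M) (hx : Ev N w x t)
    (hy : Ev N w y j) : Ev N w (digitC x y) (t / Q ^ j % Q) := by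
  have hN := h.two_le
  have htN : t ≤ N := ht.le.trans h.pow_le
  refine (Ev.ite hN (inst := inferInstance) (Dec.le hN hy h.ev_M) (u := t / Q ^ j % Q) (v := 0) (fun hj => ?_)
    fun _ => Ev.const hN 0).congr ?_
  · exact Ev.mod hN ((Nat.div_le_self _ _).trans htN) h.Q_pos
      (Ev.div hN htN (Nat.pow_pos h.Q_pos) hx ((Ev.get hN 2 hy).congr (h.pow j hj))) h.ev_Q
  · split_ifs with hj
    · rfl
    · rw [Nat.div_eq_of_lt (ht.trans_le (Nat.pow_le_pow_right h.Q_pos (by omega))), Nat.zero_mod]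

end Full

/-- The candidate of a guess. -/
def Guess.candidate (g : Guess ℕ) (E : SimpleGraph ℕ) (n : ℕ) (S : Finset ℕ) (L Q : ℕ) :
    Candidate :=
  Candidate.mk E n S L g.d g.r (fun j => g.t₁ / Q ^ j % Q) (fun j => g.t₂ / Q ^ j % Q)
    (fun j => g.t₃ / Q ^ j % Q)

/-- The codes `γ` evaluate to the guess `g`. -/
structure Ready (N : ℕ) (E : SimpleGraph ℕ) (n : ℕ) (S : Finset ℕ) (k L Q M : ℕ)
    (γ : Guess (ℕ → Program)) (g : Guess ℕ) (w : World) : Prop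
    extends Full N E n S k L Q M w where
  ev_d : Ev N w γ.d g.d
  ev_r : Ev N w γ.r g.r
  ev_t₁ : Ev N w γ.t₁ g.t₁
  ev_t₂ : Ev N w γ.t₂ g.t₂
  ev_t₃ : Ev N w γ.t₃ g.t₃
  t₁_lt : g.t₁ < Q ^ M
  t₂_lt : g.t₂ < Q ^ M
  t₃_lt : g.t₃ < Q ^ M

section Ready

variable {N : ℕ} {E : SimpleGraph ℕ} {n : ℕ} {S : Finset ℕ} {k L Q M : ℕ}
  {γ : Guess (ℕ → Program)} {g : Guess ℕ} {w w' : World} {x y : ℕ → Program} {v : ℕ}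

theorem Ready.mono (h : Ready N E n S k L Q M γ g w) (hw : w.Le w') :
    Ready N E n S k L Q M γ g w' where
  toFull := h.toFull.mono hw
  ev_d := h.ev_d.mono hw
  ev_r := h.ev_r.mono hw
  ev_t₁ := h.ev_t₁.mono hw
  ev_t₂ := h.ev_t₂.mono hw
  ev_t₃ := h.ev_t₃.mono hw
  t₁_lt := h.t₁_lt
  t₂_lt := h.t₂_lt
  t₃_lt := h.t₃_lt

/-- This and the following lemmas mirror the definitions in `Candidate` clause by clause. The bound
`v < n` is needed because only then does the computed index address an entry of the adjacency
matrix. -/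
theorem Ready.ev_deg (h : Ready N E n S k L Q M γ g w) (hv : v < n) (hx : Ev N w x v) :
    Ev N w (degC x) ((g.candidate E n S L Q).deg v) :=
  Ev.sum h.two_le (show n ≤ N by have := h.n_le; omega) h.ev_n fun w' hw u hu y hy => by
    have h' := h.mono hw
    exact Dec.and h.two_le (Dec.not h.two_le (h'.dec_mem hy)) (h'.dec_adj hv hu (hx.mono hw) hy)

theorem Ready.dec_isI (h : Ready N E n S k L Q M γ g w) (hv : v < n) (hx : Ev N w x v) :
    Dec N w (isIC γ x) ((g.candidate E n S L Q).IsI v) :=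
  Dec.and h.two_le (Dec.not h.two_le (h.dec_mem hx)) (Dec.lt h.two_le (h.ev_deg hv hx) h.ev_d)

theorem Ready.dec_isK (h : Ready N E n S k L Q M γ g w) (hv : v < n) (hx : Ev N w x v) :
    Dec N w (isKC γ x) ((g.candidate E n S L Q).IsK v) :=
  Dec.and h.two_le (Dec.not h.two_le (h.dec_mem hx))
    (Dec.not h.two_le (Dec.lt h.two_le (h.ev_deg hv hx) h.ev_d))

theorem Ready.ev_digit_rank (h : Ready N E n S k L Q M γ g w) (hv : v < n) (hx : Ev N w x v) :
    Ev N w (digitC γ.t₁ (sumC x memC)) (g.t₁ / Q ^ rank (fun u => u ∈ S) v % Q) :=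
  h.ev_digit h.t₁_lt h.ev_t₁
    (h.ev_rank hv hx fun _ hw _ _ _ hy => (h.mono hw).dec_mem hy)

theorem Ready.dec_inA₁ (h : Ready N E n S k L Q M γ g w) (hv : v < n) (hx : Ev N w x v) :
    Dec N w (inA₁C γ x) ((g.candidate E n S L Q).InA₁ v) := by
  refine Dec.congr (Dec.or h.two_le (Dec.and h.two_le (h.dec_mem hx) (Dec.eq h.two_le
    (h.ev_digit_rank hv hx) (Ev.add h.two_le h.ev_L h.ev_L))) (Dec.eq h.two_le hx h.ev_r)) ?_
  rw [← two_mul]; rfl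

theorem Ready.dec_hit (h : Ready N E n S k L Q M γ g w) (hv : v < n) (hx : Ev N w x v) :
    Dec N w (hitC γ x) ((g.candidate E n S L Q).Hit v) :=
  h.ex fun _ hw _ hu _ hy => Dec.and h.two_le ((h.mono hw).dec_inA₁ hu hy)
    ((h.mono hw).dec_adj hv hu (hx.mono hw) hy)

theorem Ready.dec_inA (h : Ready N E n S k L Q M γ g w) (hv : v < n) (hx : Ev N w x v) :
    Dec N w (inAC γ x) ((g.candidate E n S L Q).InA v) :=
  Dec.or h.two_le (h.dec_inA₁ hv hx) (Dec.and h.two_le (h.dec_isI hv hx)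
    (Dec.not h.two_le (h.dec_hit hv hx)))

theorem Ready.dec_isZ (h : Ready N E n S k L Q M γ g w) (hv : v < n) (hx : Ev N w x v) :
    Dec N w (isZC γ x) ((g.candidate E n S L Q).IsZ v) :=
  Dec.and h.two_le (h.dec_isI hv hx) (h.dec_hit hv hx)

theorem Ready.dec_isR (h : Ready N E n S k L Q M γ g w) (hv : v < n) (hx : Ev N w x v) :
    Dec N w (isRC γ x) ((g.candidate E n S L Q).IsR v) :=
  Dec.and h.two_le (h.dec_isK hv hx) (Dec.not h.two_le (Dec.eq h.two_le hx h.ev_r))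

theorem Ready.dec_isP (h : Ready N E n S k L Q M γ g w) (hv : v < n) (hx : Ev N w x v) :
    Dec N w (isPC γ x) ((g.candidate E n S L Q).IsP v) :=
  Dec.and h.two_le (Dec.not h.two_le (h.dec_inA hv hx)) (Dec.not h.two_le (h.dec_isR hv hx))

theorem Ready.ev_labP (h : Ready N E n S k L Q M γ g w) (hv : v < n) (hx : Ev N w x v) :
    Ev N w (labPC γ x) ((g.candidate E n S L Q).labP v) :=
  Ev.ite h.two_le (h.dec_mem hx) (fun _ => h.ev_digit_rank hv hx)
    fun _ => h.ev_digit h.t₂_lt h.ev_t₂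
      (h.ev_rank hv hx fun _ hw _ hu _ hy => (h.mono hw).dec_isZ hu hy)

theorem Ready.dec_bad (h : Ready N E n S k L Q M γ g w) (hv : v < n) (hx : Ev N w x v) :
    Dec N w (badC γ x) ((g.candidate E n S L Q).Bad v) :=
  Dec.and h.two_le (h.dec_isR hv hx) <| h.ex fun _ hw s hs z hz =>
    Dec.and h.two_le (Dec.and h.two_le ((h.mono hw).dec_isP hs hz)
      (Dec.le h.two_le (h.mono hw).ev_L ((h.mono hw).ev_labP hs hz))) <|
    (h.mono hw).all fun _ hw' s' hs' z' hz' => by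
      have h' := (h.mono hw).mono hw'
      exact Dec.not h.two_le (Dec.and h.two_le (h'.dec_isP hs' hz')
        (Dec.and h.two_le (Dec.eq h.two_le (h'.ev_labP hs' hz') (h'.ev_labP hs (hz.mono hw')))
          (h'.dec_adj hv hs' ((hx.mono hw).mono hw') hz')))

theorem Ready.ev_lab (h : Ready N E n S k L Q M γ g w) (hv : v < n) (hx : Ev N w x v) :
    Ev N w (labC γ x) ((g.candidate E n S L Q).lab v) := by
  refine Ev.ite h.two_le (h.dec_isR hv hx) (fun _ => Ev.ite h.two_le (h.dec_bad hv hx)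
    (fun _ => h.ev_digit h.t₃_lt h.ev_t₃
      (h.ev_rank hv hx fun _ hw _ hu _ hy => (h.mono hw).dec_bad hu hy))
    fun _ => Ev.ite h.two_le (Dec.ex h.two_le (by have := h.n_le; omega) hx
      fun _ hw _ hu _ hy => Dec.and h.two_le ((h.mono hw).dec_isR (hu.trans hv) hy)
        (Dec.not h.two_le ((h.mono hw).dec_bad (hu.trans hv) hy)))
      (fun _ => ?_) fun _ => Ev.const h.two_le 0)
    fun _ => h.ev_labP hv hx
  refine (Ev.add h.two_le (Ev.add h.two_le (Ev.add h.two_le h.ev_L h.ev_L)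
    (Ev.const h.two_le 1)) hx).congr ?_
  rw [← two_mul]; rfl

theorem Ready.dec_check (h : Ready N E n S k L Q M γ g w) :
    Dec N w (checkC γ) ((g.candidate E n S L Q).Check k) := by
  have hN := h.two_le
  refine Dec.and hN ?_ (Dec.and hN ?_ ?_)
  · refine h.all fun w₁ hw₁ u hu x hx => (h.mono hw₁).all fun w₂ hw₂ v hv y hy => ?_
    have h₂ := (h.mono hw₁).mono hw₂
    have hx₂ := hx.mono hw₂
    exact Dec.not hN (Dec.and hN (h₂.dec_inA hu hx₂) (Dec.and hN (h₂.dec_inA hv hy)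
      (h₂.dec_adj hu hv hx₂ hy)))
  · refine h.all fun w₁ hw₁ u hu x hx => (h.mono hw₁).all fun w₂ hw₂ v hv y hy => ?_
    have h₂ := (h.mono hw₁).mono hw₂
    have hx₂ := hx.mono hw₂
    refine Dec.or hN (Dec.or hN (h₂.dec_inA hu hx₂) (Dec.or hN (h₂.dec_inA hv hy)
      (Dec.eq hN (h₂.ev_lab hu hx₂) (h₂.ev_lab hv hy)))) ?_
    refine h₂.ex fun w₃ hw₃ u' hu' x' hx' => (h₂.mono hw₃).ex fun w₄ hw₄ v' hv' y' hy' => ?_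
    have h₄ := (h₂.mono hw₃).mono hw₄
    have hx₄ := (hx₂.mono hw₃).mono hw₄
    have hy₄ := (hy.mono hw₃).mono hw₄
    have hx'₄ := hx'.mono hw₄
    exact Dec.and hN (Dec.and hN (Dec.not hN (h₄.dec_inA hu' hx'₄))
      (Dec.eq hN (h₄.ev_lab hu' hx'₄) (h₄.ev_lab hu hx₄)))
      (Dec.and hN (Dec.and hN (Dec.not hN (h₄.dec_inA hv' hy'))
        (Dec.eq hN (h₄.ev_lab hv' hy') (h₄.ev_lab hv hy₄))) (h₄.dec_adj hu' hv' hx'₄ hy'))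
  · refine Dec.le hN (Ev.sum hN (show n ≤ N by have := h.n_le; omega) h.ev_n fun w₁ hw₁ v hv y hy => ?_) h.ev_k
    have h₁ := h.mono hw₁
    refine Dec.and hN (Dec.not hN (h₁.dec_inA hv hy)) (Dec.ex hN
      (by have := h.n_le; change v < n at hv; omega) hy fun w₂ hw₂ u hu x hx => ?_)
    have h₂ := h₁.mono hw₂
    have hun : u < n := hu.trans hv
    exact Dec.and hN (Dec.not hN (h₂.dec_inA hun hx)) (Dec.eq hN (h₂.ev_lab hun hx)
      (h₂.ev_lab hv (hy.mono hw₂)))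

end Ready

theorem Full.dec_search {N : ℕ} {E : SimpleGraph ℕ} {n : ℕ} {S : Finset ℕ} {k L Q M : ℕ}
    {w : World} (h : Full N E n S k L Q M w) :
    Dec N w searchC (∃ d < n + 1, ∃ r < n + 1, ∃ t₁ < Q ^ M, ∃ t₂ < Q ^ M, ∃ t₃ < Q ^ M,
      (Candidate.mk E n S L d r (fun j => t₁ / Q ^ j % Q) (fun j => t₂ / Q ^ j % Q)
        (fun j => t₃ / Q ^ j % Q)).Check k) := by
  have hN := h.two_le
  have hb : ∀ w', w.Le w' → Ev N w' (addC (regC 0) (constC 1)) (n + 1) := fun w' hw =>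
    Ev.add hN (h.mono hw).ev_n (Ev.const hN 1)
  refine Dec.ex hN h.n_le (hb _ World.Le.rfl) fun w₁ hw₁ d _ xd hd =>
    Dec.ex hN h.n_le (hb _ hw₁) fun w₂ hw₂ r _ xr hr =>
    Dec.ex hN h.pow_le ((h.mono hw₁).mono hw₂).ev_T fun w₃ hw₃ t₁ ht₁ x₁ h₁ =>
    Dec.ex hN h.pow_le (((h.mono hw₁).mono hw₂).mono hw₃).ev_T fun w₄ hw₄ t₂ ht₂ x₂ h₂ =>
    Dec.ex hN h.pow_le ((((h.mono hw₁).mono hw₂).mono hw₃).mono hw₄).ev_T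
      fun w₅ hw₅ t₃ ht₃ x₃ h₃ => ?_
  have h24 := hw₃.trans hw₄
  have h25 := h24.trans hw₅
  have h15 := hw₂.trans h25
  exact Ready.dec_check (g := ⟨d, r, t₁, t₂, t₃⟩)
    { toFull := h.mono (hw₁.trans h15)
      ev_d := hd.mono h15
      ev_r := hr.mono h25
      ev_t₁ := h₁.mono (hw₄.trans hw₅)
      ev_t₂ := h₂.mono hw₅
      ev_t₃ := h₃
      t₁_lt := ht₁
      t₂_lt := ht₂
      t₃_lt := ht₃ }

end RAM

namespace RAM

/-! ### The greedy cover of all obstructions -/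

/-- Code of `SimpleGraph.IsObstruction`. -/
def obstructionC (a b c d e : ℕ → Program) : ℕ → Program :=
  orC
    (andC (adjC a b) (andC (adjC c d) (andC (notC (adjC a c)) (andC (notC (adjC b d))
      (andC (notC (eqC a c)) (andC (notC (eqC b d)) (andC (eqC (adjC a d) (adjC b c))
        (eqC e a))))))))
    (andC (adjC a b) (andC (adjC b c) (andC (adjC c d) (andC (adjC d e) (andC (adjC e a)
      (andC (notC (adjC a c)) (andC (notC (adjC b d)) (andC (notC (adjC c e))
        (andC (notC (adjC d a)) (notC (adjC e b)))))))))))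

/-- Code for an obstruction outside `S`. -/
def newObstructionC (a b c d e : ℕ → Program) : ℕ → Program :=
  andC (andC (notC (memC a)) (andC (notC (memC b)) (andC (notC (memC c)) (andC (notC (memC d))
    (notC (memC e)))))) (obstructionC a b c d e)

theorem ind_eq_ind {p q : Prop} : ind p = ind q ↔ (p ↔ q) := by
  by_cases hp : p <;> by_cases hq : q <;> simp [ind, hp, hq]

theorem Base.dec_newObstruction {N : ℕ} {E : SimpleGraph ℕ} {n : ℕ} {S : Finset ℕ} {w : World}
    (h : Base N E n S w) {a b c d e : ℕ} {xa xb xc xd xe : ℕ → Program} (ha : a < n) (hb : b < n)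
    (hc : c < n) (hd : d < n) (he : e < n) (va : Ev N w xa a) (vb : Ev N w xb b)
    (vc : Ev N w xc c) (vd : Ev N w xd d) (ve : Ev N w xe e) :
    Dec N w (newObstructionC xa xb xc xd xe)
      ((a ∉ S ∧ b ∉ S ∧ c ∉ S ∧ d ∉ S ∧ e ∉ S) ∧ E.IsObstruction a b c d e) := by
  have hN := h.two_le
  have no : ∀ {x p}, Dec N w x p → Dec N w (notC x) (¬ p) := fun h => Dec.not hN h
  have an : ∀ {x y p q}, Dec N w x p → Dec N w y q → Dec N w (andC x y) (p ∧ q) :=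
    fun h h' => Dec.and hN h h'
  refine an (an (no (h.dec_mem va)) (an (no (h.dec_mem vb)) (an (no (h.dec_mem vc))
    (an (no (h.dec_mem vd)) (no (h.dec_mem ve)))))) (Dec.or hN ?_ ?_)
  · refine an (h.dec_adj ha hb va vb) (an (h.dec_adj hc hd vc vd) (an (no (h.dec_adj ha hc va vc))
      (an (no (h.dec_adj hb hd vb vd)) (an (no (Dec.eq hN va vc)) (an (no (Dec.eq hN vb vd))
      (an (Dec.congr (Dec.eq hN (h.dec_adj ha hd va vd) (h.dec_adj hb hc vb vc)) ind_eq_ind)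
        (Dec.eq hN ve va)))))))
  · exact an (h.dec_adj ha hb va vb) (an (h.dec_adj hb hc vb vc) (an (h.dec_adj hc hd vc vd)
      (an (h.dec_adj hd he vd ve) (an (h.dec_adj he ha ve va) (an (no (h.dec_adj ha hc va vc))
      (an (no (h.dec_adj hb hd vb vd)) (an (no (h.dec_adj hc he vc ve))
      (an (no (h.dec_adj hd ha vd va)) (no (h.dec_adj he hb ve vb))))))))))

/-- `S` meets every set that meets all obstructions in at least a fifth of its elements. -/
def IsFrugal (E : SimpleGraph ℕ) (n : ℕ) (S : Finset ℕ) : Prop :=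
  S ⊆ Finset.range n ∧
  ∀ X : Finset ℕ, (∀ a < n, ∀ b < n, ∀ c < n, ∀ d < n, ∀ e < n, E.IsObstruction a b c d e →
    a ∈ X ∨ b ∈ X ∨ c ∈ X ∨ d ∈ X ∨ e ∈ X) → S.card ≤ 5 * (S ∩ X).card

/-- The new obstruction is disjoint from `S`, and `X` must contain one of its vertices. So at most
five new elements of `S` pay for at least one new element of `X`. -/
theorem IsFrugal.insert_obstruction {E : SimpleGraph ℕ} {n : ℕ} {S : Finset ℕ} (h : IsFrugal E n S)
    {a b c d e : ℕ} (ha : a < n) (hb : b < n) (hc : c < n) (hd : d < n) (he : e < n)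
    (hS : a ∉ S ∧ b ∉ S ∧ c ∉ S ∧ d ∉ S ∧ e ∉ S) (hobs : E.IsObstruction a b c d e) :
    IsFrugal E n (insert e (insert d (insert c (insert b (insert a S))))) := by
  refine ⟨?_, fun X hX => ?_⟩
  · simp only [Finset.insert_subset_iff, Finset.mem_range]
    exact ⟨he, hd, hc, hb, ha, h.1⟩
  · have h1 := h.2 X hX
    set S' := insert e (insert d (insert c (insert b (insert a S)))) with hS'
    have h2 : S'.card ≤ S.card + 5 := by
      rw [hS']
      have i1 := Finset.card_insert_le a S
      have i2 := Finset.card_insert_le b (insert a S)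
      have i3 := Finset.card_insert_le c (insert b (insert a S))
      have i4 := Finset.card_insert_le d (insert c (insert b (insert a S)))
      have i5 := Finset.card_insert_le e (insert d (insert c (insert b (insert a S))))
      omega
    have h3 : (S ∩ X).card < (S' ∩ X).card := by
      refine Finset.card_lt_card ((Finset.ssubset_iff_of_subset fun x hx => ?_).2 ?_)
      · simp only [hS', Finset.mem_inter, Finset.mem_insert] at hx ⊢
        tauto
      · simp only [hS', Finset.mem_inter, Finset.mem_insert]
        rcases hX a ha b hb c hc d hd e he hobs with hx | hx | hx | hx | hx
        · exact ⟨a, by tauto⟩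
        · exact ⟨b, by tauto⟩
        · exact ⟨c, by tauto⟩
        · exact ⟨d, by tauto⟩
        · exact ⟨e, by tauto⟩
    omega

/-- The memory `s` differs from `s₀` in registers from `ℓ` on and in array `1`, which holds
the frugal set `S`. -/
def Marked (E : SimpleGraph ℕ) (n : ℕ) (s₀ : State) (ℓ : ℕ) (S : Finset ℕ) (s : State) : Prop :=
  (∀ x < ℓ, s.reg x = s₀.reg x) ∧ (∀ a, a ≠ 1 → s.arr a = s₀.arr a) ∧
    (∀ v, s.arr 1 v = ind (v ∈ S)) ∧ IsFrugal E n S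

/-- `p` enlarges the set in array `1` to a frugal set with the property `post`. -/
def Enlarges (N : ℕ) (E : SimpleGraph ℕ) (n : ℕ) (s₀ : State) (ℓ : ℕ) (p : Program)
    (post : Finset ℕ → Prop) : Prop :=
  ∀ S s, Marked E n s₀ ℓ S s → ∃ S' s', Exec N p s s' ∧ Marked E n s₀ ℓ S' s' ∧ S ⊆ S' ∧ post S'

/-- The loop in which register `x` runs through `0, …, n - 1`. -/
def forP (x : ℕ) (p : Program) : Program :=
  .seq (.assign x (.const 0)) (.loop (.sub (.reg 0) (.reg x))
    (.seq p (.assign x (.add (.reg x) (.const 1)))))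

/-- Since the marked set only grows and `post` is monotone in it, what one iteration achieves
persists. The framework of `Ev` does not cover these loops, because they write to an array. -/
theorem Enlarges.for {N : ℕ} {E : SimpleGraph ℕ} {n : ℕ} {s₀ : State} {ℓ : ℕ} {p : Program}
    {post : ℕ → Finset ℕ → Prop} (hN : 2 ≤ N) (hn : n ≤ N) (hℓ : 0 < ℓ) (h0 : s₀.reg 0 = n)
    (hmono : ∀ i S S', S ⊆ S' → post i S → post i S')
    (hp : ∀ i < n, Enlarges N E n (s₀.setReg ℓ i) (ℓ + 1) p (post i)) :
    Enlarges N E n s₀ ℓ (forP ℓ p) (fun S => ∀ i < n, post i S) := by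
  intro S s hs
  let I : ℕ → State → Prop := fun i t => ∃ S', Marked E n s₀ ℓ S' t ∧ S ⊆ S' ∧ t.reg ℓ = i ∧
    ∀ j < i, post j S'
  have hset : ∀ (S : Finset ℕ) (t : State) (v : ℕ), Marked E n s₀ ℓ S t →
      Marked E n s₀ ℓ S (t.setReg ℓ v) := fun S t v h =>
    ⟨fun x hx => (setReg_reg_of_ne _ _ hx.ne).trans (h.1 x hx), h.2⟩
  have hI0 : I 0 (s.setReg ℓ 0) :=
    ⟨S, hset _ _ _ hs, subset_rfl, by simp, fun j hj => absurd hj (Nat.not_lt_zero j)⟩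
  have key : ∃ s', Exec N (.loop (.sub (.reg 0) (.reg ℓ))
      (.seq p (.assign ℓ (.add (.reg ℓ) (.const 1))))) (s.setReg ℓ 0) s' ∧ I n s' := by
    refine Exec.loop hN hn I ?_ ?_ hI0
    · rintro i hi t ⟨S₁, hm, hSS, hti, hpost⟩
      have ht0 : t.reg 0 = n := (hm.1 0 hℓ).trans h0
      refine ⟨by simp only [Expr.eval, ht0, hti]; omega, ?_⟩
      obtain ⟨S₂, t', he, hm', hSS', hpost'⟩ := hp i hi S₁ t ⟨fun x hx => by
        rcases Nat.lt_succ_iff_lt_or_eq.1 hx with hx | rfl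
        · rw [setReg_reg_of_ne _ _ hx.ne, hm.1 x hx]
        · rw [setReg_reg_self, hti], hm.2⟩
      have hm'' : Marked E n s₀ ℓ S₂ t' := ⟨fun x hx => by
        rw [hm'.1 x (by omega), setReg_reg_of_ne _ _ hx.ne], hm'.2⟩
      have hti' : t'.reg ℓ = i := by rw [hm'.1 ℓ (by omega), setReg_reg_self]
      refine ⟨_, he.seq hN (Exec.assign hN _ _ _), S₂, hset _ _ _ hm'', hSS.trans hSS', ?_, ?_⟩
      · rw [setReg_reg_self]
        simp only [Expr.eval, hti']
      · intro j hj
        rcases Nat.lt_succ_iff_lt_or_eq.1 hj with hj | rfl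
        · exact hmono j _ _ hSS' (hpost j hj)
        · exact hpost'
    · rintro t ⟨S₁, hm, -, hti, -⟩
      have ht0 : t.reg 0 = n := (hm.1 0 hℓ).trans h0
      simp [Expr.eval, ht0, hti]
  obtain ⟨s', he, S', hm, hSS, -, hpost⟩ := key
  exact ⟨S', s', (Exec.assign hN _ _ _).seq hN he, hm, hSS, hpost⟩

/-- Put the value of register `x` into the set in array `1`. -/
def markP (x : ℕ) : Program := .store 1 (.reg x) (.const 1)

/-- Put the vertices in registers `6, …, 10` into the set in array `1` if they form an obstruction
outside this set. -/
def markObstructionP : Program :=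
  .seq (newObstructionC (regC 6) (regC 7) (regC 8) (regC 9) (regC 10) 11)
    (.ite (.reg 11)
      (.seq (markP 6) (.seq (markP 7) (.seq (markP 8) (.seq (markP 9) (markP 10)))))
      .skip)

/-- Compute a small set that meets all obstructions. -/
def coverP : Program :=
  forP 6 (forP 7 (forP 8 (forP 9 (forP 10 markObstructionP))))

theorem ind_mem_insert (S : Finset ℕ) (f : ℕ → ℕ) (x : ℕ) (h : ∀ v, f v = ind (v ∈ S)) (v : ℕ) :
    Function.update f x 1 v = ind (v ∈ insert x S) := by
  by_cases hv : v = x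
  · subst hv
    rw [Function.update_self, ind_true (Finset.mem_insert_self _ _)]
  · rw [Function.update_of_ne hv, h]
    exact ind_congr (by simp [hv])

theorem exec_mark {N : ℕ} (hN : 2 ≤ N) {S : Finset ℕ} {s : State}
    (h : ∀ v, s.arr 1 v = ind (v ∈ S)) (x : ℕ) :
    ∃ s', Exec N (markP x) s s' ∧ s'.reg = s.reg ∧ (∀ a, a ≠ 1 → s'.arr a = s.arr a) ∧
      ∀ v, s'.arr 1 v = ind (v ∈ insert (s.reg x) S) := by
  refine ⟨_, Exec.store hN _ _ _ _, rfl, fun a ha => Function.update_of_ne ha _ _, fun v => ?_⟩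
  simp only [State.setArr, Expr.eval, Function.update_self]
  exact ind_mem_insert S _ _ h v

theorem enlarges_markObstructionP {N : ℕ} {E : SimpleGraph ℕ} {n : ℕ} {s₀ : State} (hN : 2 ≤ N)
    (hn : n + 1 ≤ N) (h0 : s₀.reg 0 = n)
    (hadj : ∀ u < n, ∀ v < n, s₀.arr 0 (u * n + v) = ind (E.Adj u v))
    (h6 : s₀.reg 6 < n) (h7 : s₀.reg 7 < n) (h8 : s₀.reg 8 < n) (h9 : s₀.reg 9 < n)
    (h10 : s₀.reg 10 < n) :
    Enlarges N E n s₀ 11 markObstructionP fun S => s₀.reg 6 ∉ S → s₀.reg 7 ∉ S → s₀.reg 8 ∉ S →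
      s₀.reg 9 ∉ S → s₀.reg 10 ∉ S →
      ¬ E.IsObstruction (s₀.reg 6) (s₀.reg 7) (s₀.reg 8) (s₀.reg 9) (s₀.reg 10) := by
  rintro S s ⟨hr, ha, hS, hf⟩
  have hbase : Base N E n S ⟨s, 11⟩ :=
    { two_le := hN
      n_le := hn
      lvl := by simp
      reg_zero := (hr 0 (by omega)).trans h0
      adj := fun u hu v hv => by rw [← hadj u hu v hv, ← ha 0 (by omega)]
      mem := hS }
  have hev : ∀ x < 11, Ev N ⟨s, 11⟩ (regC x) (s₀.reg x) := fun x hx =>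
    (Ev.reg hN (w := ⟨s, 11⟩) hx).congr (hr x hx)
  obtain ⟨s₁, e₁, ag, hv⟩ := hbase.dec_newObstruction h6 h7 h8 h9 h10 (hev 6 (by omega))
    (hev 7 (by omega)) (hev 8 (by omega)) (hev 9 (by omega)) (hev 10 (by omega)) ⟨s, 11⟩ World.Le.rfl
  have hr₁ : ∀ x < 11, s₁.reg x = s₀.reg x := fun x hx => (ag.1 x hx).trans (hr x hx)
  by_cases hobs : (s₀.reg 6 ∉ S ∧ s₀.reg 7 ∉ S ∧ s₀.reg 8 ∉ S ∧ s₀.reg 9 ∉ S ∧ s₀.reg 10 ∉ S) ∧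
      E.IsObstruction (s₀.reg 6) (s₀.reg 7) (s₀.reg 8) (s₀.reg 9) (s₀.reg 10)
  · rw [ind_true hobs] at hv
    obtain ⟨s₂, e₂, r₂, a₂, m₂⟩ := exec_mark hN (s := s₁) (S := S) (by rw [ag.2]; exact hS) 6
    obtain ⟨s₃, e₃, r₃, a₃, m₃⟩ := exec_mark hN m₂ 7
    obtain ⟨s₄, e₄, r₄, a₄, m₄⟩ := exec_mark hN m₃ 8
    obtain ⟨s₅, e₅, r₅, a₅, m₅⟩ := exec_mark hN m₄ 9
    obtain ⟨s₆, e₆, r₆, a₆, m₆⟩ := exec_mark hN m₅ 10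
    rw [r₅, r₄, r₃, r₂, hr₁ 6 (by omega), hr₁ 7 (by omega), hr₁ 8 (by omega), hr₁ 9 (by omega),
      hr₁ 10 (by omega)] at m₆
    refine ⟨_, s₆, e₁.seq hN (Exec.iteTrue hN (by simp only [Expr.eval]; exact hv ▸ one_ne_zero)
      (e₂.seq hN (e₃.seq hN (e₄.seq hN (e₅.seq hN e₆))))), ⟨?_, ?_, m₆,
        hf.insert_obstruction h6 h7 h8 h9 h10 hobs.1 hobs.2⟩, fun x hx => ?_, fun h => ?_⟩
    · intro x hx
      rw [r₆, r₅, r₄, r₃, r₂, hr₁ x hx]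
    · intro a h1
      rw [a₆ a h1, a₅ a h1, a₄ a h1, a₃ a h1, a₂ a h1, ag.2]
      exact ha a h1
    · simp only [Finset.mem_insert]; tauto
    · simp at h
  · rw [ind_false hobs] at hv
    refine ⟨S, s₁, e₁.seq hN (Exec.iteFalse hN hv (Exec.skip hN _)), ⟨hr₁, ?_, ?_, hf⟩, subset_rfl,
      fun h1 h2 h3 h4 h5 h => hobs ⟨⟨h1, h2, h3, h4, h5⟩, h⟩⟩
    · rw [ag.2]; exact ha
    · rw [ag.2]; exact hS

/-- A single pass over all quintuples suffices: one that is handled meets the set afterwards or is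
no obstruction, and the set never shrinks. The empty set is frugal. -/
theorem exec_coverP {N : ℕ} {E : SimpleGraph ℕ} {n : ℕ} {s₀ : State} (hN : 2 ≤ N)
    (hn : n + 1 ≤ N) (h0 : s₀.reg 0 = n)
    (hadj : ∀ u < n, ∀ v < n, s₀.arr 0 (u * n + v) = ind (E.Adj u v))
    (h1 : ∀ v, s₀.arr 1 v = 0) :
    ∃ S s, Exec N coverP s₀ s ∧ IsSmallCover E n S ∧ (∀ x < 6, s.reg x = s₀.reg x) ∧
      (∀ a, a ≠ 1 → s.arr a = s₀.arr a) ∧ ∀ v, s.arr 1 v = ind (v ∈ S) := by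
  have hn' : n ≤ N := by omega
  have key : Enlarges N E n s₀ 6 coverP fun S => ∀ a < n, ∀ b < n, ∀ c < n, ∀ d < n, ∀ e < n,
      a ∉ S → b ∉ S → c ∉ S → d ∉ S → e ∉ S → ¬ E.IsObstruction a b c d e := by
    refine Enlarges.for hN hn' (by omega) h0 ?_ fun a ha => ?_
    · intro a S S' hS h b hb c hc d hd e he h1 h2 h3 h4 h5
      exact h b hb c hc d hd e he (fun x => h1 (hS x)) (fun x => h2 (hS x)) (fun x => h3 (hS x))
        (fun x => h4 (hS x)) fun x => h5 (hS x)
    refine Enlarges.for hN hn' (by omega) h0 ?_ fun b hb => ?_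
    · intro b S S' hS h c hc d hd e he h1 h2 h3 h4 h5
      exact h c hc d hd e he (fun x => h1 (hS x)) (fun x => h2 (hS x)) (fun x => h3 (hS x))
        (fun x => h4 (hS x)) fun x => h5 (hS x)
    refine Enlarges.for hN hn' (by omega) h0 ?_ fun c hc => ?_
    · intro c S S' hS h d hd e he h1 h2 h3 h4 h5
      exact h d hd e he (fun x => h1 (hS x)) (fun x => h2 (hS x)) (fun x => h3 (hS x))
        (fun x => h4 (hS x)) fun x => h5 (hS x)
    refine Enlarges.for hN hn' (by omega) h0 ?_ fun d hd => ?_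
    · intro d S S' hS h e he h1 h2 h3 h4 h5
      exact h e he (fun x => h1 (hS x)) (fun x => h2 (hS x)) (fun x => h3 (hS x))
        (fun x => h4 (hS x)) fun x => h5 (hS x)
    refine Enlarges.for hN hn' (by omega) h0 ?_ fun e he => ?_
    · intro e S S' hS h h1 h2 h3 h4 h5
      exact h (fun x => h1 (hS x)) (fun x => h2 (hS x)) (fun x => h3 (hS x))
        (fun x => h4 (hS x)) fun x => h5 (hS x)
    exact enlarges_markObstructionP hN hn h0 hadj ha hb hc hd he
  obtain ⟨S, s, he, ⟨hr, ha, hm, hf⟩, -, hpost⟩ := key ∅ s₀ ⟨fun _ _ => rfl, fun _ _ => rfl,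
    fun v => by rw [h1]; exact (ind_false (by simp)).symm, by simp, fun X _ => by simp⟩
  exact ⟨S, s, he, ⟨hf.1, hpost, hf.2⟩, hr, ha, hm⟩

/-! ### The table of powers -/

/-- Put `L`, `Q`, `M` into registers `2`, `3`, `4`. -/
def constantsP : Program :=
  .seq (.assign 5 (.add (.reg 1) (.reg 1)))
    (.seq (.assign 4 (.add (.reg 5) (.reg 1)))
      (.seq (.assign 4 (.add (.reg 4) (.reg 4)))
        (.seq (.assign 4 (.add (.reg 4) (.reg 1)))
          (.seq (.assign 4 (.add (.add (.reg 4) (.reg 4)) (.const 1)))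
            (.seq (.assign 2 (.add (.reg 4) (.const 1)))
              (.assign 3 (.add (.add (.reg 2) (.reg 2)) (.const 1))))))))

/-- Put the powers of `Q` into array `2` and `Q ^ M` into register `5`. -/
def powersP : Program :=
  .seq (.store 2 (.const 0) (.const 1)) (.seq (.assign 6 (.const 0))
    (.seq (.loop (.sub (.reg 4) (.reg 6)) (.seq (mulC (regC 3) (getC 2 (regC 6)) 7)
      (.seq (.store 2 (.add (.reg 6) (.const 1)) (.reg 7))
        (.assign 6 (.add (.reg 6) (.const 1))))))
      (.assign 5 (.get 2 (.reg 4)))))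

/-- Multiplication is not elementary, so `14 * k + 1` is built as 2 (2 (2k + k) + k) + 1. -/
theorem exec_constantsP {N : ℕ} (hN : 2 ≤ N) (s : State) :
    ∃ s', Exec N constantsP s s' ∧ s'.arr = s.arr ∧ s'.reg 0 = s.reg 0 ∧ s'.reg 1 = s.reg 1 ∧
      s'.reg 2 = 14 * s.reg 1 + 2 ∧ s'.reg 3 = 28 * s.reg 1 + 5 ∧ s'.reg 4 = 14 * s.reg 1 + 1 := by
  refine ⟨_, (Exec.assign hN _ _ _).seq hN ((Exec.assign hN _ _ _).seq hN
    ((Exec.assign hN _ _ _).seq hN ((Exec.assign hN _ _ _).seq hN ((Exec.assign hN _ _ _).seq hN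
    ((Exec.assign hN _ _ _).seq hN (Exec.assign hN _ _ _)))))), rfl, ?_, ?_, ?_, ?_, ?_⟩ <;>
  simp [State.setReg, Expr.eval, Function.update] <;> omega

theorem exec_powersP {N : ℕ} (hN : 2 ≤ N) (s : State) {Q M : ℕ} (hQ : s.reg 3 = Q)
    (hM : s.reg 4 = M) (hQN : Q ≤ N) (hMN : M ≤ N) :
    ∃ s', Exec N powersP s s' ∧ (∀ x < 5, s'.reg x = s.reg x) ∧ s'.reg 5 = Q ^ M ∧
      (∀ a, a ≠ 2 → s'.arr a = s.arr a) ∧ ∀ j ≤ M, s'.arr 2 j = Q ^ j := by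
  let I : ℕ → State → Prop := fun i t => (∀ x < 5, t.reg x = s.reg x) ∧ t.reg 6 = i ∧
    (∀ a, a ≠ 2 → t.arr a = s.arr a) ∧ ∀ j ≤ i, t.arr 2 j = Q ^ j
  have h0 : I 0 ((s.setArr 2 0 1).setReg 6 0) := by
    refine ⟨fun x hx => ?_, by simp, fun a ha => ?_, fun j hj => ?_⟩
    · rw [setReg_reg_of_ne _ _ (by omega)]; rfl
    · exact Function.update_of_ne ha _ _
    · obtain rfl : j = 0 := by omega
      simp [State.setArr]
  have key : ∃ s', Exec N (.loop (.sub (.reg 4) (.reg 6))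
      (.seq (mulC (regC 3) (getC 2 (regC 6)) 7) (.seq (.store 2 (.add (.reg 6) (.const 1)) (.reg 7))
        (.assign 6 (.add (.reg 6) (.const 1)))))) ((s.setArr 2 0 1).setReg 6 0) s' ∧ I M s' := by
    refine Exec.loop hN hMN I ?_ ?_ h0
    · rintro i hi t ⟨hr, h6, ha, hp⟩
      have h4 := (hr 4 (by omega)).trans hM
      have h3 := (hr 3 (by omega)).trans hQ
      refine ⟨by simp only [Expr.eval, h4, h6]; omega, ?_⟩
      -- The product is computed by `Q` additions at level 7, above the loop counter in register 6.
      obtain ⟨t', e, ag, hv⟩ := Ev.mul hN hQN ((Ev.reg hN (w := ⟨t, 7⟩) (x := 3) (by simp)).congr h3)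
        (Ev.get hN 2 ((Ev.reg hN (w := ⟨t, 7⟩) (x := 6) (by simp)).congr h6)) ⟨t, 7⟩ World.Le.rfl
      simp only [hp i le_rfl] at hv
      have h6' : t'.reg 6 = i := (ag.1 6 (by simp)).trans h6
      refine ⟨_, e.seq hN ((Exec.store hN _ _ _ _).seq hN (Exec.assign hN _ _ _)), ?_, ?_, ?_, ?_⟩
      · intro x hx
        rw [setReg_reg_of_ne _ _ (by omega)]
        exact (ag.1 x (by simp; omega)).trans (hr x hx)
      · rw [setReg_reg_self]
        simp only [Expr.eval, State.setArr, h6']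
      · intro a h2
        rw [setReg_arr]
        refine (Function.update_of_ne h2 _ _).trans ?_
        rw [ag.2]; exact ha a h2
      · intro j hj
        simp only [setReg_arr, State.setArr, Expr.eval, Function.update_self, h6', hv]
        by_cases hji : j = i + 1
        · rw [hji, Function.update_self, pow_succ']
        · rw [Function.update_of_ne hji, ag.2]
          exact hp j (by omega)
    · rintro t ⟨hr, h6, -, -⟩
      have h4 := (hr 4 (by omega)).trans hM
      simp [Expr.eval, h4, h6]
  obtain ⟨s', e, hr, h6, ha, hp⟩ := key
  refine ⟨_, (Exec.store hN _ _ _ _).seq hN ((Exec.assign hN _ _ _).seq hN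
    (e.seq hN (Exec.assign hN _ _ _))), ?_, ?_, ha, hp⟩
  · intro x hx
    rw [setReg_reg_of_ne _ _ (by omega), hr x hx]
  · rw [setReg_reg_self]
    simp only [Expr.eval, hr 4 (by omega), hM, hp M le_rfl]

/-! ### The main program -/

/-- The program for Split-Identification. -/
def mainP : Program :=
  .seq constantsP (.seq powersP (.seq coverP (.seq (searchC 6) (.assign 0 (.reg 6)))))

/-- Quotient and remainder modulo `n` recover the row and the column from the cell index. -/
theorem input_arr_zero {n : ℕ} (G : SimpleGraph (Fin n)) (k : ℕ) {u v : ℕ} (hu : u < n)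
    (hv : v < n) : (input G k).arr 0 (u * n + v) =
      ind ((G.map (Fin.valEmbedding : Fin n ↪ ℕ)).Adj u v) := by
  have h1 : (input G k).arr 0 (u * n + v) =
      ind (0 = 0 ∧ ∃ i j : Fin n, u * n + v = i * n + j ∧ G.Adj i j) := by
    simp only [input, ind]
    congr
  refine h1.trans (ind_congr ⟨?_, fun h => ⟨rfl, ⟨u, hu⟩, ⟨v, hv⟩, rfl, (SimpleGraph.map_val_adj G ⟨u, hu⟩ ⟨v, hv⟩).1 h⟩⟩)
  rintro ⟨-, i, j, e, h⟩
  have hn : 0 < n := by omega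
  have e1 := congrArg (· / n) e
  have e2 := congrArg (· % n) e
  simp only [Nat.add_comm _ v, Nat.add_comm _ (j : ℕ), Nat.add_mul_div_right _ _ hn,
    Nat.add_mul_mod_self_right, Nat.div_eq_of_lt hv, Nat.div_eq_of_lt j.2, Nat.mod_eq_of_lt hv,
    Nat.mod_eq_of_lt j.2, Nat.zero_add] at e1 e2
  subst e1 e2
  exact (SimpleGraph.map_val_adj G i j).2 h

theorem exec_mainP {n k : ℕ} (G : SimpleGraph (Fin n)) (hn : 1 ≤ n) :
    ∃ s, Exec ((28 * k + 5) ^ (14 * k + 1) * (n + 1)) mainP (input G k) s ∧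
      s.reg 0 = ind (G.SplitIdentification k) := by
  set Q := 28 * k + 5 with hQ
  set M := 14 * k + 1 with hM
  -- This number bounds the iterations of every loop: over vertices, thresholds and guesses, and
  -- inside products, quotients and the table of powers.
  set N := Q ^ M * (n + 1) with hNdef
  have hT : Q ^ M ≤ N := Nat.le_mul_of_pos_right _ (by omega)
  have hQT : Q ≤ Q ^ M := Nat.le_self_pow (by omega) _
  have hMT : M < Q ^ M := Nat.lt_pow_self (by omega)
  have hnN : n + 1 ≤ N := Nat.le_mul_of_pos_left _ (by omega)
  have hN : 2 ≤ N := by omega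
  obtain ⟨s₁, e₁, a₁, r0, r1, r2, r3, r4⟩ := exec_constantsP hN (input G k)
  have i0 : (input G k).reg 0 = n := rfl
  have i1 : (input G k).reg 1 = k := rfl
  rw [i0] at r0
  rw [i1] at r1 r2 r3 r4
  obtain ⟨s₂, e₂, r₂, t₂, a₂, p₂⟩ := exec_powersP hN s₁ (Q := Q) (M := M) r3 r4 (by omega) (by omega)
  have hadj : ∀ u < n, ∀ v < n, s₂.arr 0 (u * n + v) =
      ind ((G.map (Fin.valEmbedding : Fin n ↪ ℕ)).Adj u v) := fun u hu v hv => by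
    rw [a₂ 0 (by omega), a₁, input_arr_zero G k hu hv]
  obtain ⟨S, s₃, e₃, hS, r₃, a₃, m₃⟩ := exec_coverP hN hnN ((r₂ 0 (by omega)).trans r0) hadj
    (fun v => by rw [a₂ 1 (by omega), a₁]; simp [input])
  have hreg : ∀ x < 5, s₃.reg x = s₁.reg x := fun x hx => (r₃ x (by omega)).trans (r₂ x hx)
  have hfull : Full N (G.map (Fin.valEmbedding : Fin n ↪ ℕ)) n S k (14 * k + 2) Q M ⟨s₃, 6⟩ :=
    { two_le := hN
      n_le := hnN
      lvl := le_rfl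
      reg_zero := (hreg 0 (by omega)).trans r0
      adj := fun u hu v hv => by rw [← hadj u hu v hv, ← a₃ 0 (by omega)]
      mem := m₃
      pow_le := hT
      Q_pos := by omega
      reg_one := (hreg 1 (by omega)).trans r1
      reg_two := (hreg 2 (by omega)).trans r2
      reg_three := (hreg 3 (by omega)).trans r3
      reg_four := (hreg 4 (by omega)).trans r4
      reg_five := (r₃ 5 (by omega)).trans t₂
      pow := fun j hj => by rw [← p₂ j hj, ← a₃ 2 (by omega)] }
  obtain ⟨s₄, e₄, -, h₄⟩ := hfull.dec_search ⟨s₃, 6⟩ World.Le.rfl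
  refine ⟨_, e₁.seq hN (e₂.seq hN (e₃.seq hN (e₄.seq hN (Exec.assign hN _ _ _)))), ?_⟩
  rw [setReg_reg_self]
  refine h₄.trans (ind_congr ?_)
  exact (splitIdentification_iff_exists_candidate hn rfl hS hM (by omega) (by omega)).symm

/-! ### The running time -/

theorem code_bound (k : ℕ) :
    (28 * k + 5) ^ (14 * k + 1) ≤ 33 ^ 15 * k ^ (105 * k) := by
  rcases Nat.lt_or_ge k 2 with hk | hk
  -- For `k = 0` and `k = 1` the power of `k` is 1, so the constant must carry the bound; `33 ^ 15`
  -- is the exact value at `k = 1`.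
  · interval_cases k <;> norm_num
  · have h1 : 28 * k + 5 ≤ k ^ 7 := by
      have : 2 ^ 6 ≤ k ^ 6 := Nat.pow_le_pow_left hk 6
      calc 28 * k + 5 ≤ 2 ^ 6 * k := by omega
        _ ≤ k ^ 6 * k := Nat.mul_le_mul_right _ this
        _ = k ^ 7 := (pow_succ _ _).symm
    calc (28 * k + 5) ^ (14 * k + 1) ≤ (k ^ 7) ^ (14 * k + 1) := Nat.pow_le_pow_left h1 _
      _ ≤ (k ^ 7) ^ (15 * k) := Nat.pow_le_pow_right (Nat.pow_pos (by omega)) (by omega)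
      _ = k ^ (105 * k) := by rw [← pow_mul]; congr 1; ring
      _ ≤ 33 ^ 15 * k ^ (105 * k) := Nat.le_mul_of_pos_left _ (by positivity)

end RAM

theorem mainTheorem7 :
    ∃ (P : RAM.Program) (C c d : ℕ), ∀ (n k : ℕ) (G : SimpleGraph (Fin n)), 1 ≤ n →
      RAM.DecidesWithin P G k (G.SplitIdentification k) (C * k ^ (c * k) * n ^ d) := by
  refine ⟨RAM.mainP, (33 ^ 15 * 2) ^ RAM.mainP.deg, 105 * RAM.mainP.deg, RAM.mainP.deg, ?_⟩
  -- Only the independence of the degree from the instance matters, so its value is kept opaque.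
  -- Below, `n + 1 ≤ 2 * n` uses that the graph has a vertex.
  generalize hD : RAM.mainP.deg = D
  intro n k G hn
  obtain ⟨s, ⟨t, hr, ht⟩, hs⟩ := RAM.exec_mainP (k := k) G hn
  refine ⟨t, s, hr, ht.trans ?_, fun h => hs.trans (RAM.ind_true h),
    fun h => hs.trans (RAM.ind_false h)⟩
  rw [hD]
  calc ((28 * k + 5) ^ (14 * k + 1) * (n + 1)) ^ D
      ≤ (33 ^ 15 * k ^ (105 * k) * (2 * n)) ^ D :=
        Nat.pow_le_pow_left (Nat.mul_le_mul (RAM.code_bound k) (by omega)) _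
    _ = (33 ^ 15 * 2) ^ D * k ^ (105 * D * k) * n ^ D := by
        rw [show 33 ^ 15 * k ^ (105 * k) * (2 * n) = 33 ^ 15 * 2 * k ^ (105 * k) * n by ring,
          mul_pow, mul_pow, ← pow_mul]
        congr 3
        ring
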